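/- Let $T>0$, let $A\in L^\infty(\mathbb{R},\mathbb{R}^{d\times d})$ and $B\in L^\infty(\mathbb{R},\mathbb{R}^{d\times m})$ be $T$-periodic, let $U\subset\mathbb{R}^m$ be a bounded convex neighborhood of $0$, and let $\mathcal{U}$ be the set of all $u\in L^\infty(\mathbb{R},\mathbb{R}^m)$ with $u(t)\in U$ for almost all $t$. Denote by $\varphi(t;t_0,x_0,u)$ the Carathéodory solution of $$\dot x(t)=A(t)x(t)+B(t)u(t),\qquad x(t_0)=x_0,$$ and by $X(t,s)$ the principal fundamental solution of $\dot x=A(t)x$, so that $X(s,s)=I$. Assume that the system without control restrictions is controllable: for all $x_1,x_2\in\mathbb{R}^d$ and $t_0\in\mathbb{R}$ there are $t_1>t_0$ and a bounded measurable control $u$ with $\varphi(t_1;t_0,x_1,u)=x_2$. *Autonomized system.* Let $\mathbb{S}^1=\mathbb{R}/T\mathbb{Z}$, parametrized by $\tau\in[0,T)$. On $\mathbb{S}^1\times\mathbb{R}^d$ put $\varphi^a(t;(\tau,x),u)=(\tau+t \bmod T,\ \varphi(\tau+t;\tau,x,u))$ for $u\in\mathcal{U}$. Let $\mathbf{R}^a(p)=\{\varphi^a(t;p,u):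 t\ge0,\ u\in\mathcal{U}\}$ and $\mathbf{C}^a(p)=\{q:\ p\in\mathbf{R}^a(q)\}$. A control set is a nonvoid set $D\subset\mathbb{S}^1\times\mathbb{R}^d$ such that (i) for each $p\in D$ there is $u\in\mathcal{U}$ with $\varphi^a(t;p,u)\in D$ for all $t\ge0$, (ii) $D\subset\overline{\mathbf{R}^a(p)}$ for each $p\in D$, and (iii) $D$ is maximal with (i) and (ii). *Spectral subbundles.* For $\tau\in[0,T)$ let $E^-_\tau$, $E^0_\tau$, $E^+_\tau$ be the sums of the real generalized eigenspaces of $X(T+\tau,\tau)$ for the eigenvalues $\mu\in\mathbb{C}$ with $\frac1T\log|\mu|<0$, $=0$, $>0$, respectively (the real generalized eigenspace for $\mu$ consists of the real parts of the vectors in the complex generalized eigenspace), and let $\mathcal{E}^0=\{(\tau,x): x\in E^0_\tau\}$. Let $$K^-_\tau=E^-_\tau\cap\operatorname{int}\bigcup_{k\in\mathbb{N}}\{\varphi(kT+\tau;0,0,u): u\in\mathcal{U}\},$$ $$K^+_\tau=E^+_\tau\cap\operatorname{int}\bigcup_{k\in\mathbb{N},\,kT\ge\tau}\{y:\ \exists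 u\in\mathcal{U},\ \varphi(0;-kT+\tau,y,u)=0\},$$ with $\mathbb{N}=\{0,1,2,\dots\}$, and $\mathcal{K}^\pm=\{(\tau,x): x\in K^\pm_\tau\}\subset\mathbb{S}^1\times\mathbb{R}^d$. Let $Y(\tau)=X(dT+\tau,\tau)$. Below, $\oplus$ and the action of $Y(\cdot)^{\pm1}$ on subsets of $\mathbb{S}^1\times\mathbb{R}^d$ are meant fibrewise over $\mathbb{S}^1$, and closures and interiors of subsets of $\mathbb{S}^1\times\mathbb{R}^d$ are taken in $\mathbb{S}^1\times\mathbb{R}^d$. **Theorem.** The autonomized system has a unique control set $D^a$ with nonvoid interior. It is given by $D^a=\overline{\mathbf{R}^a(0,0)}\cap\mathbf{C}^a(0,0)$ and satisfies $\mathbb{S}^1\times\{0\}\subset\operatorname{int}D^a$. The sets $\mathcal{K}^-$ and $\mathcal{K}^+$ are bounded, and $$Y(\cdot)\mathcal{K}^-\oplus\mathcal{E}^0\oplus Y(\cdot)^{-1}\mathcal{K}^+\subset\operatorname{int}D^a\subset D^a\subset Y(\cdot)^{-1}\overline{\mathcal{K}^-}\oplus\mathcal{E}^0\oplus Y(\cdot)\mathcal{K}^+.$$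 In particular, $\operatorname{int}D^a$ is unbounded if and only if the center subbundle $\mathcal{E}^0$ is nontrivial, i.e. contains some $(\tau,x)$ with $x\neq0$. -/

import Mathlib

open MeasureTheory Set

noncomputable section

namespace PeriodicControl

/-! ### Linear equations with measurable coefficients -/

/-- `ξ : ℝ → ℝᵈ` is the Carathéodory solution on `ℝ` of `ẋ(t) = A(t) x(t) + f(t)`, `x(t₀) = x₀`:
a continuous function satisfying the integrated equation. -/
def IsSolution {d : ℕ} (A : ℝ → Matrix (Fin d) (Fin d) ℝ) (f : ℝ → Fin d → ℝ)
    (t₀ : ℝ) (x₀ : Fin d → ℝ) (ξ : ℝ → Fin d → ℝ) : Prop :=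
  Continuous ξ ∧ ∀ t, ξ t = x₀ + ∫ s in t₀..t, ((A s).mulVec (ξ s) + f s)

/-- The Carathéodory solution of `ẋ(t) = A(t) x(t) + f(t)`, `x(t₀) = x₀`. For `A` and `f` of class
`L^∞` it exists and is unique, so that the choice made here is immaterial. -/
def sol {d : ℕ} (A : ℝ → Matrix (Fin d) (Fin d) ℝ) (f : ℝ → Fin d → ℝ)
    (t₀ : ℝ) (x₀ : Fin d → ℝ) : ℝ → Fin d → ℝ :=
  Classical.epsilon (IsSolution A f t₀ x₀)

/-- The principal fundamental solution `X(t, s)` of `ẋ(t) = A(t) x(t)`: the matrix whose `j`-th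
column is the solution at time `t` which starts at time `s` in the `j`-th unit vector. -/
def fundamental {d : ℕ} (A : ℝ → Matrix (Fin d) (Fin d) ℝ) (t s : ℝ) :
    Matrix (Fin d) (Fin d) ℝ :=
  Matrix.of fun i j => sol A 0 s (Pi.single j 1) t i

/-- `φ(t; t₀, x₀, u)`, the solution of `ẋ(t) = A(t) x(t) + B(t) u(t)`, `x(t₀) = x₀`. -/
def phi {d m : ℕ} (A : ℝ → Matrix (Fin d) (Fin d) ℝ) (B : ℝ → Matrix (Fin d) (Fin m) ℝ)
    (t t₀ : ℝ) (x₀ : Fin d → ℝ) (u : ℝ → Fin m → ℝ) : Fin d → ℝ :=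
  sol A (fun s => (B s).mulVec (u s)) t₀ x₀ t

/-- The admissible controls: `u ∈ L^∞(ℝ, ℝᵐ)` with `u(t) ∈ U` for almost all `t`. -/
def controls {m : ℕ} (U : Set (Fin m → ℝ)) : Set (ℝ → Fin m → ℝ) :=
  {u | MemLp u ⊤ volume ∧ ∀ᵐ t, u t ∈ U}

/-- Controllability with unconstrained (bounded measurable) controls: any two points can be
joined, from any initial time, in some positive time. -/
def IsControllable {d m : ℕ} (A : ℝ → Matrix (Fin d) (Fin d) ℝ)
    (B : ℝ → Matrix (Fin d) (Fin m) ℝ) : Prop :=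
  ∀ (x₁ x₂ : Fin d → ℝ) (t₀ : ℝ), ∃ t₁ > t₀, ∃ u : ℝ → Fin m → ℝ,
    MemLp u ⊤ volume ∧ phi A B t₁ t₀ x₁ u = x₂

/-- The reachable set `R_t(t₀, x)`, used for `t ≥ t₀`. -/
def reach {d m : ℕ} (A : ℝ → Matrix (Fin d) (Fin d) ℝ) (B : ℝ → Matrix (Fin d) (Fin m) ℝ)
    (U : Set (Fin m → ℝ)) (t t₀ : ℝ) (x : Fin d → ℝ) : Set (Fin d → ℝ) :=
  {y | ∃ u ∈ controls U, phi A B t t₀ x u = y}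

/-- The controllable set `C_t(t₀, x)`, used for `t ≤ t₀`. -/
def ctrl {d m : ℕ} (A : ℝ → Matrix (Fin d) (Fin d) ℝ) (B : ℝ → Matrix (Fin d) (Fin m) ℝ)
    (U : Set (Fin m → ℝ)) (t t₀ : ℝ) (x : Fin d → ℝ) : Set (Fin d → ℝ) :=
  {y | ∃ u ∈ controls U, phi A B t₀ t y u = x}

/-- `R_{ℕT+τ}(0, 0)`, the union of the sets `R_{kT+τ}(0, 0)` over `k ∈ ℕ` (for `τ ≥ 0`). -/
def reachN {d m : ℕ} (A : ℝ → Matrix (Fin d) (Fin d) ℝ) (B : ℝ → Matrix (Fin d) (Fin m) ℝ)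
    (U : Set (Fin m → ℝ)) (T τ : ℝ) : Set (Fin d → ℝ) :=
  ⋃ k : ℕ, reach A B U (k * T + τ) 0 0

/-- `C_{-ℕT+τ}(0, 0)`, the union of the sets `C_{-kT+τ}(0, 0)` over the `k ∈ ℕ` for which
this set is defined, that is, for which `-kT+τ ≤ 0`. -/
def ctrlN {d m : ℕ} (A : ℝ → Matrix (Fin d) (Fin d) ℝ) (B : ℝ → Matrix (Fin d) (Fin m) ℝ)
    (U : Set (Fin m → ℝ)) (T τ : ℝ) : Set (Fin d → ℝ) :=
  ⋃ k : ℕ, ⋃ _ : -(k * T) + τ ≤ 0, ctrl A B U (-(k * T) + τ) 0 0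

/-! ### Spectral subspaces -/

/-- The coordinatewise real part `ℂᵈ → ℝᵈ`. -/
def rePart (d : ℕ) : (Fin d → ℂ) →ₗ[ℝ] (Fin d → ℝ) :=
  Complex.reLm.compLeft (Fin d)

/-- The real generalized eigenspace of a real matrix `M` for `μ ∈ ℂ`: the real parts of the
vectors in the (complex) generalized eigenspace. -/
def realGenEigenspace {d : ℕ} (M : Matrix (Fin d) (Fin d) ℝ) (μ : ℂ) :
    Submodule ℝ (Fin d → ℝ) :=
  ((Module.End.maxGenEigenspace (Matrix.toLin' (M.map Complex.ofReal)) μ).restrictScalars ℝ).map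
    (rePart d)

/-- The Floquet space `L(lam, τ)`: the sum of the real generalized eigenspaces of `X(T+τ, τ)` for
all Floquet multipliers `μ` with exponent `(1/T) log |μ| = lam` (trivial if there are none). -/
def floquetSpace {d : ℕ} (A : ℝ → Matrix (Fin d) (Fin d) ℝ) (T lam τ : ℝ) :
    Submodule ℝ (Fin d → ℝ) :=
  ⨆ μ : ℂ, ⨆ _ : Module.End.HasEigenvalue
      (Matrix.toLin' ((fundamental A (T + τ) τ).map Complex.ofReal)) μ ∧
      1 / T * Real.log ‖μ‖ = lam,
    realGenEigenspace (fundamental A (T + τ) τ) μ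

/-- The stable subspace at phase `τ`. -/
def stableSpace {d : ℕ} (A : ℝ → Matrix (Fin d) (Fin d) ℝ) (T τ : ℝ) :
    Submodule ℝ (Fin d → ℝ) :=
  ⨆ lam : ℝ, ⨆ _ : lam < 0, floquetSpace A T lam τ

/-- The center subspace at phase `τ`. -/
def centerSpace {d : ℕ} (A : ℝ → Matrix (Fin d) (Fin d) ℝ) (T τ : ℝ) :
    Submodule ℝ (Fin d → ℝ) :=
  floquetSpace A T 0 τ

/-- The unstable subspace at phase `τ`. -/
def unstableSpace {d : ℕ} (A : ℝ → Matrix (Fin d) (Fin d) ℝ) (T τ : ℝ) :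
    Submodule ℝ (Fin d → ℝ) :=
  ⨆ lam : ℝ, ⨆ _ : 0 < lam, floquetSpace A T lam τ

/-! ### Subsets of `𝕊¹ × ℝᵈ`

The circle `𝕊¹` is `ℝ / Tℤ`; its points are the phases `τ ∈ [0, T)`. On `ℝᵈ` only the topology and
the notion of boundedness are used. -/

/-- The representative in `[0, T)` of a point of the circle. -/
def rep {T : ℝ} [Fact (0 < T)] (τ : AddCircle T) : ℝ :=
  (AddCircle.equivIco T 0 τ : ℝ)

/-- The set of all `(τ, x)` with `x ∈ K_τ`, for a family of sets `K_τ`, `τ ∈ [0, T)`. -/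
def bundle {d : ℕ} (T : ℝ) [Fact (0 < T)] (K : ℝ → Set (Fin d → ℝ)) :
    Set (AddCircle T × (Fin d → ℝ)) :=
  {p | p.2 ∈ K (rep p.1)}

/-- The fibrewise sum of two subsets of `𝕊¹ × ℝᵈ`. -/
def bundleSum {d : ℕ} {T : ℝ} (S S' : Set (AddCircle T × (Fin d → ℝ))) :
    Set (AddCircle T × (Fin d → ℝ)) :=
  {p | ∃ a b, (p.1, a) ∈ S ∧ (p.1, b) ∈ S' ∧ p.2 = a + b}

/-- The fibrewise image `Y(·)S` of a subset of `𝕊¹ × ℝᵈ` under matrices `Y(τ)`, `τ ∈ [0, T)`. -/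
def bundleMul {d : ℕ} {T : ℝ} [Fact (0 < T)] (Y : ℝ → Matrix (Fin d) (Fin d) ℝ)
    (S : Set (AddCircle T × (Fin d → ℝ))) : Set (AddCircle T × (Fin d → ℝ)) :=
  {p | ∃ a, (p.1, a) ∈ S ∧ p.2 = (Y (rep p.1)).mulVec a}

/-- The center subbundle. -/
def centerBundle {d : ℕ} (A : ℝ → Matrix (Fin d) (Fin d) ℝ) (T : ℝ) [Fact (0 < T)] :
    Set (AddCircle T × (Fin d → ℝ)) :=
  bundle T fun τ => centerSpace A T τ

/-- The set with fibres `K⁻_τ = int R_{ℕT+τ}(0,0) ∩ E⁻_τ`. -/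
def KMinus {d m : ℕ} (A : ℝ → Matrix (Fin d) (Fin d) ℝ) (B : ℝ → Matrix (Fin d) (Fin m) ℝ)
    (U : Set (Fin m → ℝ)) (T : ℝ) [Fact (0 < T)] : Set (AddCircle T × (Fin d → ℝ)) :=
  bundle T fun τ => interior (reachN A B U T τ) ∩ stableSpace A T τ

/-- The set with fibres `K⁺_τ = int C_{-ℕT+τ}(0,0) ∩ E⁺_τ`. -/
def KPlus {d m : ℕ} (A : ℝ → Matrix (Fin d) (Fin d) ℝ) (B : ℝ → Matrix (Fin d) (Fin m) ℝ)
    (U : Set (Fin m → ℝ)) (T : ℝ) [Fact (0 < T)] : Set (AddCircle T × (Fin d → ℝ)) :=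
  bundle T fun τ => interior (ctrlN A B U T τ) ∩ unstableSpace A T τ

/-- The matrices `Y(τ) = X(dT+τ, τ)`. -/
def Ymat {d : ℕ} (A : ℝ → Matrix (Fin d) (Fin d) ℝ) (T τ : ℝ) : Matrix (Fin d) (Fin d) ℝ :=
  fundamental A (d * T + τ) τ

/-! ### The autonomized system -/

/-- The solution map of the autonomized system on `𝕊¹ × ℝᵈ`,
`φᵃ(t; (τ, x), u) = (τ + t mod T, φ(τ + t; τ, x, u))`. -/
def phiA {d m : ℕ} (A : ℝ → Matrix (Fin d) (Fin d) ℝ) (B : ℝ → Matrix (Fin d) (Fin m) ℝ)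
    {T : ℝ} [Fact (0 < T)] (t : ℝ) (p : AddCircle T × (Fin d → ℝ)) (u : ℝ → Fin m → ℝ) :
    AddCircle T × (Fin d → ℝ) :=
  (p.1 + (t : AddCircle T), phi A B (rep p.1 + t) (rep p.1) p.2 u)

/-- The reachable set `Rᵃ(τ, x)` of the autonomized system. -/
def reachA {d m : ℕ} (A : ℝ → Matrix (Fin d) (Fin d) ℝ) (B : ℝ → Matrix (Fin d) (Fin m) ℝ)
    (U : Set (Fin m → ℝ)) {T : ℝ} [Fact (0 < T)] (p : AddCircle T × (Fin d → ℝ)) :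
    Set (AddCircle T × (Fin d → ℝ)) :=
  {q | ∃ t ≥ (0 : ℝ), ∃ u ∈ controls U, phiA A B t p u = q}

/-- The controllable set `Cᵃ(τ, x)` of the autonomized system. -/
def ctrlA {d m : ℕ} (A : ℝ → Matrix (Fin d) (Fin d) ℝ) (B : ℝ → Matrix (Fin d) (Fin m) ℝ)
    (U : Set (Fin m → ℝ)) {T : ℝ} [Fact (0 < T)] (p : AddCircle T × (Fin d → ℝ)) :
    Set (AddCircle T × (Fin d → ℝ)) :=
  {q | ∃ t ≥ (0 : ℝ), ∃ u ∈ controls U, phiA A B t q u = p}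

/-- Controlled invariance together with approximate controllability: from each point of `D` one
can stay in `D` for all `t ≥ 0`, and `D` lies in the closure of each `Rᵃ(p)`, `p ∈ D`. -/
def IsPreControlSet {d m : ℕ} (A : ℝ → Matrix (Fin d) (Fin d) ℝ)
    (B : ℝ → Matrix (Fin d) (Fin m) ℝ) (U : Set (Fin m → ℝ)) {T : ℝ} [Fact (0 < T)]
    (D : Set (AddCircle T × (Fin d → ℝ))) : Prop :=
  (∀ p ∈ D, ∃ u ∈ controls U, ∀ t ≥ (0 : ℝ), phiA A B t p u ∈ D) ∧
    ∀ p ∈ D, D ⊆ closure (reachA A B U p)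

/-- A control set of the autonomized system: a nonvoid maximal set with these properties. -/
def IsControlSet {d m : ℕ} (A : ℝ → Matrix (Fin d) (Fin d) ℝ)
    (B : ℝ → Matrix (Fin d) (Fin m) ℝ) (U : Set (Fin m → ℝ)) {T : ℝ} [Fact (0 < T)]
    (D : Set (AddCircle T × (Fin d → ℝ))) : Prop :=
  D.Nonempty ∧ IsPreControlSet A B U D ∧
    ∀ D', D ⊆ D' → IsPreControlSet A B U D' → D' = D

end PeriodicControl

end

namespace PeriodicControl

/-! ### Products of essentially bounded functions -/

/-! The argument takes place on the covering space `ℝ × ℝᵈ`. Two families of fibres carry it: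
`reachableSet` at `t`, the states reached at time `t` from the origin at some time `s ≤ t`, and
`nullSet` at `t`, the states steered from time `t` to the origin at some time `s ≥ t`. Both are
periodic in `t`, and they are the preimages of Rᵃ(0,0) and Cᵃ(0,0). They are convex, because staying
at the origin under zero control lets the time interval be enlarged, and they are open, because
superposing and scaling unconstrained controls gives local controllability. Time reversal exchanges
the two families and the stable and unstable spaces, so only `reachableSet` needs direct proofs.

The key fact is `centerUnstableSpace_subset_reachableSet`. If `w` is not reachable, Hahn–Banach
gives a functional `l` with `l < l w` on the reachable set. That set contains all sums of `M ^ (n *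
i)` applied to vectors `± δ x`, where `M` is the monodromy matrix. Choosing the signs well makes `∑
|l (M ^ (n * i) x)|` finite for every `x`, so these values tend to 0 and `l` vanishes on every
generalized eigenspace with `1 ≤ ‖μ‖`. Then `l w = 0 = l 0`, a contradiction. By openness and
convexity, `reachableSet` is invariant under translation by the center-unstable space
(`add_mem_reachableSet`), and dually `nullSet` under the center-stable space. Their remaining stable
and unstable parts are bounded, since the powers of `M` are summable on the stable space
(`exists_stable_reachable_bound`).

The set closure(Rᵃ(0,0)) ∩ Cᵃ(0,0) is a control set because each of its points can be steered to the
origin and Cᵃ(0,0) is open. For uniqueness, a point of a set with (i) and (ii) is approximated by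
its own trajectories at arbitrarily late times. Discarding the decaying stable part puts it in the
closure of Rᵃ(0,0) (`subset_closure_reachA`), and the backward argument puts it in the closure of
the null set (`mem_closure_nullSet`). Interior points then lie in the open convex null set itself,
so the two control sets meet and maximality makes them equal.

The spectral inclusions follow from the translation invariances. The factors Y(τ) do no harm, since
forward periods preserve K⁻ and backward periods preserve K⁺. -/

theorem memLp_mulVec {n k : ℕ} {B : ℝ → Matrix (Fin n) (Fin k) ℝ} {u : ℝ → Fin k → ℝ}
    (hB : ∀ i j, MemLp (fun t => B t i j) ⊤ volume) (hu : MemLp u ⊤ volume) :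
    MemLp (fun s => (B s).mulVec (u s)) ⊤ volume := by
  rw [memLp_pi_iff] at hu ⊢
  intro i
  have : (fun s => (B s).mulVec (u s) i) = fun s => ∑ j, B s i j * u s j := by
    ext s; simp [Matrix.mulVec, dotProduct]
  rw [this]
  exact memLp_finsetSum _ fun j _ => (hu j).mul' (hB i j)

theorem aestronglyMeasurable_mulVec {n k : ℕ} {B : ℝ → Matrix (Fin n) (Fin k) ℝ}
    {u : ℝ → Fin k → ℝ} (hB : ∀ i j, MemLp (fun t => B t i j) ⊤ volume) (hu : Continuous u) :
    AEStronglyMeasurable (fun s => (B s).mulVec (u s)) volume := by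
  refine AEMeasurable.aestronglyMeasurable (aemeasurable_pi_lambda _ fun i => ?_)
  have : (fun s => (B s).mulVec (u s) i) = fun s => ∑ j, B s i j * u s j := by
    ext s; simp [Matrix.mulVec, dotProduct]
  rw [this]
  exact Finset.aemeasurable_fun_sum _ fun j _ => (hB i j).1.aemeasurable.mul
    ((continuous_apply j).comp hu).aemeasurable

theorem ae_norm_le_of_memLp_top {E : Type*} [NormedAddCommGroup E] {f : ℝ → E}
    (hf : MemLp f ⊤ volume) : ∃ C, 0 ≤ C ∧ ∀ᵐ t, ‖f t‖ ≤ C := by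
  refine ⟨(eLpNormEssSup f volume).toReal, ENNReal.toReal_nonneg, ?_⟩
  have hlt : eLpNormEssSup f volume < ⊤ := by simpa using hf.2
  filter_upwards [ae_le_eLpNormEssSup (f := f) (μ := volume)] with t ht
  rw [← toReal_enorm]
  exact ENNReal.toReal_mono hlt.ne ht

theorem exists_mulVec_bound {n k : ℕ} {B : ℝ → Matrix (Fin n) (Fin k) ℝ}
    (hB : ∀ i j, MemLp (fun t => B t i j) ⊤ volume) :
    ∃ K, 0 ≤ K ∧ ∀ᵐ t, ∀ v, ‖(B t).mulVec v‖ ≤ K * ‖v‖ := by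
  choose C hC0 hC using fun i j => ae_norm_le_of_memLp_top (hB i j)
  refine ⟨∑ i, ∑ j, C i j, Finset.sum_nonneg fun i _ => Finset.sum_nonneg fun j _ => hC0 i j, ?_⟩
  have : ∀ᵐ t, ∀ i j, ‖B t i j‖ ≤ C i j := by
    rw [ae_all_iff]; intro i; rw [ae_all_iff]; exact hC i
  filter_upwards [this] with t ht v
  have hnn : 0 ≤ ∑ i, ∑ j, C i j :=
    Finset.sum_nonneg fun i _ => Finset.sum_nonneg fun j _ => hC0 i j
  rw [pi_norm_le_iff_of_nonneg (by positivity)]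
  intro i
  calc ‖(B t).mulVec v i‖ = ‖∑ j, B t i j * v j‖ := by simp [Matrix.mulVec, dotProduct]
    _ ≤ ∑ j, ‖B t i j * v j‖ := norm_sum_le _ _
    _ ≤ ∑ j, C i j * ‖v‖ := Finset.sum_le_sum fun j _ => by
        rw [norm_mul]; gcongr
        · exact hC0 i j
        · exact ht i j
        · exact norm_le_pi_norm v j
    _ = (∑ j, C i j) * ‖v‖ := by rw [Finset.sum_mul]
    _ ≤ _ := by
        gcongr
        exact Finset.single_le_sum (f := fun i => ∑ j, C i j)
          (fun i _ => Finset.sum_nonneg fun j _ => hC0 i j) (Finset.mem_univ i)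

theorem intervalIntegrable_of_memLp_top {E : Type*} [NormedAddCommGroup E] {f : ℝ → E}
    (hf : MemLp f ⊤ volume) (a b : ℝ) : IntervalIntegrable f volume a b := by
  rw [intervalIntegrable_iff, uIoc]
  exact (hf.restrict _).integrable le_top

theorem intervalIntegrable_mulVec {n k : ℕ} {B : ℝ → Matrix (Fin n) (Fin k) ℝ}
    {u : ℝ → Fin k → ℝ} (hB : ∀ i j, MemLp (fun t => B t i j) ⊤ volume) (hu : Continuous u)
    (a b : ℝ) : IntervalIntegrable (fun s => (B s).mulVec (u s)) volume a b := by
  obtain ⟨K, -, hK⟩ := exists_mulVec_bound hB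
  have h1 : IntervalIntegrable (fun s => K * ‖u s‖) volume a b :=
    (continuous_const.mul hu.norm).intervalIntegrable _ _
  refine h1.mono_fun' (aestronglyMeasurable_mulVec hB hu).restrict (ae_restrict_of_ae ?_)
  filter_upwards [hK] with t ht using ht _

/-! ### Grönwall's inequality in integral form -/

/-- The majorant `g` is differentiable although `‖z‖` need not be, and `g' = K‖z‖ ≤ K g`, so the
differential Grönwall inequality applies to `g`. -/
theorem norm_le_of_integral_le_right {E : Type*} [NormedAddCommGroup E] {z : ℝ → E}
    (hz : Continuous z) {C K : ℝ} {a b : ℝ} (hK : 0 ≤ K) (hab : a ≤ b)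
    (h : ∀ t ∈ Icc a b, ‖z t‖ ≤ C + K * ∫ s in a..t, ‖z s‖) :
    ‖z b‖ ≤ C * Real.exp (K * (b - a)) := by
  set g : ℝ → ℝ := fun t => C + K * ∫ s in a..t, ‖z s‖ with hg
  have hd : ∀ t, HasDerivAt g (K * ‖z t‖) t := fun t =>
    ((intervalIntegral.integral_hasDerivAt_right (hz.norm.intervalIntegrable _ _)
      (hz.norm.stronglyMeasurableAtFilter _ _) hz.norm.continuousAt).const_mul K).const_add C
  have key := le_gronwallBound_of_liminf_deriv_right_le (f := g) (f' := fun t => K * ‖z t‖)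
    (δ := C) (K := K) (ε := 0) (a := a) (b := b)
    (fun t _ => (hd t).continuousAt.continuousWithinAt)
    (fun t _ r hr => (hd t).hasDerivWithinAt.liminf_right_slope_le hr)
    (by simp [hg])
    (fun t ht => by
      have := mul_le_mul_of_nonneg_left (h t ⟨ht.1, ht.2.le⟩) hK
      simpa using this)
    b ⟨hab, le_rfl⟩
  rw [gronwallBound_ε0] at key
  exact (h b ⟨hab, le_rfl⟩).trans key

theorem norm_le_of_integral_le {E : Type*} [NormedAddCommGroup E] {z : ℝ → E}
    (hz : Continuous z) {C K : ℝ} {a b : ℝ} (hK : 0 ≤ K)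
    (h : ∀ t ∈ uIcc a b, ‖z t‖ ≤ C + K * |∫ s in a..t, ‖z s‖|) :
    ‖z b‖ ≤ C * Real.exp (K * |b - a|) := by
  rcases le_total a b with hab | hab
  · rw [abs_of_nonneg (sub_nonneg.2 hab)]
    refine norm_le_of_integral_le_right hz hK hab fun t ht => ?_
    have := h t (by rwa [uIcc_of_le hab])
    rwa [abs_of_nonneg (intervalIntegral.integral_nonneg ht.1 fun _ _ => norm_nonneg _)] at this
  · rw [abs_of_nonpos (sub_nonpos.2 hab)]
    have hz' : Continuous fun t => z (-t) := hz.comp continuous_neg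
    have := norm_le_of_integral_le_right (z := fun t => z (-t)) (C := C) (a := -a) (b := -b) hz' hK
      (by linarith) fun t ht => by
        have h1 := h (-t) (by rw [uIcc_of_ge hab]; constructor <;> linarith [ht.1, ht.2])
        have h2 : ∫ s in (-a)..t, ‖z (-s)‖ = -∫ s in a..(-t), ‖z s‖ := by
          rw [intervalIntegral.integral_comp_neg (fun s => ‖z s‖), neg_neg,
            intervalIntegral.integral_symm]
        have h3 : 0 ≤ ∫ s in (-a)..t, ‖z (-s)‖ :=
          intervalIntegral.integral_nonneg ht.1 fun _ _ => norm_nonneg _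
        rw [h2] at h3 ⊢
        rwa [abs_of_nonpos (by linarith)] at h1
    simp only [neg_neg] at this
    convert this using 3
    ring

/-! ### Existence and uniqueness -/

/-- Integrating the weight `exp (c|t - a|)` gains a factor `1/c`; this makes the Picard operator a
contraction on the whole line at once. -/
theorem abs_integral_exp_abs_le {c : ℝ} (hc : 0 < c) (a t : ℝ) :
    |∫ s in a..t, Real.exp (c * |s - a|)| ≤ Real.exp (c * |t - a|) / c := by
  have hr : ∀ a t : ℝ, a ≤ t →
      |∫ s in a..t, Real.exp (c * |s - a|)| ≤ Real.exp (c * |t - a|) / c := by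
    intro a t hat
    have h1 : ∫ s in a..t, Real.exp (c * |s - a|) = ∫ s in a..t, Real.exp (c * (s - a)) := by
      refine intervalIntegral.integral_congr fun s hs => ?_
      rw [uIcc_of_le hat] at hs
      simp only [abs_of_nonneg (sub_nonneg.2 hs.1)]
    have h2 : ∫ s in a..t, Real.exp (c * (s - a)) =
        Real.exp (c * (t - a)) / c - Real.exp (c * (a - a)) / c := by
      refine intervalIntegral.integral_eq_sub_of_hasDerivAt
        (f := fun s => Real.exp (c * (s - a)) / c) (fun s _ => ?_)
        (Continuous.intervalIntegrable (by fun_prop) _ _)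
      have := ((((hasDerivAt_id s).sub_const a).const_mul c).exp).div_const c
      simp only [id] at this
      rwa [mul_one, mul_div_cancel_right₀ _ hc.ne'] at this
    rw [abs_of_nonneg (intervalIntegral.integral_nonneg hat fun _ _ => (Real.exp_pos _).le),
      h1, h2, abs_of_nonneg (sub_nonneg.2 hat)]
    have : 0 ≤ Real.exp (c * (a - a)) / c := by positivity
    linarith
  rcases le_total a t with h | h
  · exact hr a t h
  · have := hr (-a) (-t) (by linarith)
    have h2 : ∫ s in (-a)..(-t), Real.exp (c * |s - -a|) = -∫ s in a..t, Real.exp (c * |s - a|) := by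
      have h3 : ∀ s : ℝ, |s - -a| = |(-s) - a| := fun s => by rw [← abs_neg]; congr 1; ring
      simp_rw [h3]
      rw [intervalIntegral.integral_comp_neg (fun s => Real.exp (c * |s - a|)), neg_neg, neg_neg,
        intervalIntegral.integral_symm]
    rw [h2, abs_neg] at this
    convert this using 3
    rw [← abs_neg]; congr 2; ring

theorem exists_isSolution {d : ℕ} {A : ℝ → Matrix (Fin d) (Fin d) ℝ} {f : ℝ → Fin d → ℝ}
    (hA : ∀ i j, MemLp (fun t => A t i j) ⊤ volume) (hf : MemLp f ⊤ volume)
    (t₀ : ℝ) (x₀ : Fin d → ℝ) : ∃ ξ, IsSolution A f t₀ x₀ ξ := by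
  obtain ⟨K, hK0, hK⟩ := exists_mulVec_bound hA
  obtain ⟨F, hF0, hF⟩ := ae_norm_le_of_memLp_top hf
  -- With this rate the contraction constant is `K / c ≤ 1/2`; the summand 1 keeps `c` positive when
  -- `K = 0`.
  set c : ℝ := 2 * K + 1 with hc
  have hcpos : 0 < c := by positivity
  let w : ℝ → ℝ := fun t => Real.exp (c * |t - t₀|)
  have hw : Continuous w := by fun_prop
  have hwpos : ∀ t, 0 < w t := fun t => Real.exp_pos _
  have hw1 : ∀ t, 1 ≤ w t := fun t => Real.one_le_exp (by positivity)
  have hint : ∀ g : ℝ → Fin d → ℝ, Continuous g → ∀ a b : ℝ,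
      IntervalIntegrable (fun s => (A s).mulVec (g s) + f s) volume a b := fun g hg a b =>
    (intervalIntegrable_mulVec hA hg a b).add (intervalIntegrable_of_memLp_top hf a b)
  have hbound : ∀ (h : ℝ → Fin d → ℝ) (L : ℝ), 0 ≤ L → (∀ᵐ s, ‖h s‖ ≤ L * w s) →
      ∀ t, (w t)⁻¹ * ‖∫ s in t₀..t, h s‖ ≤ L / c := by
    intro h L hL hh t
    have h1 : ‖∫ s in t₀..t, h s‖ ≤ |∫ s in t₀..t, L * w s| :=
      intervalIntegral.norm_integral_le_abs_of_norm_le (ae_restrict_of_ae hh)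
        ((continuous_const.mul hw).intervalIntegrable _ _)
    rw [intervalIntegral.integral_const_mul, abs_mul, abs_of_nonneg hL] at h1
    have h2 := abs_integral_exp_abs_le hcpos t₀ t
    calc (w t)⁻¹ * ‖∫ s in t₀..t, h s‖ ≤ (w t)⁻¹ * (L * (w t / c)) := by
          have := (hwpos t).le
          gcongr
          exact h1.trans (by gcongr)
      _ = L / c := by have := (hwpos t).ne'; field_simp
  -- The Picard operator in terms of `y = ξ / w`; the solution may grow exponentially, but `y` is
  -- bounded, so the fixed point is sought among bounded continuous functions.
  let G : (ℝ → Fin d → ℝ) → ℝ → Fin d → ℝ := fun y t =>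
    (w t)⁻¹ • (x₀ + ∫ s in t₀..t, ((A s).mulVec (w s • y s) + f s))
  have hGc : ∀ y : BoundedContinuousFunction ℝ (Fin d → ℝ), Continuous (G y) := fun y => by
    refine (hw.inv₀ fun t => (hwpos t).ne').smul (continuous_const.add ?_)
    exact intervalIntegral.continuous_primitive (hint _ (hw.smul y.continuous)) _
  have hGb : ∀ (y : BoundedContinuousFunction ℝ (Fin d → ℝ)) t,
      ‖G y t‖ ≤ ‖x₀‖ + (K * ‖y‖ + F) / c := fun y t => by
    rw [norm_smul, norm_inv, Real.norm_of_nonneg (hwpos t).le]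
    have h1 := hbound (fun s => (A s).mulVec (w s • y s) + f s) (K * ‖y‖ + F) (by positivity) (by
      filter_upwards [hK, hF] with s hs hs'
      calc _ ≤ ‖(A s).mulVec (w s • y s)‖ + ‖f s‖ := norm_add_le _ _
        _ ≤ K * ‖w s • y s‖ + F := add_le_add (hs _) hs'
        _ ≤ K * (w s * ‖y‖) + F * w s := by
            rw [norm_smul, Real.norm_of_nonneg (hwpos s).le]
            have := (hwpos s).le
            gcongr
            · exact y.norm_coe_le_norm s
            · exact le_mul_of_one_le_right hF0 (hw1 s)
        _ = _ := by ring) t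
    calc _ ≤ (w t)⁻¹ * (‖x₀‖ + ‖∫ s in t₀..t, ((A s).mulVec (w s • y s) + f s)‖) := by
          have := (hwpos t).le
          gcongr
          exact norm_add_le _ _
      _ ≤ ‖x₀‖ + (K * ‖y‖ + F) / c := by
          rw [mul_add]
          gcongr
          exact mul_le_of_le_one_left (norm_nonneg _) (inv_le_one_of_one_le₀ (hw1 t))
  let Φ : BoundedContinuousFunction ℝ (Fin d → ℝ) → BoundedContinuousFunction ℝ (Fin d → ℝ) :=
    fun y => BoundedContinuousFunction.ofNormedAddCommGroup (G y) (hGc y) _ (hGb y)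
  have hcontr : ContractingWith (1 / 2) Φ := by
    refine ⟨by rw [← NNReal.coe_lt_coe]; norm_num, LipschitzWith.of_dist_le_mul fun y z => ?_⟩
    rw [BoundedContinuousFunction.dist_le (by positivity)]
    intro t
    have h1 := hbound (fun s => (A s).mulVec (w s • (y s - z s))) (K * dist y z)
      (by positivity) (by
        filter_upwards [hK] with s hs
        refine (hs _).trans ?_
        rw [norm_smul, Real.norm_of_nonneg (hwpos s).le, ← dist_eq_norm]
        have := (hwpos s).le
        calc K * (w s * dist (y s) (z s)) ≤ K * (w s * dist y z) := by
              gcongr; exact BoundedContinuousFunction.dist_coe_le_dist s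
          _ = _ := by ring) t
    have h2 : G y t - G z t = (w t)⁻¹ • ∫ s in t₀..t, (A s).mulVec (w s • (y s - z s)) := by
      simp only [G]
      rw [← smul_sub, add_sub_add_left_eq_sub, ← intervalIntegral.integral_sub
        (hint (fun s => w s • y s) (hw.smul y.continuous) _ _)
        (hint (fun s => w s • z s) (hw.smul z.continuous) _ _)]
      congr 2
      ext1 s
      rw [add_sub_add_right_eq_sub, ← Matrix.mulVec_sub, ← smul_sub]
    change dist (G y t) (G z t) ≤ _
    rw [dist_eq_norm, h2, norm_smul, norm_inv, Real.norm_of_nonneg (hwpos t).le]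
    refine h1.trans ?_
    rw [div_le_iff₀ hcpos]
    have : 0 ≤ dist y z := dist_nonneg
    push_cast
    nlinarith
  obtain ⟨y, hy, -⟩ := hcontr.exists_fixedPoint 0 (edist_ne_top _ _)
  refine ⟨fun t => w t • y t, hw.smul y.continuous, fun t => ?_⟩
  have h1 : y t = G y t := by
    conv_lhs => rw [← hy]
    rfl
  change w t • y t = _
  rw [h1, smul_inv_smul₀ (hwpos t).ne']

section Solutions

variable {d : ℕ} {A : ℝ → Matrix (Fin d) (Fin d) ℝ} {f g : ℝ → Fin d → ℝ}
  {t₀ : ℝ} {x₀ y₀ : Fin d → ℝ} {ξ ζ : ℝ → Fin d → ℝ}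

theorem intervalIntegrable_rhs (hA : ∀ i j, MemLp (fun t => A t i j) ⊤ volume)
    (hf : MemLp f ⊤ volume) (hξ : Continuous ξ) (a b : ℝ) :
    IntervalIntegrable (fun s => (A s).mulVec (ξ s) + f s) volume a b :=
  (intervalIntegrable_mulVec hA hξ a b).add (intervalIntegrable_of_memLp_top hf a b)

theorem sol_spec (hA : ∀ i j, MemLp (fun t => A t i j) ⊤ volume) (hf : MemLp f ⊤ volume)
    (t₀ : ℝ) (x₀ : Fin d → ℝ) : IsSolution A f t₀ x₀ (sol A f t₀ x₀) :=
  Classical.epsilon_spec (exists_isSolution hA hf t₀ x₀)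

/-- A solution up to a time depends only on the forcing up to this time. -/
theorem IsSolution.eq_at (hA : ∀ i j, MemLp (fun t => A t i j) ⊤ volume)
    (hf : MemLp f ⊤ volume) (hg : MemLp g ⊤ volume)
    (hξ : IsSolution A f t₀ x₀ ξ) (hζ : IsSolution A g t₀ x₀ ζ) {t₁ : ℝ}
    (hfg : ∀ᵐ s, s ∈ uIoc t₀ t₁ → f s = g s) : ξ t₁ = ζ t₁ := by
  obtain ⟨K, hK0, hK⟩ := exists_mulVec_bound hA
  have hz : Continuous fun t => ξ t - ζ t := hξ.1.sub hζ.1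
  have key := norm_le_of_integral_le (C := 0) (a := t₀) (b := t₁) hz hK0 fun t ht => by
    have h1 : ξ t - ζ t = ∫ s in t₀..t, (A s).mulVec (ξ s - ζ s) := by
      rw [hξ.2 t, hζ.2 t, add_sub_add_left_eq_sub, ← intervalIntegral.integral_sub
        (intervalIntegrable_rhs hA hf hξ.1 _ _) (intervalIntegrable_rhs hA hg hζ.1 _ _)]
      refine intervalIntegral.integral_congr_ae ?_
      filter_upwards [hfg] with s hs hs'
      rw [hs (uIoc_subset_uIoc_of_uIcc_subset_uIcc (uIcc_subset_uIcc_left ht) hs'),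
        add_sub_add_right_eq_sub, Matrix.mulVec_sub]
    have h2 : K * |∫ s in t₀..t, ‖ξ s - ζ s‖| = |K * ∫ s in t₀..t, ‖ξ s - ζ s‖| := by
      rw [abs_mul, abs_of_nonneg hK0]
    rw [h1, zero_add, h2, ← intervalIntegral.integral_const_mul]
    refine intervalIntegral.norm_integral_le_abs_of_norm_le (ae_restrict_of_ae ?_)
      ((continuous_const.mul hz.norm).intervalIntegrable _ _)
    filter_upwards [hK] with s hs using hs _
  rw [zero_mul] at key
  exact sub_eq_zero.1 (norm_le_zero_iff.1 key)

theorem IsSolution.eq_sol (hA : ∀ i j, MemLp (fun t => A t i j) ⊤ volume)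
    (hf : MemLp f ⊤ volume) (hξ : IsSolution A f t₀ x₀ ξ) : sol A f t₀ x₀ = ξ :=
  funext fun _ => (sol_spec hA hf t₀ x₀).eq_at hA hf hf hξ (.of_forall fun _ _ => rfl)

theorem IsSolution.lincomb (hA : ∀ i j, MemLp (fun t => A t i j) ⊤ volume)
    (hf : MemLp f ⊤ volume) (hg : MemLp g ⊤ volume)
    (hξ : IsSolution A f t₀ x₀ ξ) (hζ : IsSolution A g t₀ y₀ ζ) (a b : ℝ) :
    IsSolution A (fun s => a • f s + b • g s) t₀ (a • x₀ + b • y₀)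
      fun t => a • ξ t + b • ζ t := by
  refine ⟨(hξ.1.const_smul a).add (hζ.1.const_smul b), fun t => ?_⟩
  have h1 := intervalIntegrable_rhs hA hf hξ.1 t₀ t
  have h2 := intervalIntegrable_rhs hA hg hζ.1 t₀ t
  have h3 : (∫ s in t₀..t, ((A s).mulVec (a • ξ s + b • ζ s) + (a • f s + b • g s))) =
      ∫ s in t₀..t, (a • ((A s).mulVec (ξ s) + f s) + b • ((A s).mulVec (ζ s) + g s)) := by
    congr 1; ext1 s
    rw [Matrix.mulVec_add, Matrix.mulVec_smul, Matrix.mulVec_smul]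
    module
  have h4 := intervalIntegral.integral_add (h1.smul a) (h2.smul b)
  simp only [Pi.smul_apply] at h4
  rw [h3, h4, intervalIntegral.integral_smul, intervalIntegral.integral_smul]
  change a • ξ t + b • ζ t = _
  rw [hξ.2 t, hζ.2 t]
  module

theorem IsSolution.restart (hA : ∀ i j, MemLp (fun t => A t i j) ⊤ volume)
    (hf : MemLp f ⊤ volume) (hξ : IsSolution A f t₀ x₀ ξ) (t₁ : ℝ) :
    IsSolution A f t₁ (ξ t₁) ξ := by
  refine ⟨hξ.1, fun t => ?_⟩
  rw [hξ.2 t, hξ.2 t₁, add_assoc, intervalIntegral.integral_add_adjacent_intervals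
    (intervalIntegrable_rhs hA hf hξ.1 _ _) (intervalIntegrable_rhs hA hf hξ.1 _ _)]

/-! ### Translation and reflection of time. -/

theorem ae_comp_add_right {p : ℝ → Prop} (h : ∀ᵐ t, p t) (a : ℝ) : ∀ᵐ t, p (t + a) :=
  (measurePreserving_add_right volume a).quasiMeasurePreserving.ae h

theorem ae_comp_neg {p : ℝ → Prop} (h : ∀ᵐ t, p t) : ∀ᵐ t, p (-t) :=
  (Measure.measurePreserving_neg volume).quasiMeasurePreserving.ae h

theorem memLp_comp_add_right {E : Type*} [NormedAddCommGroup E] {f : ℝ → E}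
    (h : MemLp f ⊤ volume) (a : ℝ) : MemLp (fun t => f (t + a)) ⊤ volume :=
  h.comp_measurePreserving (measurePreserving_add_right volume a)

theorem memLp_comp_neg {E : Type*} [NormedAddCommGroup E] {f : ℝ → E}
    (h : MemLp f ⊤ volume) : MemLp (fun t => f (-t)) ⊤ volume :=
  h.comp_measurePreserving (Measure.measurePreserving_neg volume)

theorem IsSolution.shift {a : ℝ} (hAa : ∀ᵐ t, A (t + a) = A t)
    (hξ : IsSolution A f (t₀ + a) x₀ ξ) :
    IsSolution A (fun s => f (s + a)) t₀ x₀ fun t => ξ (t + a) := by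
  refine ⟨hξ.1.comp (continuous_add_const a), fun t => ?_⟩
  change ξ (t + a) = _
  rw [hξ.2 (t + a), ← intervalIntegral.integral_comp_add_right]
  congr 1
  refine intervalIntegral.integral_congr_ae ?_
  filter_upwards [hAa] with s hs _
  rw [hs]

theorem IsSolution.reverse (hξ : IsSolution A f t₀ x₀ ξ) :
    IsSolution (fun t => -A (-t)) (fun s => -f (-s)) (-t₀) x₀ fun t => ξ (-t) := by
  refine ⟨hξ.1.comp continuous_neg, fun t => ?_⟩
  change ξ (-t) = _
  rw [hξ.2 (-t)]
  have : ∀ s, (-A (-s)).mulVec (ξ (-s)) + -f (-s) = -((A (-s)).mulVec (ξ (-s)) + f (-s)) :=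
    fun s => by rw [Matrix.neg_mulVec, neg_add]
  simp_rw [this]
  rw [intervalIntegral.integral_neg,
    intervalIntegral.integral_comp_neg (fun s => (A s).mulVec (ξ s) + f s), neg_neg,
    intervalIntegral.integral_symm]

theorem IsSolution.norm_le (hA : ∀ i j, MemLp (fun t => A t i j) ⊤ volume)
    (hf : MemLp f ⊤ volume) {K F : ℝ} (hK0 : 0 ≤ K) (hF0 : 0 ≤ F)
    (hK : ∀ᵐ t, ∀ v, ‖(A t).mulVec v‖ ≤ K * ‖v‖) (hF : ∀ᵐ t, ‖f t‖ ≤ F)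
    (hξ : IsSolution A f t₀ x₀ ξ) (t : ℝ) :
    ‖ξ t‖ ≤ (‖x₀‖ + F * |t - t₀|) * Real.exp (K * |t - t₀|) := by
  refine norm_le_of_integral_le hξ.1 hK0 fun r hr => ?_
  have h1 : ‖∫ s in t₀..r, (A s).mulVec (ξ s)‖ ≤ |∫ s in t₀..r, K * ‖ξ s‖| :=
    intervalIntegral.norm_integral_le_abs_of_norm_le
      (ae_restrict_of_ae (by filter_upwards [hK] with s hs using hs _))
      ((continuous_const.mul hξ.1.norm).intervalIntegrable _ _)
  have h2 : ‖∫ s in t₀..r, f s‖ ≤ F * |r - t₀| :=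
    intervalIntegral.norm_integral_le_of_norm_le_const_ae
      (by filter_upwards [hF] with s hs _ using hs)
  have h3 : |r - t₀| ≤ |t - t₀| := abs_sub_left_of_mem_uIcc hr
  rw [intervalIntegral.integral_const_mul, abs_mul, abs_of_nonneg hK0] at h1
  rw [hξ.2 r, intervalIntegral.integral_add (intervalIntegrable_mulVec hA hξ.1 _ _)
    (intervalIntegrable_of_memLp_top hf _ _)]
  calc _ ≤ ‖x₀‖ + (‖∫ s in t₀..r, (A s).mulVec (ξ s)‖ + ‖∫ s in t₀..r, f s‖) :=
        (norm_add_le _ _).trans (by gcongr; exact norm_add_le _ _)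
    _ ≤ ‖x₀‖ + (K * |∫ s in t₀..r, ‖ξ s‖| + F * |t - t₀|) := by
        gcongr
        exact h2.trans (by gcongr)
    _ = _ := by ring

end Solutions

/-! ### The solution map of the control system -/

section Phi

variable {d m : ℕ} {A : ℝ → Matrix (Fin d) (Fin d) ℝ} {B : ℝ → Matrix (Fin d) (Fin m) ℝ}
  {u v : ℝ → Fin m → ℝ}

theorem phi_self (hA : ∀ i j, MemLp (fun t => A t i j) ⊤ volume)
    (hB : ∀ i j, MemLp (fun t => B t i j) ⊤ volume) (hu : MemLp u ⊤ volume)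
    (t : ℝ) (x : Fin d → ℝ) : phi A B t t x u = x := by
  have := (sol_spec hA (memLp_mulVec hB hu) t x).2 t
  rwa [intervalIntegral.integral_same, add_zero] at this

theorem phi_congr (hA : ∀ i j, MemLp (fun t => A t i j) ⊤ volume)
    (hB : ∀ i j, MemLp (fun t => B t i j) ⊤ volume) (hu : MemLp u ⊤ volume)
    (hv : MemLp v ⊤ volume) {t s : ℝ} (h : ∀ᵐ r, r ∈ uIoc s t → u r = v r) (x : Fin d → ℝ) :
    phi A B t s x u = phi A B t s x v :=
  (sol_spec hA (memLp_mulVec hB hu) s x).eq_at hA (memLp_mulVec hB hu) (memLp_mulVec hB hv)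
    (sol_spec hA (memLp_mulVec hB hv) s x) (by
      filter_upwards [h] with r hr hr'
      rw [hr hr'])

theorem phi_trans (hA : ∀ i j, MemLp (fun t => A t i j) ⊤ volume)
    (hB : ∀ i j, MemLp (fun t => B t i j) ⊤ volume) (hu : MemLp u ⊤ volume)
    (t r s : ℝ) (x : Fin d → ℝ) : phi A B t r (phi A B r s x u) u = phi A B t s x u :=
  congrFun (((sol_spec hA (memLp_mulVec hB hu) s x).restart hA (memLp_mulVec hB hu) r).eq_sol hA
    (memLp_mulVec hB hu)) t

theorem phi_lincomb (hA : ∀ i j, MemLp (fun t => A t i j) ⊤ volume)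
    (hB : ∀ i j, MemLp (fun t => B t i j) ⊤ volume) (hu : MemLp u ⊤ volume)
    (hv : MemLp v ⊤ volume) (t s : ℝ) (x y : Fin d → ℝ) (a b : ℝ) :
    phi A B t s (a • x + b • y) (fun r => a • u r + b • v r) =
      a • phi A B t s x u + b • phi A B t s y v := by
  have hu' := memLp_mulVec hB hu
  have hv' := memLp_mulVec hB hv
  have h := ((sol_spec hA hu' s x).lincomb hA hu' hv' (sol_spec hA hv' s y) a b).eq_sol hA
    ((hu'.const_smul a).add (hv'.const_smul b))
  have h2 : (fun r => (B r).mulVec (a • u r + b • v r)) =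
      fun r => a • (B r).mulVec (u r) + b • (B r).mulVec (v r) := by
    ext1 r; rw [Matrix.mulVec_add, Matrix.mulVec_smul, Matrix.mulVec_smul]
  unfold phi
  rw [h2]
  exact congrFun h t

theorem phi_add (hA : ∀ i j, MemLp (fun t => A t i j) ⊤ volume)
    (hB : ∀ i j, MemLp (fun t => B t i j) ⊤ volume) (hu : MemLp u ⊤ volume)
    (hv : MemLp v ⊤ volume) (t s : ℝ) (x y : Fin d → ℝ) :
    phi A B t s (x + y) (fun r => u r + v r) = phi A B t s x u + phi A B t s y v := by
  simpa using phi_lincomb hA hB hu hv t s x y 1 1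

theorem phi_smul (hA : ∀ i j, MemLp (fun t => A t i j) ⊤ volume)
    (hB : ∀ i j, MemLp (fun t => B t i j) ⊤ volume) (hu : MemLp u ⊤ volume)
    (t s : ℝ) (x : Fin d → ℝ) (a : ℝ) :
    phi A B t s (a • x) (fun r => a • u r) = a • phi A B t s x u := by
  simpa using phi_lincomb hA hB hu hu t s x x a 0

theorem phi_sum (hA : ∀ i j, MemLp (fun t => A t i j) ⊤ volume)
    (hB : ∀ i j, MemLp (fun t => B t i j) ⊤ volume) {ι : Type*} (S : Finset ι)
    {w : ι → ℝ → Fin m → ℝ} (hw : ∀ i, MemLp (w i) ⊤ volume)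
    (t s : ℝ) (x : ι → Fin d → ℝ) (a : ι → ℝ) :
    phi A B t s (∑ i ∈ S, a i • x i) (fun r => ∑ i ∈ S, a i • w i r) =
      ∑ i ∈ S, a i • phi A B t s (x i) (w i) := by
  classical
  induction S using Finset.induction_on with
  | empty =>
    simpa using phi_smul hA hB (u := fun _ => 0) MemLp.zero' t s 0 0
  | insert i S hi ih =>
    simp only [Finset.sum_insert hi]
    rw [← ih, ← phi_smul hA hB (hw i)]
    exact phi_add hA hB ((hw i).const_smul (a i))
      (memLp_finsetSum S fun j _ => (hw j).const_smul (a j)) t s _ _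

theorem phi_shift (hA : ∀ i j, MemLp (fun t => A t i j) ⊤ volume)
    (hB : ∀ i j, MemLp (fun t => B t i j) ⊤ volume) {c : ℝ} (hAc : ∀ᵐ t, A (t + c) = A t)
    (hBc : ∀ᵐ t, B (t + c) = B t) (hu : MemLp u ⊤ volume) (t s : ℝ) (x : Fin d → ℝ) :
    phi A B (t + c) (s + c) x u = phi A B t s x fun r => u (r + c) := by
  have h1 := (sol_spec hA (memLp_mulVec hB hu) (s + c) x).shift hAc
  have h2 := memLp_mulVec hB (memLp_comp_add_right hu c)
  exact (((sol_spec hA h2 s x).eq_at hA h2 (memLp_comp_add_right (memLp_mulVec hB hu) c) h1 (by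
    filter_upwards [hBc] with r hr _
    rw [hr]))).symm

theorem phi_reverse (hA : ∀ i j, MemLp (fun t => A t i j) ⊤ volume)
    (hB : ∀ i j, MemLp (fun t => B t i j) ⊤ volume) (hu : MemLp u ⊤ volume) (t s : ℝ)
    (x : Fin d → ℝ) :
    phi (fun t => -A (-t)) (fun t => -B (-t)) t s x (fun r => u (-r)) = phi A B (-t) (-s) x u := by
  have h1 := (sol_spec hA (memLp_mulVec hB hu) (-s) x).reverse
  rw [neg_neg] at h1
  have hA' : ∀ i j, MemLp (fun t => (-A (-t)) i j) ⊤ volume := fun i j =>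
    (memLp_comp_neg (hA i j)).neg
  have h2 := h1.eq_sol hA' (memLp_comp_neg (memLp_mulVec hB hu)).neg
  have h3 : (fun r => (-B (-r)).mulVec (u (-r))) = fun r => -(B (-r)).mulVec (u (-r)) := by
    ext1 r; rw [Matrix.neg_mulVec]
  unfold phi
  rw [h3]
  exact congrFun h2 t

theorem continuous_phi (hA : ∀ i j, MemLp (fun t => A t i j) ⊤ volume)
    (hB : ∀ i j, MemLp (fun t => B t i j) ⊤ volume) (hu : MemLp u ⊤ volume) (s : ℝ)
    (x : Fin d → ℝ) : Continuous fun t => phi A B t s x u :=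
  (sol_spec hA (memLp_mulVec hB hu) s x).1

theorem memLp_zero_control : MemLp (fun _ : ℝ => (0 : Fin m → ℝ)) ⊤ volume := MemLp.zero'

theorem phi_zero_zero (hA : ∀ i j, MemLp (fun t => A t i j) ⊤ volume)
    (hB : ∀ i j, MemLp (fun t => B t i j) ⊤ volume) (t s : ℝ) :
    phi A B t s 0 (fun _ => 0) = 0 := by
  simpa using phi_smul hA hB memLp_zero_control t s 0 0

/-! ### The fundamental solution -/

theorem fundamental_mulVec (hA : ∀ i j, MemLp (fun t => A t i j) ⊤ volume)
    (hB : ∀ i j, MemLp (fun t => B t i j) ⊤ volume) (t s : ℝ) (x : Fin d → ℝ) :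
    (fundamental A t s).mulVec x = phi A B t s x fun _ => 0 := by
  have h0 : (fun r => (B r).mulVec (0 : Fin m → ℝ)) = 0 := by ext1 r; simp
  have h1 := phi_sum hA hB Finset.univ (fun _ : Fin d => memLp_zero_control (m := m)) t s
    (fun i => Pi.single i 1) x
  have h2 : ∑ i, x i • (Pi.single i 1 : Fin d → ℝ) = x := by
    ext i; simp [Finset.sum_apply, Pi.single_apply]
  simp only [h2, smul_zero, Finset.sum_const_zero] at h1
  rw [h1]
  ext i
  simp only [fundamental, phi, h0, Matrix.mulVec, dotProduct, Matrix.of_apply, Finset.sum_apply,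
    Pi.smul_apply, smul_eq_mul]
  exact Finset.sum_congr rfl fun j _ => mul_comm _ _

theorem phi_eq (hA : ∀ i j, MemLp (fun t => A t i j) ⊤ volume)
    (hB : ∀ i j, MemLp (fun t => B t i j) ⊤ volume) (hu : MemLp u ⊤ volume)
    (t s : ℝ) (x : Fin d → ℝ) :
    phi A B t s x u = (fundamental A t s).mulVec x + phi A B t s 0 u := by
  rw [fundamental_mulVec hA hB]
  simpa using phi_add hA hB memLp_zero_control hu t s x 0

theorem fundamental_mul (hA : ∀ i j, MemLp (fun t => A t i j) ⊤ volume) (t r s : ℝ) :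
    fundamental A t r * fundamental A r s = fundamental A t s := by
  have hB : ∀ i j, MemLp (fun t => (fun _ => 0 : ℝ → Matrix (Fin d) (Fin 0) ℝ) t i j) ⊤ volume :=
    fun _ j => j.elim0
  refine Matrix.ext_of_mulVec_single fun j => ?_
  rw [← Matrix.mulVec_mulVec, fundamental_mulVec hA hB, fundamental_mulVec hA hB,
    fundamental_mulVec hA hB, phi_trans hA hB memLp_zero_control]

theorem fundamental_self (hA : ∀ i j, MemLp (fun t => A t i j) ⊤ volume) (t : ℝ) :
    fundamental A t t = 1 := by
  have hB : ∀ i j, MemLp (fun t => (fun _ => 0 : ℝ → Matrix (Fin d) (Fin 0) ℝ) t i j) ⊤ volume :=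
    fun _ j => j.elim0
  refine Matrix.ext_of_mulVec_single fun j => ?_
  rw [fundamental_mulVec hA hB, phi_self hA hB memLp_zero_control, Matrix.one_mulVec]

theorem fundamental_inv (hA : ∀ i j, MemLp (fun t => A t i j) ⊤ volume) (t s : ℝ) :
    (fundamental A t s)⁻¹ = fundamental A s t :=
  Matrix.inv_eq_right_inv (by rw [fundamental_mul hA, fundamental_self hA])

theorem isUnit_fundamental (hA : ∀ i j, MemLp (fun t => A t i j) ⊤ volume) (t s : ℝ) :
    IsUnit (fundamental A t s) :=
  IsUnit.of_mul_eq_one (fundamental A s t) (by rw [fundamental_mul hA, fundamental_self hA])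

theorem fundamental_shift (hA : ∀ i j, MemLp (fun t => A t i j) ⊤ volume) {c : ℝ}
    (hAc : ∀ᵐ t, A (t + c) = A t) (t s : ℝ) :
    fundamental A (t + c) (s + c) = fundamental A t s := by
  have hB : ∀ i j, MemLp (fun t => (fun _ => 0 : ℝ → Matrix (Fin d) (Fin 0) ℝ) t i j) ⊤ volume :=
    fun _ j => j.elim0
  refine Matrix.ext_of_mulVec_single fun j => ?_
  rw [fundamental_mulVec hA hB, fundamental_mulVec hA hB,
    phi_shift hA hB hAc (.of_forall fun _ => rfl) memLp_zero_control]

theorem fundamental_reverse (hA : ∀ i j, MemLp (fun t => A t i j) ⊤ volume) (t s : ℝ) :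
    fundamental (fun t => -A (-t)) t s = fundamental A (-t) (-s) := by
  have hB : ∀ i j, MemLp (fun t => (fun _ => 0 : ℝ → Matrix (Fin d) (Fin 0) ℝ) t i j) ⊤ volume :=
    fun _ j => j.elim0
  have hB' : ∀ i j, MemLp (fun t => (fun t => -(fun _ => 0 : ℝ → Matrix (Fin d) (Fin 0) ℝ) (-t))
    t i j) ⊤ volume := fun _ j => j.elim0
  have hA' : ∀ i j, MemLp (fun t => (fun t => -A (-t)) t i j) ⊤ volume := fun i j =>
    (memLp_comp_neg (hA i j)).neg
  refine Matrix.ext_of_mulVec_single fun j => ?_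
  rw [fundamental_mulVec hA hB, fundamental_mulVec hA' hB',
    ← phi_reverse hA hB memLp_zero_control]

theorem continuous_fundamental_left (hA : ∀ i j, MemLp (fun t => A t i j) ⊤ volume) (s : ℝ) :
    Continuous fun t => fundamental A t s := by
  refine continuous_matrix fun i j => ?_
  exact (continuous_apply i).comp (sol_spec hA MemLp.zero s _).1

/-- Continuity in the initial time comes from `X(t, s) = X(t, 0) X(0, s)`, where `X(0, s)` is the
inverse of `X(s, 0)`. -/
theorem continuous_fundamental (hA : ∀ i j, MemLp (fun t => A t i j) ⊤ volume) :
    Continuous fun p : ℝ × ℝ => fundamental A p.1 p.2 := by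
  have h0 : Continuous fun t => fundamental A 0 t := by
    refine continuous_iff_continuousAt.2 fun t => ?_
    have h1 : (fun t => fundamental A 0 t) = fun t => (fundamental A t 0)⁻¹ := by
      ext1 t; rw [fundamental_inv hA]
    rw [h1]
    have h2 := (Matrix.isUnit_iff_isUnit_det _).1 (isUnit_fundamental hA t 0)
    exact ContinuousAt.comp (f := fun t => fundamental A t 0)
      (continuousAt_matrix_inv _ (NormedRing.inverse_continuousAt h2.unit))
      (continuous_fundamental_left hA 0).continuousAt
  have h : (fun p : ℝ × ℝ => fundamental A p.1 p.2) =
      fun p => fundamental A p.1 0 * fundamental A 0 p.2 := by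
    ext1 p; rw [fundamental_mul hA]
  rw [h]
  exact ((continuous_fundamental_left hA 0).comp continuous_fst).mul (h0.comp continuous_snd)

/-- The solution depends continuously on final time, initial time and initial state. -/
theorem continuous_phi_joint (hA : ∀ i j, MemLp (fun t => A t i j) ⊤ volume)
    (hB : ∀ i j, MemLp (fun t => B t i j) ⊤ volume) (hu : MemLp u ⊤ volume) :
    Continuous fun p : ℝ × ℝ × (Fin d → ℝ) => phi A B p.1 p.2.1 p.2.2 u := by
  have h : ∀ t s x, phi A B t s x u =
      (fundamental A t s).mulVec (x - phi A B s 0 0 u) + phi A B t 0 0 u := fun t s x => by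
    rw [← phi_trans hA hB hu t s 0, phi_eq hA hB hu t s x, phi_eq hA hB hu t s (phi A B s 0 0 u),
      Matrix.mulVec_sub]
    abel
  rw [show (fun p : ℝ × ℝ × (Fin d → ℝ) => phi A B p.1 p.2.1 p.2.2 u) = _ from
    funext fun p => h p.1 p.2.1 p.2.2]
  have h1 := continuous_phi hA hB hu 0 0
  have h2 := continuous_fundamental hA
  exact ((h2.comp (continuous_fst.prodMk (continuous_fst.comp continuous_snd))).matrix_mulVec
    ((continuous_snd.comp continuous_snd).sub
      (h1.comp (continuous_fst.comp continuous_snd)))).add (h1.comp continuous_fst)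

end Phi

/-! ### Generalized eigenspaces -/

section GenEigenspace

open Module.End Filter Topology

variable {E F : Type*} [AddCommGroup E] [Module ℂ E] [AddCommGroup F] [Module ℂ F]

theorem mem_maxGenEigenspace_of_sub {f : Module.End ℂ E} {μ : ℂ} {v : E}
    (h : f v - μ • v ∈ maxGenEigenspace f μ) : v ∈ maxGenEigenspace f μ := by
  rw [mem_maxGenEigenspace] at h ⊢
  obtain ⟨k, hk⟩ := h
  exact ⟨k + 1, by rw [pow_succ]; simpa using hk⟩

/-- Induction on the power of `f - μ` that kills the vector; it takes the place of Jordan chains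
below. -/
theorem maxGenEigenspace_induction {f : Module.End ℂ E} {μ : ℂ} {P : E → Prop} (h0 : P 0)
    (hs : ∀ v, P (f v - μ • v) → P v) {v : E} (hv : v ∈ maxGenEigenspace f μ) : P v := by
  rw [mem_maxGenEigenspace] at hv
  obtain ⟨k, hk⟩ := hv
  induction k generalizing v with
  | zero => simp only [pow_zero, one_apply] at hk; rwa [hk]
  | succ k ih => exact hs v (ih (by rw [pow_succ] at hk; simpa using hk))

theorem map_mem_maxGenEigenspace {f : Module.End ℂ E} {g : Module.End ℂ F} {μ ν : ℂ}
    (c : E →+ F) (hc : ∀ v, c (f v - μ • v) = g (c v) - ν • c v) {v : E}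
    (hv : v ∈ maxGenEigenspace f μ) : c v ∈ maxGenEigenspace g ν :=
  maxGenEigenspace_induction (P := fun v => c v ∈ maxGenEigenspace g ν)
    (by rw [map_zero]; exact zero_mem _)
    (fun v h => mem_maxGenEigenspace_of_sub (hc v ▸ h)) hv

theorem mem_maxGenEigenspace_inv {f g : Module.End ℂ E} (hgf : g * f = 1) {μ : ℂ} (hμ : μ ≠ 0)
    {v : E} (hv : v ∈ maxGenEigenspace f μ) : v ∈ maxGenEigenspace g μ⁻¹ := by
  refine maxGenEigenspace_induction (zero_mem _) (fun v h => mem_maxGenEigenspace_of_sub ?_) hv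
  have h1 := mapsTo_maxGenEigenspace_of_comm (Commute.refl g) μ⁻¹ h
  have h2 : g (f v) = v := by rw [← mul_apply, hgf, one_apply]
  have h3 : g v - μ⁻¹ • v = (-μ⁻¹) • g (f v - μ • v) := by
    rw [map_sub, h2, map_smul, smul_sub, smul_smul, neg_mul, inv_mul_cancel₀ hμ]
    module
  rw [h3]
  exact Submodule.smul_mem _ _ h1

/-- Summing the recursion bounds each partial sum of `a` by `(a 0 + ∑ b) / (1 - q)`, the fixed point
of `S ↦ q S + a 0 + ∑ b`. -/
theorem summable_of_le_mul_add {a b : ℕ → ℝ} {q : ℝ} (hq0 : 0 ≤ q) (hq : q < 1)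
    (ha : ∀ k, 0 ≤ a k) (hb : ∀ k, 0 ≤ b k) (hbs : Summable b)
    (h : ∀ k, a (k + 1) ≤ q * a k + b k) : Summable a := by
  have hq' : 0 < 1 - q := by linarith
  refine summable_of_sum_range_le (c := (a 0 + ∑' k, b k) / (1 - q)) ha fun n => ?_
  have hB : 0 ≤ ∑' k, b k := tsum_nonneg hb
  induction n with
  | zero => simpa using div_nonneg (add_nonneg (ha 0) hB) hq'.le
  | succ n ih =>
    rw [Finset.sum_range_succ']
    have h1 : ∑ k ∈ Finset.range n, a (k + 1) ≤
        q * ∑ k ∈ Finset.range n, a k + ∑ k ∈ Finset.range n, b k := by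
      rw [Finset.mul_sum, ← Finset.sum_add_distrib]
      exact Finset.sum_le_sum fun k _ => h k
    have h2 := hbs.sum_le_tsum (Finset.range n) fun k _ => hb k
    have h3 := mul_le_mul_of_nonneg_left ih hq0
    have h4 : q * ((a 0 + ∑' k, b k) / (1 - q)) + (a 0 + ∑' k, b k) =
        (a 0 + ∑' k, b k) / (1 - q) := by field_simp; ring
    linarith

/-- Going up one step along the chain, `f ^ (k + 1) v = μ f ^ k v + f ^ k (f v - μ v)` is a
contractive recursion whose inhomogeneity is summable by induction. -/
theorem summable_norm_pow_apply {E : Type*} [NormedAddCommGroup E] [NormedSpace ℂ E]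
    {f : Module.End ℂ E} {μ : ℂ} (hμ : ‖μ‖ < 1) {v : E} (hv : v ∈ maxGenEigenspace f μ) :
    Summable fun k => ‖(f ^ k) v‖ := by
  refine maxGenEigenspace_induction (P := fun v => Summable fun k => ‖(f ^ k) v‖) (by simp)
    (fun v h => ?_) hv
  refine summable_of_le_mul_add (norm_nonneg μ) hμ (fun _ => norm_nonneg _)
    (fun _ => norm_nonneg _) h fun k => ?_
  have : (f ^ (k + 1)) v = μ • (f ^ k) v + (f ^ k) (f v - μ • v) := by
    rw [pow_succ, mul_apply, map_sub, map_smul]; abel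
  rw [this, ← norm_smul]
  exact norm_add_le _ _

/-- Once `L` vanishes on the orbit of `f v - μ v`, it satisfies `L (f ^ k v) = μ ^ k L v`. Since `1
≤ ‖μ‖`, this can only tend to 0 along the times `a i` if `L v = 0`. -/
theorem functional_eq_zero {f : Module.End ℂ E} {L : E →ₗ[ℂ] ℂ} {a : ℕ → ℕ}
    (hL : ∀ v, Tendsto (fun i => L ((f ^ a i) v)) atTop (𝓝 0))
    {μ : ℂ} (hμ : 1 ≤ ‖μ‖) {v : E} (hv : v ∈ maxGenEigenspace f μ) : L v = 0 := by
  suffices h : ∀ k, L ((f ^ k) v) = 0 by simpa using h 0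
  refine maxGenEigenspace_induction (P := fun v => ∀ k, L ((f ^ k) v) = 0) (by simp)
    (fun v h => ?_) hv
  have h1 : ∀ k, L ((f ^ k) v) = μ ^ k * L v := fun k => by
    induction k with
    | zero => simp
    | succ k ih =>
      have : (f ^ (k + 1)) v = μ • (f ^ k) v + (f ^ k) (f v - μ • v) := by
        rw [pow_succ, mul_apply, map_sub, map_smul]; abel
      rw [this, map_add, h k, map_smul, ih, smul_eq_mul]
      ring
  have h2 : ‖L v‖ ≤ 0 := by
    refine ge_of_tendsto' (by simpa using (hL v).norm) fun i => ?_
    rw [h1, norm_mul, norm_pow]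
    exact le_mul_of_one_le_left (norm_nonneg _) (one_le_pow₀ hμ)
  intro k
  rw [h1, norm_le_zero_iff.1 h2, mul_zero]

end GenEigenspace

/-! ### Sums of real generalized eigenspaces -/

section SpectralSum

open Module.End Filter Topology

variable {d : ℕ}

/-- The sum of the real generalized eigenspaces of `M` for the `μ ∈ ℂ` with `p μ`. -/
noncomputable def spectralSum (M : Matrix (Fin d) (Fin d) ℝ) (p : ℂ → Prop) :
    Submodule ℝ (Fin d → ℝ) :=
  ⨆ μ : ℂ, ⨆ _ : p μ, realGenEigenspace M μ

/-- The complexification of a real matrix, as an endomorphism. -/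
noncomputable def complexEnd (M : Matrix (Fin d) (Fin d) ℝ) : Module.End ℂ (Fin d → ℂ) :=
  Matrix.toLin' (M.map Complex.ofReal)

theorem complexEnd_apply (M : Matrix (Fin d) (Fin d) ℝ) (v : Fin d → ℂ) (i : Fin d) :
    complexEnd M v i = ∑ j, (M i j : ℂ) * v j := by
  simp [complexEnd, Matrix.mulVec, dotProduct]

theorem complexEnd_mul (M N : Matrix (Fin d) (Fin d) ℝ) :
    complexEnd (M * N) = complexEnd M * complexEnd N := by
  unfold complexEnd
  rw [show (M * N).map Complex.ofReal = M.map Complex.ofReal * N.map Complex.ofReal from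
    Matrix.map_mul (f := Complex.ofRealHom), Matrix.toLin'_mul]
  rfl

theorem complexEnd_one : complexEnd (1 : Matrix (Fin d) (Fin d) ℝ) = 1 := by
  refine LinearMap.ext fun v => funext fun i => ?_
  simp [complexEnd_apply, Matrix.one_apply, apply_ite Complex.ofReal]

theorem complexEnd_pow (M : Matrix (Fin d) (Fin d) ℝ) (k : ℕ) :
    complexEnd (M ^ k) = complexEnd M ^ k := by
  induction k with
  | zero => simp [complexEnd_one]
  | succ k ih => rw [pow_succ, pow_succ, complexEnd_mul, ih]

theorem rePart_apply (v : Fin d → ℂ) (i : Fin d) : rePart d v i = (v i).re := rfl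

theorem rePart_complexEnd (M : Matrix (Fin d) (Fin d) ℝ) (v : Fin d → ℂ) :
    rePart d (complexEnd M v) = M.mulVec (rePart d v) := by
  ext i
  simp [rePart_apply, complexEnd_apply, Matrix.mulVec, dotProduct]

theorem mem_realGenEigenspace {M : Matrix (Fin d) (Fin d) ℝ} {μ : ℂ} {x : Fin d → ℝ} :
    x ∈ realGenEigenspace M μ ↔ ∃ v ∈ maxGenEigenspace (complexEnd M) μ, rePart d v = x := by
  simp [realGenEigenspace, complexEnd, Submodule.mem_map]

/-- Complex conjugation of the coordinates. -/
noncomputable def conjVec (d : ℕ) : (Fin d → ℂ) →+ (Fin d → ℂ) where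
  toFun v i := star (v i)
  map_zero' := by ext i; simp
  map_add' v w := by ext i; simp

theorem conjVec_complexEnd (M : Matrix (Fin d) (Fin d) ℝ) (v : Fin d → ℂ) :
    conjVec d (complexEnd M v) = complexEnd M (conjVec d v) := by
  ext i
  simp [conjVec, complexEnd_apply]

theorem conjVec_mem {M : Matrix (Fin d) (Fin d) ℝ} {μ : ℂ} {v : Fin d → ℂ}
    (hv : v ∈ maxGenEigenspace (complexEnd M) μ) :
    conjVec d v ∈ maxGenEigenspace (complexEnd M) (star μ) := by
  refine map_mem_maxGenEigenspace (conjVec d) (fun v => ?_) hv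
  rw [map_sub, conjVec_complexEnd]
  congr 1
  ext i
  simp [conjVec]

theorem spectralSum_mono {M : Matrix (Fin d) (Fin d) ℝ} {p q : ℂ → Prop} (h : ∀ μ, p μ → q μ) :
    spectralSum M p ≤ spectralSum M q :=
  iSup_mono fun μ => iSup_mono' fun hμ => ⟨h μ hμ, le_rfl⟩

theorem realGenEigenspace_le_spectralSum {M : Matrix (Fin d) (Fin d) ℝ} {p : ℂ → Prop} {μ : ℂ}
    (h : p μ) : realGenEigenspace M μ ≤ spectralSum M p :=
  le_iSup₂_of_le μ h le_rfl

theorem spectralSum_induction {M : Matrix (Fin d) (Fin d) ℝ} {p : ℂ → Prop}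
    {S : Submodule ℝ (Fin d → ℝ)}
    (h : ∀ μ, p μ → ∀ v ∈ maxGenEigenspace (complexEnd M) μ, rePart d v ∈ S) :
    spectralSum M p ≤ S :=
  iSup₂_le fun μ hμ x hx => by
    obtain ⟨v, hv, rfl⟩ := mem_realGenEigenspace.1 hx
    exact h μ hμ v hv

theorem rePart_mem_spectralSum {M : Matrix (Fin d) (Fin d) ℝ} {p : ℂ → Prop} {μ : ℂ} (hμ : p μ)
    {v : Fin d → ℂ} (hv : v ∈ maxGenEigenspace (complexEnd M) μ) :
    rePart d v ∈ spectralSum M p :=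
  realGenEigenspace_le_spectralSum hμ (mem_realGenEigenspace.2 ⟨v, hv, rfl⟩)

theorem spectralSum_or_le (M : Matrix (Fin d) (Fin d) ℝ) (p q : ℂ → Prop) :
    spectralSum M (fun μ => p μ ∨ q μ) ≤ spectralSum M p ⊔ spectralSum M q :=
  spectralSum_induction fun μ hμ v hv => by
    rcases hμ with hμ | hμ
    · exact Submodule.mem_sup_left (rePart_mem_spectralSum hμ hv)
    · exact Submodule.mem_sup_right (rePart_mem_spectralSum hμ hv)

theorem spectralSum_true (M : Matrix (Fin d) (Fin d) ℝ) :
    spectralSum M (fun _ => True) = ⊤ := by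
  rw [eq_top_iff]
  intro x _
  have hx : (fun i => (x i : ℂ)) ∈ ⨆ μ, maxGenEigenspace (complexEnd M) μ := by
    rw [iSup_maxGenEigenspace_eq_top]; trivial
  have : rePart d (fun i => (x i : ℂ)) ∈ spectralSum M (fun _ => True) := by
    refine Submodule.iSup_induction _ (motive := fun v => rePart d v ∈ spectralSum M fun _ => True)
      hx (fun μ v hv => rePart_mem_spectralSum trivial hv) (by rw [map_zero]; exact zero_mem _)
      fun v w hv hw => by rw [map_add]; exact add_mem hv hw
  simpa [rePart, LinearMap.compLeft, Function.comp_def] using this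

/-- Conjugation maps the generalized eigenspace of `μ` to that of its conjugate, so for a
conjugation-invariant `p` the real part `(v + conj v) / 2` stays in the complex sum. Independence of
the complex eigenspaces thus carries over to the real sums. -/
theorem ofReal_mem_of_mem_spectralSum {M : Matrix (Fin d) (Fin d) ℝ} {p : ℂ → Prop}
    (hp : ∀ μ, p μ → p (star μ)) {x : Fin d → ℝ} (hx : x ∈ spectralSum M p) :
    (fun i => (x i : ℂ)) ∈ ⨆ μ ∈ {μ | p μ}, maxGenEigenspace (complexEnd M) μ := by
  let S : Submodule ℝ (Fin d → ℝ) :=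
    ((⨆ μ ∈ {μ | p μ}, maxGenEigenspace (complexEnd M) μ).restrictScalars ℝ).comap
      (Complex.ofRealLI.toLinearMap.compLeft (Fin d))
  have h : spectralSum M p ≤ S := by
    refine spectralSum_induction fun μ hμ v hv => ?_
    have h1 : v ∈ ⨆ μ ∈ {μ | p μ}, maxGenEigenspace (complexEnd M) μ :=
      Submodule.mem_iSup_of_mem μ (Submodule.mem_iSup_of_mem hμ hv)
    have h2 : conjVec d v ∈ ⨆ μ ∈ {μ | p μ}, maxGenEigenspace (complexEnd M) μ :=
      Submodule.mem_iSup_of_mem (star μ) (Submodule.mem_iSup_of_mem (hp μ hμ) (conjVec_mem hv))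
    have h3 : (fun i => ((rePart d v i : ℝ) : ℂ)) = (1 / 2 : ℂ) • (v + conjVec d v) := by
      ext i
      simp only [rePart_apply, Complex.re_eq_add_conj, conjVec, Pi.smul_apply, Pi.add_apply,
        AddMonoidHom.coe_mk, ZeroHom.coe_mk, smul_eq_mul, Complex.star_def]
      ring
    change (fun i => ((rePart d v i : ℝ) : ℂ)) ∈
      ⨆ μ ∈ {μ | p μ}, maxGenEigenspace (complexEnd M) μ
    rw [h3]
    exact Submodule.smul_mem _ _ (add_mem h1 h2)
  exact h hx

theorem disjoint_spectralSum (M : Matrix (Fin d) (Fin d) ℝ) {p q : ℂ → Prop}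
    (hp : ∀ μ, p μ → p (star μ)) (hq : ∀ μ, q μ → q (star μ)) (hpq : ∀ μ, p μ → ¬ q μ) :
    Disjoint (spectralSum M p) (spectralSum M q) := by
  rw [Submodule.disjoint_def]
  intro x hx hx'
  have h := (independent_maxGenEigenspace (complexEnd M)).disjoint_biSup_biSup
    (s := {μ | p μ}) (t := {μ | q μ}) (Set.disjoint_left.2 hpq)
  have h0 := Submodule.disjoint_def.1 h _ (ofReal_mem_of_mem_spectralSum hp hx)
    (ofReal_mem_of_mem_spectralSum hq hx')
  ext i
  exact Complex.ofReal_eq_zero.1 (congrFun h0 i)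

/-- An intertwining matrix preserves generalized eigenspaces. Applied to `X(t, s)`, which
intertwines the monodromy matrices at `s` and `t`, it gives invariance of the spectral subbundles.
-/
theorem mulVec_mem_spectralSum {M N P : Matrix (Fin d) (Fin d) ℝ} (h : P * M = N * P)
    {p : ℂ → Prop} {x : Fin d → ℝ} (hx : x ∈ spectralSum M p) :
    P.mulVec x ∈ spectralSum N p := by
  have : spectralSum M p ≤ (spectralSum N p).comap P.mulVecLin := by
    refine spectralSum_induction fun μ hμ v hv => ?_
    rw [Submodule.mem_comap, Matrix.mulVecLin_apply, ← rePart_complexEnd]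
    refine rePart_mem_spectralSum hμ ?_
    refine map_mem_maxGenEigenspace (complexEnd P).toAddMonoidHom (fun v => ?_) hv
    change complexEnd P _ = complexEnd N (complexEnd P v) - μ • complexEnd P v
    rw [map_sub, map_smul, ← Module.End.mul_apply, ← complexEnd_mul, h, complexEnd_mul,
      Module.End.mul_apply]
  exact this hx

theorem spectralSum_inv_le {M N : Matrix (Fin d) (Fin d) ℝ} (h : N * M = 1) (p : ℂ → Prop) :
    spectralSum M (fun μ => μ ≠ 0 ∧ p μ⁻¹) ≤ spectralSum N p :=
  spectralSum_induction fun μ hμ v hv =>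
    rePart_mem_spectralSum hμ.2 (mem_maxGenEigenspace_inv (by
      rw [← complexEnd_mul, h, complexEnd_one]) hμ.1 hv)

theorem maxGenEigenspace_zero {M N : Matrix (Fin d) (Fin d) ℝ} (h : N * M = 1) {v : Fin d → ℂ}
    (hv : v ∈ maxGenEigenspace (complexEnd M) 0) : v = 0 := by
  refine maxGenEigenspace_induction (P := fun w => w = (0 : Fin d → ℂ)) (by rfl) (fun v h0 => ?_) hv
  rw [zero_smul, sub_zero] at h0
  have : complexEnd N (complexEnd M v) = v := by
    rw [← Module.End.mul_apply, ← complexEnd_mul, h, complexEnd_one, Module.End.one_apply]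
  rw [← this, h0, map_zero]

theorem spectralSum_ne_zero {M N : Matrix (Fin d) (Fin d) ℝ} (h : N * M = 1) (p : ℂ → Prop) :
    spectralSum M p ≤ spectralSum M fun μ => μ ≠ 0 ∧ p μ :=
  spectralSum_induction fun μ hμ v hv => by
    rcases eq_or_ne μ 0 with rfl | h0
    · rw [maxGenEigenspace_zero h hv, map_zero]; exact zero_mem _
    · exact rePart_mem_spectralSum ⟨h0, hμ⟩ hv

theorem summable_norm_pow_mulVec {M : Matrix (Fin d) (Fin d) ℝ} {x : Fin d → ℝ}
    (hx : x ∈ spectralSum M fun μ => ‖μ‖ < 1) : Summable fun k : ℕ => ‖(M ^ k).mulVec x‖ := by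
  let S : Submodule ℝ (Fin d → ℝ) :=
    { carrier := {x | Summable fun k : ℕ => ‖(M ^ k).mulVec x‖}
      zero_mem' := by simp
      add_mem' := fun {x y} hx hy => by
        refine (hx.add hy).of_nonneg_of_le (fun _ => norm_nonneg _) fun k => ?_
        rw [Matrix.mulVec_add]; exact norm_add_le _ _
      smul_mem' := fun c x hx => by
        refine (hx.mul_left ‖c‖).congr fun k => ?_
        rw [Matrix.mulVec_smul, norm_smul] }
  have : (spectralSum M fun μ => ‖μ‖ < 1) ≤ S := by
    refine spectralSum_induction fun μ hμ v hv => ?_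
    refine (summable_norm_pow_apply hμ hv).of_nonneg_of_le (fun _ => norm_nonneg _) fun k => ?_
    rw [← rePart_complexEnd, complexEnd_pow, pi_norm_le_iff_of_nonneg (norm_nonneg _)]
    intro i
    exact (Complex.abs_re_le_norm _).trans (norm_le_pi_norm ((complexEnd M ^ k) v) i)
  exact this hx

theorem functional_eq_zero_of_mem_spectralSum {M : Matrix (Fin d) (Fin d) ℝ}
    {l : (Fin d → ℝ) →ₗ[ℝ] ℝ} {a : ℕ → ℕ}
    (hl : ∀ x, Tendsto (fun i => l ((M ^ a i).mulVec x)) atTop (𝓝 0))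
    {x : Fin d → ℝ} (hx : x ∈ spectralSum M fun μ => 1 ≤ ‖μ‖) : l x = 0 := by
  let L : (Fin d → ℂ) →ₗ[ℂ] ℂ :=
    ∑ j, ((l (Pi.single j 1) : ℝ) : ℂ) • LinearMap.proj j
  have hl' : ∀ y, l y = ∑ j, l (Pi.single j 1) * y j := fun y => by
    conv_lhs => rw [show y = ∑ j, y j • (Pi.single j 1 : Fin d → ℝ) by
      ext i; simp [Finset.sum_apply, Pi.single_apply]]
    simp [map_sum, mul_comm]
  have hre : ∀ v, (L v).re = l (rePart d v) := fun v => by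
    rw [hl']; simp [L, rePart_apply]
  have hL : ∀ v, Tendsto (fun i => L ((complexEnd M ^ a i) v)) atTop (𝓝 0) := fun v => by
    -- The imaginary part of `L` is again the real functional `l`, evaluated on the real part of `i
    -- v`, so both parts tend to 0.
    have him : ∀ v, (L v).im = -l (rePart d (Complex.I • v)) := fun v => by
      rw [← hre, map_smul]; simp
    have h1 : ∀ i, L ((complexEnd M ^ a i) v) = ((l ((M ^ a i).mulVec (rePart d v)) : ℝ) : ℂ) +
        ((-l ((M ^ a i).mulVec (rePart d (Complex.I • v))) : ℝ) : ℂ) * Complex.I := fun i => by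
      rw [← rePart_complexEnd, ← rePart_complexEnd, map_smul, complexEnd_pow, ← hre, ← him,
        Complex.re_add_im]
    simp_rw [h1]
    have h2 := (Complex.continuous_ofReal.tendsto 0).comp (hl (rePart d v))
    have h3 := (Complex.continuous_ofReal.tendsto _).comp (hl (rePart d (Complex.I • v))).neg
    simpa using h2.add (h3.mul_const Complex.I)
  have : (spectralSum M fun μ => 1 ≤ ‖μ‖) ≤ LinearMap.ker l :=
    spectralSum_induction fun μ hμ v hv => by
      rw [LinearMap.mem_ker, ← hre, functional_eq_zero hL hμ hv, Complex.zero_re]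
  exact this hx

end SpectralSum

/-! ### The Floquet subbundles -/

section Floquet

variable {d : ℕ} {A : ℝ → Matrix (Fin d) (Fin d) ℝ} {T τ : ℝ}

/-- Values `μ` that are not eigenvalues contribute nothing. The condition `μ ≠ 0` matters because
`Real.log 0 = 0` would count `μ = 0` as a center multiplier; it can be imposed since the monodromy
matrix is invertible. -/
theorem floquetSpace_eq (hA : ∀ i j, MemLp (fun t => A t i j) ⊤ volume) (lam : ℝ) :
    floquetSpace A T lam τ =
      spectralSum (fundamental A (T + τ) τ) fun μ => μ ≠ 0 ∧ 1 / T * Real.log ‖μ‖ = lam := by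
  have hinv : fundamental A τ (T + τ) * fundamental A (T + τ) τ = 1 := by
    rw [fundamental_mul hA, fundamental_self hA]
  refine le_antisymm (le_trans ?_ (spectralSum_ne_zero hinv _))
    (spectralSum_induction fun μ hμ v hv => ?_)
  · exact iSup₂_le fun μ hμ => realGenEigenspace_le_spectralSum hμ.2
  · by_cases h : Module.End.HasEigenvalue (complexEnd (fundamental A (T + τ) τ)) μ
    · exact Submodule.mem_iSup_of_mem μ (Submodule.mem_iSup_of_mem ⟨h, hμ.2⟩
        (mem_realGenEigenspace.2 ⟨v, hv, rfl⟩))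
    · have : v = 0 := by
        refine maxGenEigenspace_induction (P := fun w => w = (0 : Fin d → ℂ)) (by rfl) (fun v h0 => ?_) hv
        by_contra hne
        exact h (Module.End.hasEigenvalue_of_hasEigenvector
          ⟨Module.End.mem_eigenspace_iff.2 (sub_eq_zero.1 h0), hne⟩)
      rw [this, map_zero]; exact zero_mem _

theorem iSup_floquetSpace_eq (hA : ∀ i j, MemLp (fun t => A t i j) ⊤ volume) {q : ℝ → Prop} :
    ⨆ lam : ℝ, ⨆ _ : q lam, floquetSpace A T lam τ =
      spectralSum (fundamental A (T + τ) τ) fun μ => μ ≠ 0 ∧ q (1 / T * Real.log ‖μ‖) := by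
  refine le_antisymm (iSup₂_le fun lam hlam => ?_) (spectralSum_induction fun μ hμ v hv => ?_)
  · rw [floquetSpace_eq hA]
    exact spectralSum_mono fun μ hμ => ⟨hμ.1, hμ.2 ▸ hlam⟩
  · refine Submodule.mem_iSup_of_mem _ (Submodule.mem_iSup_of_mem hμ.2 ?_)
    rw [floquetSpace_eq hA]
    exact rePart_mem_spectralSum ⟨hμ.1, rfl⟩ hv

theorem stableSpace_eq (hA : ∀ i j, MemLp (fun t => A t i j) ⊤ volume) (hT : 0 < T) :
    stableSpace A T τ = spectralSum (fundamental A (T + τ) τ) fun μ => ‖μ‖ < 1 := by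
  have hinv : fundamental A τ (T + τ) * fundamental A (T + τ) τ = 1 := by
    rw [fundamental_mul hA, fundamental_self hA]
  unfold stableSpace
  rw [iSup_floquetSpace_eq hA]
  refine le_antisymm (spectralSum_mono fun μ hμ => ?_)
    ((spectralSum_ne_zero hinv _).trans (spectralSum_mono fun μ hμ => ⟨hμ.1, ?_⟩))
  · rw [← neg_pos, ← mul_neg, mul_pos_iff_of_pos_left (by positivity), neg_pos] at hμ
    exact (Real.log_neg_iff (norm_pos_iff.2 hμ.1)).1 hμ.2
  · rw [← neg_pos, ← mul_neg, mul_pos_iff_of_pos_left (by positivity), neg_pos]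
    exact Real.log_neg (norm_pos_iff.2 hμ.1) hμ.2

theorem unstableSpace_eq (hA : ∀ i j, MemLp (fun t => A t i j) ⊤ volume) (hT : 0 < T) :
    unstableSpace A T τ = spectralSum (fundamental A (T + τ) τ) fun μ => 1 < ‖μ‖ := by
  have hinv : fundamental A τ (T + τ) * fundamental A (T + τ) τ = 1 := by
    rw [fundamental_mul hA, fundamental_self hA]
  unfold unstableSpace
  rw [iSup_floquetSpace_eq hA]
  refine le_antisymm (spectralSum_mono fun μ hμ => ?_)
    ((spectralSum_ne_zero hinv _).trans (spectralSum_mono fun μ hμ => ⟨hμ.1, ?_⟩))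
  · rw [mul_pos_iff_of_pos_left (by positivity)] at hμ
    exact (Real.log_pos_iff (norm_nonneg _)).1 hμ.2
  · rw [mul_pos_iff_of_pos_left (by positivity)]
    exact Real.log_pos hμ.2

theorem centerSpace_eq (hA : ∀ i j, MemLp (fun t => A t i j) ⊤ volume) (hT : 0 < T) :
    centerSpace A T τ = spectralSum (fundamental A (T + τ) τ) fun μ => ‖μ‖ = 1 := by
  have hinv : fundamental A τ (T + τ) * fundamental A (T + τ) τ = 1 := by
    rw [fundamental_mul hA, fundamental_self hA]
  unfold centerSpace
  rw [floquetSpace_eq hA]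
  refine le_antisymm (spectralSum_mono fun μ hμ => ?_)
    ((spectralSum_ne_zero hinv _).trans (spectralSum_mono fun μ hμ => ⟨hμ.1, ?_⟩))
  · have h := (mul_eq_zero.1 hμ.2).resolve_left (by positivity)
    exact Real.eq_one_of_pos_of_log_eq_zero (norm_pos_iff.2 hμ.1) h
  · rw [hμ.2, Real.log_one, mul_zero]

end Floquet

/-! ### Admissible controls and concatenation -/

section Controls

variable {d m : ℕ} {A : ℝ → Matrix (Fin d) (Fin d) ℝ} {B : ℝ → Matrix (Fin d) (Fin m) ℝ}
  {U : Set (Fin m → ℝ)} {u v : ℝ → Fin m → ℝ} {t r s : ℝ}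

theorem zero_mem_controls (h0 : (0 : Fin m → ℝ) ∈ U) : (fun _ => 0) ∈ controls U :=
  ⟨memLp_zero_control, .of_forall fun _ => h0⟩

theorem comp_add_right_mem_controls (hu : u ∈ controls U) (c : ℝ) :
    (fun r => u (r + c)) ∈ controls U :=
  ⟨memLp_comp_add_right hu.1 c, ae_comp_add_right hu.2 c⟩

theorem comp_neg_mem_controls (hu : u ∈ controls U) : (fun r => u (-r)) ∈ controls U :=
  ⟨memLp_comp_neg hu.1, ae_comp_neg hu.2⟩

theorem lincomb_mem_controls (hU : Convex ℝ U) (hu : u ∈ controls U) (hv : v ∈ controls U)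
    {a b : ℝ} (ha : 0 ≤ a) (hb : 0 ≤ b) (hab : a + b = 1) :
    (fun r => a • u r + b • v r) ∈ controls U :=
  ⟨(hu.1.const_smul a).add (hv.1.const_smul b), by
    filter_upwards [hu.2, hv.2] with r h1 h2 using hU h1 h2 ha hb hab⟩

/-- Membership in `uIcc` allows either direction of time, so the same lemma serves reachable and
controllable sets. -/
theorem exists_concat (hA : ∀ i j, MemLp (fun t => A t i j) ⊤ volume)
    (hB : ∀ i j, MemLp (fun t => B t i j) ⊤ volume) (hu : u ∈ controls U) (hv : v ∈ controls U)
    (hr : r ∈ uIcc s t) :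
    ∃ w ∈ controls U, ∀ x, phi A B t s x w = phi A B t r (phi A B r s x v) u := by
  classical
  have hw : (uIoc r t).piecewise u v ∈ controls U := by
    refine ⟨MemLp.piecewise measurableSet_uIoc (hu.1.restrict _) (hv.1.restrict _), ?_⟩
    filter_upwards [hu.2, hv.2] with q h1 h2
    by_cases hq : q ∈ uIoc r t
    · rwa [piecewise_eq_of_mem _ _ _ hq]
    · rwa [piecewise_eq_of_notMem _ _ _ hq]
  refine ⟨_, hw, fun x => ?_⟩
  rw [← phi_trans hA hB hw.1 t r s x]
  have h1 : phi A B r s x ((uIoc r t).piecewise u v) = phi A B r s x v := by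
    refine phi_congr hA hB hw.1 hv.1 (.of_forall fun q hq => piecewise_eq_of_notMem _ _ _ ?_) x
    intro hq'
    rw [mem_uIoc] at hq hq'
    rcases mem_uIcc.1 hr with h | h <;> rcases hq with h2 | h2 <;> rcases hq' with h3 | h3 <;>
      linarith [h2.1, h2.2, h3.1, h3.2]
  rw [h1]
  exact phi_congr hA hB hw.1 hu.1 (.of_forall fun q hq => piecewise_eq_of_mem _ _ _ hq) _

theorem mem_reach_phi (hA : ∀ i j, MemLp (fun t => A t i j) ⊤ volume)
    (hB : ∀ i j, MemLp (fun t => B t i j) ⊤ volume) (hr : r ∈ uIcc s t) (hu : u ∈ controls U)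
    {x y : Fin d → ℝ} (hx : x ∈ reach A B U r s y) : phi A B t r x u ∈ reach A B U t s y := by
  obtain ⟨v, hv, rfl⟩ := hx
  obtain ⟨w, hw, h⟩ := exists_concat hA hB hu hv hr
  exact ⟨w, hw, h y⟩

theorem reach_zero_mono (hA : ∀ i j, MemLp (fun t => A t i j) ⊤ volume)
    (hB : ∀ i j, MemLp (fun t => B t i j) ⊤ volume) (h0 : (0 : Fin m → ℝ) ∈ U)
    (hr : r ∈ uIcc s t) : reach A B U t r 0 ⊆ reach A B U t s 0 := by
  rintro x ⟨u, hu, rfl⟩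
  exact mem_reach_phi hA hB hr hu ⟨_, zero_mem_controls h0, phi_zero_zero hA hB r s⟩

theorem convex_reach (hA : ∀ i j, MemLp (fun t => A t i j) ⊤ volume)
    (hB : ∀ i j, MemLp (fun t => B t i j) ⊤ volume) (hU : Convex ℝ U) :
    Convex ℝ (reach A B U t s 0) := by
  rintro x ⟨u, hu, rfl⟩ y ⟨v, hv, rfl⟩ a b ha hb hab
  refine ⟨_, lincomb_mem_controls hU hu hv ha hb hab, ?_⟩
  simpa using phi_lincomb hA hB hu.1 hv.1 t s 0 0 a b

/-- Running the same control back from `t` to `s` shows that, for `s ≥ t`, `reach A B U t s 0`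
consists of the states steered from time `t` to the origin at time `s`. One definition thus covers
both families. -/
theorem mem_reach_zero_iff (hA : ∀ i j, MemLp (fun t => A t i j) ⊤ volume)
    (hB : ∀ i j, MemLp (fun t => B t i j) ⊤ volume) {x : Fin d → ℝ} :
    x ∈ reach A B U t s 0 ↔ ∃ u ∈ controls U, phi A B s t x u = 0 := by
  refine exists_congr fun u => and_congr_right fun hu => ⟨fun h => ?_, fun h => ?_⟩
  · rw [← h, phi_trans hA hB hu.1, phi_self hA hB hu.1]
  · rw [← h, phi_trans hA hB hu.1, phi_self hA hB hu.1]

theorem reach_shift (hA : ∀ i j, MemLp (fun t => A t i j) ⊤ volume)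
    (hB : ∀ i j, MemLp (fun t => B t i j) ⊤ volume) {c : ℝ} (hAc : ∀ᵐ t, A (t + c) = A t)
    (hBc : ∀ᵐ t, B (t + c) = B t) (t s : ℝ) (x : Fin d → ℝ) :
    reach A B U (t + c) (s + c) x = reach A B U t s x := by
  ext y
  constructor
  · rintro ⟨u, hu, rfl⟩
    exact ⟨_, comp_add_right_mem_controls hu c, (phi_shift hA hB hAc hBc hu.1 t s x).symm⟩
  · rintro ⟨u, hu, rfl⟩
    refine ⟨_, comp_add_right_mem_controls hu (-c), ?_⟩
    rw [phi_shift hA hB hAc hBc (comp_add_right_mem_controls hu (-c)).1]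
    simp

theorem reach_reverse (hA : ∀ i j, MemLp (fun t => A t i j) ⊤ volume)
    (hB : ∀ i j, MemLp (fun t => B t i j) ⊤ volume) (t s : ℝ) (x : Fin d → ℝ) :
    reach (fun t => -A (-t)) (fun t => -B (-t)) U t s x = reach A B U (-t) (-s) x := by
  ext y
  constructor
  · rintro ⟨u, hu, rfl⟩
    refine ⟨_, comp_neg_mem_controls hu, ?_⟩
    rw [← phi_reverse hA hB (comp_neg_mem_controls hu).1]
    simp
  · rintro ⟨u, hu, rfl⟩
    exact ⟨_, comp_neg_mem_controls hu, phi_reverse hA hB hu.1 t s x⟩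

/-- Small neighborhoods of the origin stay reachable when the time interval is enlarged. -/
theorem reach_mem_nhds_of_mem_uIcc (hA : ∀ i j, MemLp (fun t => A t i j) ⊤ volume)
    (hB : ∀ i j, MemLp (fun t => B t i j) ⊤ volume) (h0 : (0 : Fin m → ℝ) ∈ U)
    (hr : r ∈ uIcc s t) (h : reach A B U r s 0 ∈ nhds 0) : reach A B U t s 0 ∈ nhds 0 := by
  have hc : Continuous fun y => (fundamental A r t).mulVec y :=
    Continuous.matrix_mulVec continuous_const continuous_id
  filter_upwards [hc.tendsto' 0 0 (Matrix.mulVec_zero _) h] with y hy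
  have := mem_reach_phi hA hB hr (zero_mem_controls h0) hy
  rwa [← fundamental_mulVec hA hB, Matrix.mulVec_mulVec, fundamental_mul hA, fundamental_self hA,
    Matrix.one_mulVec] at this

/-- By variation of constants, a control reaching `-X(t, s) y` from the origin also steers `y` to
the origin, so local reachability and local null controllability are equivalent on a given interval.
-/
theorem reach_mem_nhds_symm (hA : ∀ i j, MemLp (fun t => A t i j) ⊤ volume)
    (hB : ∀ i j, MemLp (fun t => B t i j) ⊤ volume) (h : reach A B U t s 0 ∈ nhds 0) :
    reach A B U s t 0 ∈ nhds 0 := by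
  have hc : Continuous fun y => -(fundamental A t s).mulVec y :=
    (Continuous.matrix_mulVec continuous_const continuous_id).neg
  filter_upwards [hc.tendsto' 0 0 (by rw [Matrix.mulVec_zero, neg_zero]) h] with y hy
  obtain ⟨u, hu, h⟩ := (mem_reach_zero_iff hA hB).1 hy
  refine ⟨u, hu, ?_⟩
  rw [phi_eq hA hB hu.1, Matrix.mulVec_neg, Matrix.mulVec_mulVec, fundamental_mul hA,
    fundamental_self hA, Matrix.one_mulVec, neg_add_eq_zero] at h
  exact h.symm

theorem ae_add_int_mul {α : Type*} {f : ℝ → α} {T : ℝ} (h : ∀ᵐ t, f (t + T) = f t) (n : ℤ) :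
    ∀ᵐ t, f (t + n * T) = f t := by
  have hN : ∀ n : ℕ, ∀ᵐ t, f (t + n * T) = f t := fun n => by
    induction n with
    | zero => simp
    | succ n ih =>
      filter_upwards [ih, ae_comp_add_right h (n * T)] with t h1 h2
      rw [← h1, ← h2]
      congr 1; push_cast; ring
  obtain ⟨k, rfl | rfl⟩ := n.eq_nat_or_neg
  · simpa using hN k
  · filter_upwards [ae_comp_add_right (hN k) (-(k * T))] with t ht
    rw [← sub_eq_add_neg, sub_add_cancel] at ht
    rw [ht]; congr 1; push_cast; ring

/-- Controllability without constraints yields local null controllability with small controls. -/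
theorem exists_reach_mem_nhds (hA : ∀ i j, MemLp (fun t => A t i j) ⊤ volume)
    (hB : ∀ i j, MemLp (fun t => B t i j) ⊤ volume) (hU : U ∈ nhds 0)
    (hctrl : IsControllable A B) (t : ℝ) : ∃ s ≥ t, reach A B U t s 0 ∈ nhds 0 := by
  -- The control range `univ` stands for essentially bounded controls without restriction;
  -- boundedness enters only when the finitely many controls are scaled into `U`.
  have h1 : ∀ i : Fin d, ∃ s > t, (Pi.single i 1 : Fin d → ℝ) ∈ reach A B univ t s 0 := fun i => by
    obtain ⟨s, hs, u, hu, h⟩ := hctrl (Pi.single i 1) 0 t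
    exact ⟨s, hs, (mem_reach_zero_iff hA hB).2 ⟨u, ⟨hu, by simp⟩, h⟩⟩
  choose s hs h1 using h1
  obtain ⟨r, hr⟩ := (Set.finite_range s).bddAbove
  have h2 : ∀ i : Fin d, (Pi.single i 1 : Fin d → ℝ) ∈ reach A B univ t (max r t) 0 := fun i =>
    reach_zero_mono hA hB (mem_univ _) (mem_uIcc.2 (Or.inr
      ⟨(hs i).le, (hr (mem_range_self i)).trans (le_max_left _ _)⟩)) (h1 i)
  choose v hv hv1 using h2
  choose C hC0 hC using fun i => ae_norm_le_of_memLp_top (hv i).1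
  obtain ⟨δ, hδ, hδU⟩ := Metric.mem_nhds_iff.1 hU
  have hS : 0 ≤ ∑ i, C i := Finset.sum_nonneg fun i _ => hC0 i
  refine ⟨max r t, le_max_right _ _, Metric.mem_nhds_iff.2
    ⟨δ / (∑ i, C i + 1), by positivity, fun x hx => ?_⟩⟩
  refine ⟨fun q => ∑ i, x i • v i q,
    ⟨memLp_finsetSum _ fun i _ => (hv i).1.const_smul (x i), ?_⟩, ?_⟩
  · have : ∀ᵐ q, ∀ i, ‖v i q‖ ≤ C i := by rw [ae_all_iff]; exact hC
    filter_upwards [this] with q hq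
    refine hδU ?_
    rw [mem_ball_zero_iff] at hx ⊢
    calc ‖∑ i, x i • v i q‖ ≤ ∑ i, ‖x‖ * C i := by
          refine (norm_sum_le _ _).trans (Finset.sum_le_sum fun i _ => ?_)
          rw [norm_smul]
          gcongr
          · exact norm_le_pi_norm x i
          · exact hq i
      _ = ‖x‖ * ∑ i, C i := by rw [Finset.mul_sum]
      _ ≤ ‖x‖ * (∑ i, C i + 1) := by gcongr; linarith
      _ < δ := by rwa [lt_div_iff₀ (by positivity)] at hx
  · have := phi_sum hA hB Finset.univ (fun i => (hv i).1) t (max r t) (fun _ => 0) x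
    simp only [smul_zero, Finset.sum_const_zero, hv1] at this
    rw [this]
    ext i; simp [Finset.sum_apply, Pi.single_apply]

end Controls

/-! ### Periodic systems with local controllability -/

/-- A periodic linear control system with bounded convex control range which is locally reachable
from and locally controllable to the origin. -/
structure IsAdmissible {d m : ℕ} (A : ℝ → Matrix (Fin d) (Fin d) ℝ)
    (B : ℝ → Matrix (Fin d) (Fin m) ℝ) (U : Set (Fin m → ℝ)) (T : ℝ) : Prop where
  pos : 0 < T
  memLp_A : ∀ i j, MemLp (fun t => A t i j) ⊤ volume
  memLp_B : ∀ i j, MemLp (fun t => B t i j) ⊤ volume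
  periodic_A : ∀ᵐ t, A (t + T) = A t
  periodic_B : ∀ᵐ t, B (t + T) = B t
  bounded : Bornology.IsBounded U
  convex : Convex ℝ U
  zero_mem : (0 : Fin m → ℝ) ∈ U
  reach_nhds : ∀ t, ∃ s ≤ t, reach A B U t s 0 ∈ nhds 0
  null_nhds : ∀ t, ∃ s ≥ t, reach A B U t s 0 ∈ nhds 0

theorem exists_nat_mul_ge {T : ℝ} (hT : 0 < T) (a : ℝ) : ∃ n : ℕ, a ≤ n * T := by
  obtain ⟨n, hn⟩ := exists_nat_ge (a / T)
  exact ⟨n, by rwa [div_le_iff₀ hT] at hn⟩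

theorem IsControllable.isAdmissible {d m : ℕ} {A : ℝ → Matrix (Fin d) (Fin d) ℝ}
    {B : ℝ → Matrix (Fin d) (Fin m) ℝ} {U : Set (Fin m → ℝ)} {T : ℝ}
    (hctrl : IsControllable A B) (hT : 0 < T)
    (hA : ∀ i j, MemLp (fun t => A t i j) ⊤ volume)
    (hB : ∀ i j, MemLp (fun t => B t i j) ⊤ volume)
    (hAT : ∀ᵐ t, A (t + T) = A t) (hBT : ∀ᵐ t, B (t + T) = B t)
    (hUb : Bornology.IsBounded U) (hUc : Convex ℝ U) (hU0 : U ∈ nhds 0) :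
    IsAdmissible A B U T where
  pos := hT
  memLp_A := hA
  memLp_B := hB
  periodic_A := hAT
  periodic_B := hBT
  bounded := hUb
  convex := hUc
  zero_mem := mem_of_mem_nhds hU0
  null_nhds := exists_reach_mem_nhds hA hB hU0 hctrl
  -- Local null controllability on `[0, s]` is turned into local reachability on the same interval,
  -- moved back by `n` periods so that it ends before `t`, and extended to `t` with zero control.
  reach_nhds := fun t => by
    obtain ⟨s, hs, h⟩ := exists_reach_mem_nhds hA hB hU0 hctrl 0
    obtain ⟨n, hn⟩ := exists_nat_mul_ge hT (s - t)
    have h1 := reach_mem_nhds_symm hA hB h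
    rw [← reach_shift hA hB (ae_add_int_mul hAT (-n)) (ae_add_int_mul hBT (-n))] at h1
    push_cast at h1
    refine ⟨0 + -n * T, by linarith, reach_mem_nhds_of_mem_uIcc hA hB (mem_of_mem_nhds hU0)
      (mem_uIcc.2 (Or.inl ⟨by linarith, by linarith⟩)) h1⟩

/-- The states which are reached from the origin at time `t`. -/
def reachableSet {d m : ℕ} (A : ℝ → Matrix (Fin d) (Fin d) ℝ)
    (B : ℝ → Matrix (Fin d) (Fin m) ℝ) (U : Set (Fin m → ℝ)) (t : ℝ) : Set (Fin d → ℝ) :=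
  {x | ∃ s ≤ t, x ∈ reach A B U t s 0}

/-- The states which are controlled to the origin from time `t`. -/
def nullSet {d m : ℕ} (A : ℝ → Matrix (Fin d) (Fin d) ℝ)
    (B : ℝ → Matrix (Fin d) (Fin m) ℝ) (U : Set (Fin m → ℝ)) (t : ℝ) : Set (Fin d → ℝ) :=
  {x | ∃ s ≥ t, x ∈ reach A B U t s 0}

/-- The sum of the center and the unstable subspace. -/
noncomputable def centerUnstableSpace {d : ℕ} (A : ℝ → Matrix (Fin d) (Fin d) ℝ) (T t : ℝ) :
    Submodule ℝ (Fin d → ℝ) :=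
  spectralSum (fundamental A (T + t) t) fun μ => 1 ≤ ‖μ‖

/-- The sum of the center and the stable subspace. -/
noncomputable def centerStableSpace {d : ℕ} (A : ℝ → Matrix (Fin d) (Fin d) ℝ) (T t : ℝ) :
    Submodule ℝ (Fin d → ℝ) :=
  spectralSum (fundamental A (T + t) t) fun μ => ‖μ‖ ≤ 1

namespace IsAdmissible

variable {d m : ℕ} {A : ℝ → Matrix (Fin d) (Fin d) ℝ} {B : ℝ → Matrix (Fin d) (Fin m) ℝ}
  {U : Set (Fin m → ℝ)} {T : ℝ} {u : ℝ → Fin m → ℝ} {t s : ℝ} {x y : Fin d → ℝ}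

theorem reverse (h : IsAdmissible A B U T) :
    IsAdmissible (fun t => -A (-t)) (fun t => -B (-t)) U T where
  pos := h.pos
  memLp_A := fun i j => (memLp_comp_neg (h.memLp_A i j)).neg
  memLp_B := fun i j => (memLp_comp_neg (h.memLp_B i j)).neg
  periodic_A := by
    filter_upwards [ae_comp_neg (ae_add_int_mul h.periodic_A (-1))] with t ht
    rw [← ht]; congr 2; push_cast; ring
  periodic_B := by
    filter_upwards [ae_comp_neg (ae_add_int_mul h.periodic_B (-1))] with t ht
    rw [← ht]; congr 2; push_cast; ring
  bounded := h.bounded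
  convex := h.convex
  zero_mem := h.zero_mem
  reach_nhds := fun t => by
    obtain ⟨s, hs, h'⟩ := h.null_nhds (-t)
    exact ⟨-s, by linarith, by rwa [reach_reverse h.memLp_A h.memLp_B, neg_neg]⟩
  null_nhds := fun t => by
    obtain ⟨s, hs, h'⟩ := h.reach_nhds (-t)
    exact ⟨-s, by linarith, by rwa [reach_reverse h.memLp_A h.memLp_B, neg_neg]⟩

theorem reachableSet_reverse (h : IsAdmissible A B U T) (t : ℝ) :
    reachableSet (fun t => -A (-t)) (fun t => -B (-t)) U (-t) = nullSet A B U t := by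
  ext x
  simp only [reachableSet, nullSet, mem_ofPred_eq, reach_reverse h.memLp_A h.memLp_B, neg_neg]
  constructor
  · rintro ⟨s, hs, hx⟩; exact ⟨-s, by linarith, hx⟩
  · rintro ⟨s, hs, hx⟩; exact ⟨-s, by linarith, by rwa [neg_neg]⟩

/-! #### Periodicity -/

theorem fundamental_add_int (h : IsAdmissible A B U T) (n : ℤ) (t s : ℝ) :
    fundamental A (t + n * T) (s + n * T) = fundamental A t s :=
  fundamental_shift h.memLp_A (ae_add_int_mul h.periodic_A n) t s

theorem reach_add_int (h : IsAdmissible A B U T) (n : ℤ) (t s : ℝ) (x : Fin d → ℝ) :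
    reach A B U (t + n * T) (s + n * T) x = reach A B U t s x :=
  reach_shift h.memLp_A h.memLp_B (ae_add_int_mul h.periodic_A n) (ae_add_int_mul h.periodic_B n)
    t s x

theorem phi_add_int (h : IsAdmissible A B U T) (n : ℤ) (hu : MemLp u ⊤ volume) (t s : ℝ)
    (x : Fin d → ℝ) :
    phi A B (t + n * T) (s + n * T) x u = phi A B t s x fun r => u (r + n * T) :=
  phi_shift h.memLp_A h.memLp_B (ae_add_int_mul h.periodic_A n)
    (ae_add_int_mul h.periodic_B n) hu t s x

theorem reachableSet_add_int (h : IsAdmissible A B U T) (n : ℤ) (t : ℝ) :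
    reachableSet A B U (t + n * T) = reachableSet A B U t := by
  ext x
  constructor
  · rintro ⟨s, hs, hx⟩
    refine ⟨s - n * T, by linarith, ?_⟩
    rwa [← h.reach_add_int n, sub_add_cancel]
  · rintro ⟨s, hs, hx⟩
    exact ⟨s + n * T, by linarith, by rwa [h.reach_add_int n]⟩

theorem nullSet_add_int (h : IsAdmissible A B U T) (n : ℤ) (t : ℝ) :
    nullSet A B U (t + n * T) = nullSet A B U t := by
  rw [← h.reachableSet_reverse, ← h.reachableSet_reverse, ← h.reverse.reachableSet_add_int (-n) (-t)]
  congr 1; push_cast; ring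

theorem monodromy_add_int (h : IsAdmissible A B U T) (n : ℤ) (t : ℝ) :
    fundamental A (T + (t + n * T)) (t + n * T) = fundamental A (T + t) t := by
  rw [← add_assoc, h.fundamental_add_int]

theorem fundamental_add_nat_mul (h : IsAdmissible A B U T) (k : ℕ) (t : ℝ) :
    fundamental A (t + k * T) t = fundamental A (T + t) t ^ k := by
  induction k with
  | zero => simp [fundamental_self h.memLp_A]
  | succ k ih =>
    rw [pow_succ', ← ih, ← h.monodromy_add_int k t]
    push_cast
    rw [fundamental_mul h.memLp_A]
    congr 1; ring

theorem fundamental_sub_nat_mul (h : IsAdmissible A B U T) (k : ℕ) (t : ℝ) :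
    fundamental A t (t - k * T) = fundamental A (T + t) t ^ k := by
  rw [← h.fundamental_add_nat_mul, ← h.fundamental_add_int k t (t - k * T)]
  push_cast
  rw [sub_add_cancel]

/-! #### The reachable sets -/

theorem zero_mem_reachableSet (h : IsAdmissible A B U T) (t : ℝ) : 0 ∈ reachableSet A B U t :=
  ⟨t, le_rfl, _, zero_mem_controls h.zero_mem, phi_zero_zero h.memLp_A h.memLp_B t t⟩

theorem mem_reach_of_le (h : IsAdmissible A B U T) {r : ℝ} (hsr : s ≤ r) (hr : r ≤ t)
    (hx : x ∈ reach A B U t r 0) : x ∈ reach A B U t s 0 :=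
  reach_zero_mono h.memLp_A h.memLp_B h.zero_mem (mem_uIcc.2 (Or.inl ⟨hsr, hr⟩)) hx

theorem convex_reachableSet (h : IsAdmissible A B U T) (t : ℝ) :
    Convex ℝ (reachableSet A B U t) := by
  rintro x ⟨s, hs, hx⟩ y ⟨r, hr, hy⟩ a b ha hb hab
  exact ⟨min s r, (min_le_left _ _).trans hs, convex_reach h.memLp_A h.memLp_B h.convex
    (h.mem_reach_of_le (min_le_left _ _) hs hx) (h.mem_reach_of_le (min_le_right _ _) hr hy)
    ha hb hab⟩

theorem phi_mem_reachableSet (h : IsAdmissible A B U T) (hx : x ∈ reachableSet A B U s)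
    (hst : s ≤ t) (hu : u ∈ controls U) : phi A B t s x u ∈ reachableSet A B U t := by
  obtain ⟨r, hr, hx⟩ := hx
  exact ⟨r, hr.trans hst, mem_reach_phi h.memLp_A h.memLp_B (mem_uIcc.2 (Or.inl ⟨hr, hst⟩)) hu hx⟩

theorem fundamental_mulVec_mem_reachableSet (h : IsAdmissible A B U T)
    (hx : x ∈ reachableSet A B U s) (hst : s ≤ t) :
    (fundamental A t s).mulVec x ∈ reachableSet A B U t := by
  rw [fundamental_mulVec h.memLp_A h.memLp_B]
  exact h.phi_mem_reachableSet hx hst (zero_mem_controls h.zero_mem)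

/-- A nearby `(t', x')` is carried back to time `s` along the control `u` that reaches `x`. The
result is close to 0, hence reachable at time `s`, and `u` then drives it to `x'` at time `t'`. -/
theorem isOpen_reachableSet (h : IsAdmissible A B U T) :
    IsOpen {p : ℝ × (Fin d → ℝ) | p.2 ∈ reachableSet A B U p.1} := by
  rw [isOpen_iff_mem_nhds]
  rintro ⟨t, x⟩ ⟨s', hs', hx⟩
  -- An earlier start makes `s < t` strict, so that times near `t` remain after `s`.
  obtain ⟨s, hst, hx⟩ : ∃ s < t, x ∈ reach A B U t s 0 :=
    ⟨s' - 1, by linarith, h.mem_reach_of_le (by linarith) hs' hx⟩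
  obtain ⟨u, hu, rfl⟩ := hx
  obtain ⟨r, hr, hN⟩ := h.reach_nhds s
  have hc : Continuous fun p : ℝ × (Fin d → ℝ) =>
      (fundamental A s p.1).mulVec (p.2 - phi A B p.1 s 0 u) :=
    ((continuous_fundamental h.memLp_A).comp (continuous_const.prodMk continuous_fst)).matrix_mulVec
      (continuous_snd.sub ((continuous_phi h.memLp_A h.memLp_B hu.1 s 0).comp continuous_fst))
  have h1 := hc.tendsto' (t, phi A B t s 0 u) 0 (by simp) hN
  have h2 : ∀ᶠ p : ℝ × (Fin d → ℝ) in nhds (t, phi A B t s 0 u), s < p.1 :=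
    continuous_fst.continuousAt.eventually (lt_mem_nhds hst)
  filter_upwards [h1, h2] with p hp hp2
  have h3 := h.phi_mem_reachableSet (t := p.1) ⟨r, hr, hp⟩ hp2.le hu
  rwa [phi_eq h.memLp_A h.memLp_B hu.1, Matrix.mulVec_mulVec, fundamental_mul h.memLp_A,
    fundamental_self h.memLp_A, Matrix.one_mulVec, sub_add_cancel] at h3

theorem isOpen_reachableSet_fiber (h : IsAdmissible A B U T) (t : ℝ) :
    IsOpen (reachableSet A B U t) :=
  h.isOpen_reachableSet.preimage (Continuous.prodMk_right t)

theorem exists_phi_bound (h : IsAdmissible A B U T) (b : ℝ) :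
    ∃ C, 0 ≤ C ∧ ∀ t s, |t - s| ≤ b → ∀ u ∈ controls U, ∀ x, ‖phi A B t s x u‖ ≤ C * (‖x‖ + 1) := by
  obtain ⟨K, hK0, hK⟩ := exists_mulVec_bound h.memLp_A
  obtain ⟨L, hL0, hL⟩ := exists_mulVec_bound h.memLp_B
  obtain ⟨R, hR0, hR⟩ := h.bounded.exists_pos_norm_le
  set b' := max b 0
  have hb' : 0 ≤ b' := le_max_right _ _
  refine ⟨(1 + L * R * b') * Real.exp (K * b'), by positivity, fun t s hts u hu x => ?_⟩
  have hts' : |t - s| ≤ b' := hts.trans (le_max_left _ _)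
  have hF : ∀ᵐ q, ‖(B q).mulVec (u q)‖ ≤ L * R := by
    filter_upwards [hL, hu.2] with q h1 h2
    exact (h1 _).trans (by gcongr; exact hR _ h2)
  have hF0 : 0 ≤ L * R := by positivity
  have := (sol_spec h.memLp_A (memLp_mulVec h.memLp_B hu.1) s x).norm_le h.memLp_A
    (memLp_mulVec h.memLp_B hu.1) hK0 hF0 hK hF t
  refine this.trans ?_
  have h1 : ‖x‖ + L * R * |t - s| ≤ (1 + L * R * b') * (‖x‖ + 1) := by
    have : L * R * |t - s| ≤ L * R * b' := by gcongr
    nlinarith [norm_nonneg x, mul_nonneg (mul_nonneg hF0 hb') (norm_nonneg x)]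
  calc _ ≤ ((1 + L * R * b') * (‖x‖ + 1)) * Real.exp (K * b') := by gcongr
    _ = _ := by ring

theorem exists_fundamental_bound (h : IsAdmissible A B U T) (b : ℝ) :
    ∃ C, 0 ≤ C ∧ ∀ t s, |t - s| ≤ b → ∀ x, ‖(fundamental A t s).mulVec x‖ ≤ C * ‖x‖ := by
  obtain ⟨C, hC0, hC⟩ := h.exists_phi_bound b
  refine ⟨C * 2, by positivity, fun t s hts x => ?_⟩
  rcases eq_or_ne x 0 with rfl | hx
  · simp
  have hx' : 0 < ‖x‖ := norm_pos_iff.2 hx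
  have h1 := hC t s hts _ (zero_mem_controls h.zero_mem) (‖x‖⁻¹ • x)
  rw [← fundamental_mulVec h.memLp_A h.memLp_B, Matrix.mulVec_smul, norm_smul, norm_smul,
    norm_inv, norm_norm, inv_mul_cancel₀ hx'.ne', inv_mul_le_iff₀ hx'] at h1
  linarith

/-! #### The center and the unstable directions are reachable -/

open Filter Topology in
-- A functional separating a point from this open convex set would be bounded above on all sums of
-- pushed-forward small reachable vectors. This forces it to decay along the monodromy orbits, hence
-- to vanish where `1 ≤ ‖μ‖`.
theorem centerUnstableSpace_subset_reachableSet (h : IsAdmissible A B U T) (t : ℝ) :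
    (centerUnstableSpace A T t : Set (Fin d → ℝ)) ⊆ reachableSet A B U t := by
  intro w hw
  by_contra hwS
  obtain ⟨l, hl⟩ := geometric_hahn_banach_open_point (h.convex_reachableSet t)
    (h.isOpen_reachableSet_fiber t) hwS
  obtain ⟨s, hs, hQ⟩ := h.reach_nhds t
  obtain ⟨n, hn⟩ : ∃ n : ℕ, 0 < n ∧ t - n * T ≤ s := by
    obtain ⟨n, hn⟩ := exists_nat_mul_ge h.pos (t - s)
    refine ⟨n + 1, n.succ_pos, ?_⟩
    push_cast
    linarith [h.pos]
  set M := fundamental A (T + t) t with hM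
  replace hQ : reach A B U t (t - n * T) 0 ∈ 𝓝 0 :=
    mem_of_superset hQ fun x hx => h.mem_reach_of_le hn.2 hs hx
  have hnT : 0 ≤ n * T := mul_nonneg n.cast_nonneg h.pos.le
  have hstep : ∀ x ∈ reachableSet A B U t, ∀ q ∈ reach A B U t (t - n * T) 0,
      (M ^ n).mulVec x + q ∈ reachableSet A B U t := by
    rintro x hx q ⟨u, hu, rfl⟩
    have h1 : x ∈ reachableSet A B U (t - n * T) := by
      rw [← h.reachableSet_add_int n]; push_cast; rwa [sub_add_cancel]
    have h2 := h.phi_mem_reachableSet (t := t) h1 (by linarith) hu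
    rwa [phi_eq h.memLp_A h.memLp_B hu.1, h.fundamental_sub_nat_mul] at h2
  have hsum : ∀ k : ℕ, ∀ q : ℕ → Fin d → ℝ, (∀ i, q i ∈ reach A B U t (t - n * T) 0) →
      ∑ i ∈ Finset.range k, (M ^ (n * i)).mulVec (q i) ∈ reachableSet A B U t := by
    intro k
    induction k with
    | zero => intro q _; simpa using h.zero_mem_reachableSet t
    | succ k ih =>
      intro q hq
      rw [Finset.sum_range_succ']
      convert hstep _ (ih (fun i => q (i + 1)) fun i => hq _) _ (hq 0) using 2
      · rw [Matrix.mulVec_sum]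
        refine Finset.sum_congr rfl fun i _ => ?_
        rw [Matrix.mulVec_mulVec, ← pow_add]
        congr 2; ring
      · simp
  have hlim : ∀ x, Tendsto (fun i => l ((M ^ (n * i)).mulVec x)) atTop (𝓝 0) := by
    intro x
    obtain ⟨δ, hδ, hδ1, hδ2⟩ : ∃ δ : ℝ, δ > 0 ∧ δ • x ∈ reach A B U t (t - n * T) 0 ∧
        (-δ) • x ∈ reach A B U t (t - n * T) 0 := by
      have h1 : Tendsto (fun δ : ℝ => δ • x) (𝓝 0) (𝓝 0) :=
        (continuous_id.smul continuous_const).tendsto' _ _ (zero_smul ℝ x)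
      have h2 : Tendsto (fun δ : ℝ => (-δ) • x) (𝓝 0) (𝓝 0) :=
        (continuous_neg.smul continuous_const).tendsto' _ _ (by simp)
      obtain ⟨ε, hε, hε'⟩ := Metric.eventually_nhds_iff.1
        ((h1.eventually_mem hQ).and (h2.eventually_mem hQ))
      exact ⟨ε / 2, by positivity, hε' (y := ε / 2) (by
        rw [dist_zero_right, Real.norm_of_nonneg (by positivity)]; linarith)⟩
    have hs : Summable fun i => δ * |l ((M ^ (n * i)).mulVec x)| := by
      refine summable_of_sum_range_le (c := l w) (fun i => by positivity) fun k => ?_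
      -- The sign is chosen so that `l` takes the value `δ |l (M ^ (n * i) x)|` on the `i`-th
      -- summand, which bounds all partial sums by `l w`.
      let q : ℕ → Fin d → ℝ := fun i =>
        if 0 ≤ l ((M ^ (n * i)).mulVec x) then δ • x else (-δ) • x
      have hq : ∀ i, l ((M ^ (n * i)).mulVec (q i)) = δ * |l ((M ^ (n * i)).mulVec x)| := by
        intro i
        by_cases hi : 0 ≤ l ((M ^ (n * i)).mulVec x)
        · simp only [q, if_pos hi, Matrix.mulVec_smul, map_smul, smul_eq_mul, abs_of_nonneg hi]
        · simp only [q, if_neg hi, Matrix.mulVec_smul, map_smul, smul_eq_mul,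
            abs_of_neg (not_le.1 hi)]
          ring
      have h1 := hl _ (hsum k q fun i => by
        by_cases hi : 0 ≤ l ((M ^ (n * i)).mulVec x)
        · simpa only [q, if_pos hi] using hδ1
        · simpa only [q, if_neg hi] using hδ2)
      rw [map_sum] at h1
      simp only [hq] at h1
      exact h1.le
    have h1 := hs.tendsto_atTop_zero.const_mul δ⁻¹
    simp only [← mul_assoc, inv_mul_cancel₀ hδ.ne', one_mul, mul_zero] at h1
    exact (tendsto_zero_iff_abs_tendsto_zero _).2 h1
  have h0 := functional_eq_zero_of_mem_spectralSum (l := l.toLinearMap) hlim hw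
  have h1 := hl 0 (h.zero_mem_reachableSet t)
  rw [map_zero] at h1
  exact h1.ne' h0

/-- Write `x + w = (1 - ε) ((1 - ε)⁻¹ x) + ε (ε⁻¹ w)`. The first point is reachable for small `ε` by
openness, and the second for every `ε > 0` because a whole subspace is reachable. -/
theorem add_mem_reachableSet (h : IsAdmissible A B U T) (hx : x ∈ reachableSet A B U t)
    {w : Fin d → ℝ} (hw : w ∈ centerUnstableSpace A T t) : x + w ∈ reachableSet A B U t := by
  have hc : Filter.Tendsto (fun ε : ℝ => (1 - ε)⁻¹ • x) (nhds 0) (nhds x) := by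
    have : ContinuousAt (fun ε : ℝ => (1 - ε)⁻¹ • x) 0 :=
      ((continuousAt_const.sub continuousAt_id).inv₀ (by simp)).smul continuousAt_const
    simpa [ContinuousAt] using this
  obtain ⟨δ, hδ, hδ'⟩ := Metric.eventually_nhds_iff.1
    (hc ((h.isOpen_reachableSet_fiber t).mem_nhds hx))
  set ε := min (δ / 2) (1 / 2)
  have hε : 0 < ε := by positivity
  have hε1 : ε ≤ 1 / 2 := min_le_right _ _
  have h1 : (1 - ε)⁻¹ • x ∈ reachableSet A B U t := hδ' (y := ε) (by
    rw [dist_zero_right, Real.norm_of_nonneg hε.le]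
    exact (min_le_left _ _).trans_lt (by linarith))
  have h2 := h.centerUnstableSpace_subset_reachableSet t (Submodule.smul_mem _ ε⁻¹ hw)
  have h3 := h.convex_reachableSet t h1 h2 (by linarith : 0 ≤ 1 - ε) hε.le (by ring)
  rwa [smul_inv_smul₀ (by linarith), smul_inv_smul₀ hε.ne'] at h3

end IsAdmissible

/-- Reversing time inverts the monodromy matrix, so this exchanges multipliers inside and outside
the unit circle. -/
theorem spectralSum_inv {d : ℕ} {M N : Matrix (Fin d) (Fin d) ℝ} (hNM : N * M = 1)
    (hMN : M * N = 1) (p : ℂ → Prop) :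
    spectralSum N p = spectralSum M fun μ => μ ≠ 0 ∧ p μ⁻¹ := by
  refine le_antisymm ?_ (spectralSum_inv_le hNM p)
  refine (spectralSum_ne_zero hMN p).trans (le_trans ?_ (spectralSum_inv_le hMN _))
  exact spectralSum_mono fun μ hμ => ⟨hμ.1, inv_ne_zero hμ.1, by rw [inv_inv]; exact hμ.2⟩

/-- The projection onto the stable along the center-unstable subspace at time `t`. -/
noncomputable def stableProj {d : ℕ} (A : ℝ → Matrix (Fin d) (Fin d) ℝ) (T t : ℝ) :
    Matrix (Fin d) (Fin d) ℝ :=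
  fundamental A t 0 *
    Classical.epsilon (fun P : Matrix (Fin d) (Fin d) ℝ =>
      ∀ x, P.mulVec x ∈ stableSpace A T 0 ∧ x - P.mulVec x ∈ centerUnstableSpace A T 0) *
    fundamental A 0 t

namespace IsAdmissible

variable {d m : ℕ} {A : ℝ → Matrix (Fin d) (Fin d) ℝ} {B : ℝ → Matrix (Fin d) (Fin m) ℝ}
  {U : Set (Fin m → ℝ)} {T : ℝ} {u : ℝ → Fin m → ℝ} {t s : ℝ} {x y : Fin d → ℝ}

/-! #### Spectral subbundles -/

theorem monodromy_reverse (h : IsAdmissible A B U T) (t : ℝ) :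
    fundamental (fun t => -A (-t)) (T + -t) (-t) = fundamental A t (T + t) := by
  rw [fundamental_reverse h.memLp_A, ← h.fundamental_add_int 1]
  congr 1 <;> push_cast <;> ring

theorem spectralSum_reverse (h : IsAdmissible A B U T) (t : ℝ) (p : ℂ → Prop) :
    spectralSum (fundamental (fun t => -A (-t)) (T + -t) (-t)) p =
      spectralSum (fundamental A (T + t) t) fun μ => μ ≠ 0 ∧ p μ⁻¹ := by
  rw [h.monodromy_reverse]
  exact spectralSum_inv (by rw [fundamental_mul h.memLp_A, fundamental_self h.memLp_A])
    (by rw [fundamental_mul h.memLp_A, fundamental_self h.memLp_A]) p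

theorem stableSpace_reverse (h : IsAdmissible A B U T) (t : ℝ) :
    stableSpace (fun t => -A (-t)) T (-t) = unstableSpace A T t := by
  rw [stableSpace_eq h.reverse.memLp_A h.pos, unstableSpace_eq h.memLp_A h.pos,
    h.spectralSum_reverse]
  refine le_antisymm (spectralSum_mono fun μ hμ => ?_) (spectralSum_mono fun μ hμ => ?_)
  · have := hμ.2
    rwa [norm_inv, inv_lt_one₀ (norm_pos_iff.2 hμ.1)] at this
  · have h0 : 0 < ‖μ‖ := zero_lt_one.trans hμ
    exact ⟨norm_pos_iff.1 h0, by rwa [norm_inv, inv_lt_one₀ h0]⟩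

theorem centerUnstableSpace_reverse (h : IsAdmissible A B U T) (t : ℝ) :
    centerUnstableSpace (fun t => -A (-t)) T (-t) = centerStableSpace A T t := by
  unfold centerUnstableSpace centerStableSpace
  rw [h.spectralSum_reverse]
  refine le_antisymm (spectralSum_mono fun μ hμ => ?_)
    ((spectralSum_ne_zero (N := fundamental A t (T + t)) (by
      rw [fundamental_mul h.memLp_A, fundamental_self h.memLp_A]) _).trans
      (spectralSum_mono fun μ hμ => ⟨hμ.1, ?_⟩))
  · have := hμ.2
    rwa [norm_inv, one_le_inv₀ (norm_pos_iff.2 hμ.1)] at this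
  · rw [norm_inv, one_le_inv₀ (norm_pos_iff.2 hμ.1)]
    exact hμ.2

theorem centerSpace_le_centerUnstableSpace (h : IsAdmissible A B U T) (t : ℝ) :
    centerSpace A T t ≤ centerUnstableSpace A T t := by
  rw [centerSpace_eq h.memLp_A h.pos]
  exact spectralSum_mono fun μ hμ => hμ.ge

theorem unstableSpace_le_centerUnstableSpace (h : IsAdmissible A B U T) (t : ℝ) :
    unstableSpace A T t ≤ centerUnstableSpace A T t := by
  rw [unstableSpace_eq h.memLp_A h.pos]
  exact spectralSum_mono fun μ hμ => hμ.le

theorem centerSpace_le_centerStableSpace (h : IsAdmissible A B U T) (t : ℝ) :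
    centerSpace A T t ≤ centerStableSpace A T t := by
  rw [centerSpace_eq h.memLp_A h.pos]
  exact spectralSum_mono fun μ hμ => hμ.le

theorem stableSpace_le_centerStableSpace (h : IsAdmissible A B U T) (t : ℝ) :
    stableSpace A T t ≤ centerStableSpace A T t := by
  rw [stableSpace_eq h.memLp_A h.pos]
  exact spectralSum_mono fun μ hμ => hμ.le

theorem centerUnstableSpace_le_sup (h : IsAdmissible A B U T) (t : ℝ) :
    centerUnstableSpace A T t ≤ centerSpace A T t ⊔ unstableSpace A T t := by
  rw [centerSpace_eq h.memLp_A h.pos, unstableSpace_eq h.memLp_A h.pos]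
  exact (spectralSum_mono fun μ (hμ : 1 ≤ ‖μ‖) => hμ.eq_or_lt.imp_left Eq.symm).trans
    (spectralSum_or_le _ _ _)

theorem isCompl_stableSpace (h : IsAdmissible A B U T) (t : ℝ) :
    IsCompl (stableSpace A T t) (centerUnstableSpace A T t) := by
  rw [stableSpace_eq h.memLp_A h.pos]
  refine ⟨disjoint_spectralSum _ (fun μ hμ => by rwa [norm_star]) (fun μ hμ => by rwa [norm_star])
    fun μ hμ => not_le.2 hμ, codisjoint_iff_le_sup.2 ?_⟩
  rw [← spectralSum_true (fundamental A (T + t) t)]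
  exact (spectralSum_mono fun μ _ => lt_or_ge ‖μ‖ 1).trans (spectralSum_or_le _ _ _)

theorem fundamental_mul_monodromy (h : IsAdmissible A B U T) (t s : ℝ) :
    fundamental A t s * fundamental A (T + s) s = fundamental A (T + t) t * fundamental A t s := by
  have h1 : fundamental A (T + t) (T + s) = fundamental A t s := by
    rw [← h.fundamental_add_int 1 t s]
    congr 1 <;> push_cast <;> ring
  rw [fundamental_mul h.memLp_A, ← h1, fundamental_mul h.memLp_A]

theorem fundamental_mulVec_mem_stableSpace (h : IsAdmissible A B U T)
    (hx : x ∈ stableSpace A T s) (t : ℝ) : (fundamental A t s).mulVec x ∈ stableSpace A T t := by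
  rw [stableSpace_eq h.memLp_A h.pos] at hx ⊢
  exact mulVec_mem_spectralSum (h.fundamental_mul_monodromy t s) hx

theorem fundamental_mulVec_mem_unstableSpace (h : IsAdmissible A B U T)
    (hx : x ∈ unstableSpace A T s) (t : ℝ) :
    (fundamental A t s).mulVec x ∈ unstableSpace A T t := by
  rw [unstableSpace_eq h.memLp_A h.pos] at hx ⊢
  exact mulVec_mem_spectralSum (h.fundamental_mul_monodromy t s) hx

theorem fundamental_mulVec_mem_centerUnstableSpace (h : IsAdmissible A B U T)
    (hx : x ∈ centerUnstableSpace A T s) (t : ℝ) :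
    (fundamental A t s).mulVec x ∈ centerUnstableSpace A T t :=
  mulVec_mem_spectralSum (h.fundamental_mul_monodromy t s) hx

theorem stableSpace_add_int (h : IsAdmissible A B U T) (n : ℤ) (t : ℝ) :
    stableSpace A T (t + n * T) = stableSpace A T t := by
  rw [stableSpace_eq h.memLp_A h.pos, stableSpace_eq h.memLp_A h.pos, h.monodromy_add_int]

theorem unstableSpace_add_int (h : IsAdmissible A B U T) (n : ℤ) (t : ℝ) :
    unstableSpace A T (t + n * T) = unstableSpace A T t := by
  rw [unstableSpace_eq h.memLp_A h.pos, unstableSpace_eq h.memLp_A h.pos, h.monodromy_add_int]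

theorem centerSpace_add_int (h : IsAdmissible A B U T) (n : ℤ) (t : ℝ) :
    centerSpace A T (t + n * T) = centerSpace A T t := by
  rw [centerSpace_eq h.memLp_A h.pos, centerSpace_eq h.memLp_A h.pos, h.monodromy_add_int]

theorem centerUnstableSpace_add_int (h : IsAdmissible A B U T) (n : ℤ) (t : ℝ) :
    centerUnstableSpace A T (t + n * T) = centerUnstableSpace A T t := by
  unfold centerUnstableSpace
  rw [h.monodromy_add_int]

/-! #### The stable projections -/

theorem stableProj_mem_and (h : IsAdmissible A B U T) (t : ℝ) (x : Fin d → ℝ) :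
    (stableProj A T t).mulVec x ∈ stableSpace A T t ∧
      x - (stableProj A T t).mulVec x ∈ centerUnstableSpace A T t := by
  have hex : ∃ P : Matrix (Fin d) (Fin d) ℝ,
      ∀ x, P.mulVec x ∈ stableSpace A T 0 ∧ x - P.mulVec x ∈ centerUnstableSpace A T 0 := by
    have hc := h.isCompl_stableSpace 0
    refine ⟨LinearMap.toMatrix' (Submodule.projection _ _ hc), fun x => ?_⟩
    rw [LinearMap.toMatrix'_mulVec]
    obtain ⟨a, ha, b, hb, rfl⟩ := Submodule.mem_sup.1
      (show x ∈ stableSpace A T 0 ⊔ centerUnstableSpace A T 0 by rw [hc.sup_eq_top]; trivial)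
    have h1 : Submodule.projection _ _ hc a = a := Submodule.projection_apply_left hc ⟨a, ha⟩
    have h2 : Submodule.projection _ _ hc b = 0 := (Submodule.projection_apply_eq_zero_iff hc).2 hb
    rw [map_add, h1, h2, add_zero, add_sub_cancel_left]
    exact ⟨ha, hb⟩
  have hP := Classical.epsilon_spec hex
  unfold stableProj
  set P := Classical.epsilon (fun P : Matrix (Fin d) (Fin d) ℝ =>
    ∀ x, P.mulVec x ∈ stableSpace A T 0 ∧ x - P.mulVec x ∈ centerUnstableSpace A T 0)
  set z := (fundamental A 0 t).mulVec x with hz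
  have h3 : (fundamental A t 0 * P * fundamental A 0 t).mulVec x =
      (fundamental A t 0).mulVec (P.mulVec z) := by
    rw [← Matrix.mulVec_mulVec, ← Matrix.mulVec_mulVec]
  have h4 : x = (fundamental A t 0).mulVec z := by
    rw [hz, Matrix.mulVec_mulVec, fundamental_mul h.memLp_A, fundamental_self h.memLp_A,
      Matrix.one_mulVec]
  rw [h3]
  refine ⟨h.fundamental_mulVec_mem_stableSpace (hP z).1 t, ?_⟩
  conv => enter [2, 1]; rw [h4]
  rw [← Matrix.mulVec_sub]
  exact h.fundamental_mulVec_mem_centerUnstableSpace (hP z).2 t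

theorem stableProj_eq (h : IsAdmissible A B U T) {a b : Fin d → ℝ} (ha : a ∈ stableSpace A T t)
    (hb : b ∈ centerUnstableSpace A T t) : (stableProj A T t).mulVec (a + b) = a := by
  obtain ⟨h1, h2⟩ := h.stableProj_mem_and t (a + b)
  have h3 : (stableProj A T t).mulVec (a + b) - a =
      b - (a + b - (stableProj A T t).mulVec (a + b)) := by abel
  exact sub_eq_zero.1 (Submodule.disjoint_def.1 (h.isCompl_stableSpace t).disjoint _
    (sub_mem h1 ha) (h3 ▸ sub_mem hb h2))

theorem stableProj_fundamental (h : IsAdmissible A B U T) (t s : ℝ) (x : Fin d → ℝ) :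
    (stableProj A T t).mulVec ((fundamental A t s).mulVec x) =
      (fundamental A t s).mulVec ((stableProj A T s).mulVec x) := by
  obtain ⟨h1, h2⟩ := h.stableProj_mem_and s x
  have := h.stableProj_eq (h.fundamental_mulVec_mem_stableSpace h1 t)
    (h.fundamental_mulVec_mem_centerUnstableSpace h2 t)
  rwa [← Matrix.mulVec_add, add_sub_cancel] at this

theorem stableProj_add_int (h : IsAdmissible A B U T) (n : ℤ) (t : ℝ) (x : Fin d → ℝ) :
    (stableProj A T (t + n * T)).mulVec x = (stableProj A T t).mulVec x := by
  obtain ⟨h1, h2⟩ := h.stableProj_mem_and t x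
  rw [← h.stableSpace_add_int n] at h1
  rw [← h.centerUnstableSpace_add_int n] at h2
  have := h.stableProj_eq h1 h2
  rwa [add_sub_cancel] at this

/-- Immediate from transporting a single projection at time 0 by the fundamental solution; this
continuity is what lets the closure pass through the stable projection later. -/
theorem continuous_stableProj (h : IsAdmissible A B U T) : Continuous (stableProj A T) :=
  ((continuous_fundamental_left h.memLp_A 0).mul continuous_const).mul
    ((continuous_fundamental h.memLp_A).comp (Continuous.prodMk_right 0))

/-- The constants sum the norms over the images of the unit vectors, each of which is summable in
`k` because its projection lies in the stable space. -/
theorem exists_summable_stable_bound (h : IsAdmissible A B U T) (t : ℝ) :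
    ∃ c : ℕ → ℝ, (∀ k, 0 ≤ c k) ∧ Summable c ∧
      ∀ k x, ‖(fundamental A (T + t) t ^ k).mulVec ((stableProj A T t).mulVec x)‖ ≤ c k * ‖x‖ := by
  set M := fundamental A (T + t) t
  refine ⟨fun k => ∑ i, ‖(M ^ k).mulVec ((stableProj A T t).mulVec (Pi.single i 1))‖,
    fun k => Finset.sum_nonneg fun i _ => norm_nonneg _,
    summable_sum fun i _ => summable_norm_pow_mulVec ?_, fun k x => ?_⟩
  · have := (h.stableProj_mem_and t (Pi.single i 1)).1
    rwa [stableSpace_eq h.memLp_A h.pos] at this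
  · have hx : x = ∑ i, x i • (Pi.single i 1 : Fin d → ℝ) := by
      ext i; simp [Finset.sum_apply, Pi.single_apply]
    calc _ = ‖∑ i, x i • (M ^ k).mulVec ((stableProj A T t).mulVec (Pi.single i 1))‖ := by
          conv_lhs => rw [hx]
          simp only [Matrix.mulVec_sum, Matrix.mulVec_smul]
      _ ≤ ∑ i, ‖(M ^ k).mulVec ((stableProj A T t).mulVec (Pi.single i 1))‖ * ‖x‖ := by
          refine (norm_sum_le _ _).trans (Finset.sum_le_sum fun i _ => ?_)
          rw [norm_smul, mul_comm]
          gcongr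
          exact norm_le_pi_norm x i
      _ = _ := by rw [Finset.sum_mul]

open Filter Topology in
/-- Solutions which start in the stable subspace tend to `0`. -/
theorem tendsto_fundamental_stable (h : IsAdmissible A B U T) (hx : x ∈ stableSpace A T s) :
    Tendsto (fun t => (fundamental A t s).mulVec x) atTop (𝓝 0) := by
  obtain ⟨C, hC0, hC⟩ := h.exists_fundamental_bound T
  rw [stableSpace_eq h.memLp_A h.pos] at hx
  have h1 : Tendsto (fun t : ℝ => ⌊(t - s) / T⌋₊) atTop atTop :=
    tendsto_nat_floor_atTop.comp
      ((tendsto_atTop_add_const_right _ (-s) tendsto_id).atTop_div_const h.pos)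
  have h2 := ((summable_norm_pow_mulVec hx).tendsto_atTop_zero.comp h1).const_mul C
  rw [mul_zero] at h2
  refine squeeze_zero_norm' ?_ h2
  filter_upwards [eventually_ge_atTop s] with t ht
  set k := ⌊(t - s) / T⌋₊ with hk
  have hk1 : k * T ≤ t - s := by
    rw [← le_div_iff₀ h.pos]; exact Nat.floor_le (div_nonneg (by linarith) h.pos.le)
  have hk2 : t - s < (k + 1) * T := by
    rw [← div_lt_iff₀ h.pos]; exact Nat.lt_floor_add_one _
  rw [← fundamental_mul h.memLp_A t (s + k * T) s, ← Matrix.mulVec_mulVec,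
    h.fundamental_add_nat_mul]
  exact hC _ _ (by rw [abs_le]; constructor <;> linarith [h.pos]) _

open Filter Topology in
-- Split `s` into `k` whole periods and a remainder shorter than `T`: the remainder costs a uniform
-- constant, and the periods contribute the factor `c k`, which tends to 0.
theorem exists_tendsto_stable_bound (h : IsAdmissible A B U T) (t : ℝ) :
    ∃ g : ℝ → ℝ, Tendsto g atTop (𝓝 0) ∧ ∀ s ≥ 0, ∀ x,
      ‖(stableProj A T t).mulVec ((fundamental A t (t - s)).mulVec x)‖ ≤ g s * ‖x‖ := by
  obtain ⟨C, hC0, hC⟩ := h.exists_fundamental_bound T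
  obtain ⟨c, hc0, hcs, hc⟩ := h.exists_summable_stable_bound t
  have h1 : Tendsto (fun s : ℝ => ⌊s / T⌋₊) atTop atTop :=
    tendsto_nat_floor_atTop.comp (tendsto_id.atTop_div_const h.pos)
  have h2 := (hcs.tendsto_atTop_zero.comp h1).mul_const C
  rw [zero_mul] at h2
  refine ⟨_, h2, fun s hs x => ?_⟩
  set k := ⌊s / T⌋₊ with hk
  have hk1 : k * T ≤ s := by
    rw [← le_div_iff₀ h.pos]; exact Nat.floor_le (div_nonneg hs h.pos.le)
  have hk2 : s < (k + 1) * T := by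
    rw [← div_lt_iff₀ h.pos]; exact Nat.lt_floor_add_one _
  have h3 := h.stableProj_add_int (-k) t
  push_cast at h3
  rw [neg_mul, ← sub_eq_add_neg] at h3
  rw [← fundamental_mul h.memLp_A t (t - k * T), ← Matrix.mulVec_mulVec, h.stableProj_fundamental,
    h3, h.fundamental_sub_nat_mul]
  refine (hc k _).trans ?_
  rw [Function.comp_apply, ← hk, mul_assoc]
  exact mul_le_mul_of_nonneg_left
    (hC _ _ (by rw [abs_le]; constructor <;> linarith [h.pos]) _) (hc0 k)

/-- The effects of the control over the successive periods, each bounded by `C`, are transported to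
time 0 by powers of the monodromy matrix. -/
theorem exists_sum_of_mem_reach (h : IsAdmissible A B U T) {C : ℝ}
    (hC : ∀ t s, |t - s| ≤ T → ∀ u ∈ controls U, ‖phi A B t s 0 u‖ ≤ C) (k : ℕ) :
    ∀ z ∈ reach A B U 0 (0 - k * T) 0, ∃ p : ℕ → Fin d → ℝ, (∀ j, ‖p j‖ ≤ C) ∧
      z = ∑ j ∈ Finset.range k, (fundamental A (T + 0) 0 ^ j).mulVec (p j) := by
  have hT := h.pos
  induction k with
  | zero =>
    rintro z ⟨u, hu, rfl⟩
    have h0 : phi A B 0 (0 - (0 : ℕ) * T) 0 u = 0 := by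
      simp [phi_self h.memLp_A h.memLp_B hu.1]
    exact ⟨fun _ => phi A B 0 0 0 u, fun _ => hC 0 0 (by simpa using hT.le) u hu, by rw [h0]; simp⟩
  | succ k ih =>
    rintro z ⟨u, hu, rfl⟩
    have h1 : phi A B (0 - T) (0 - (k + 1 : ℕ) * T) 0 u ∈ reach A B U 0 (0 - k * T) 0 := by
      have : phi A B (0 - T) (0 - (k + 1 : ℕ) * T) 0 u ∈
          reach A B U (0 - T) (0 - (k + 1 : ℕ) * T) 0 := ⟨u, hu, rfl⟩
      rw [← h.reach_add_int 1] at this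
      convert this using 2 <;> push_cast <;> ring
    obtain ⟨p, hp, hz⟩ := ih _ h1
    -- The last period before time 0 enters at index 0 and the earlier contributions move up by one
    -- power.
    refine ⟨fun j => Nat.casesOn j (phi A B 0 (0 - T) 0 u) p, fun j => ?_, ?_⟩
    · cases j with
      | zero => exact hC _ _ (by rw [sub_sub_cancel, abs_of_pos hT]) u hu
      | succ j => exact hp j
    · have h2 := h.fundamental_sub_nat_mul 1 0
      rw [Nat.cast_one, one_mul, pow_one] at h2
      rw [← phi_trans h.memLp_A h.memLp_B hu.1 0 (0 - T), phi_eq h.memLp_A h.memLp_B hu.1, h2, hz,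
        Finset.sum_range_succ', Matrix.mulVec_sum]
      simp only [pow_zero, Matrix.one_mulVec]
      congr 1
      refine Finset.sum_congr rfl fun j _ => ?_
      rw [Matrix.mulVec_mulVec, ← pow_succ']

/-- The stable projection commutes with the monodromy matrix, so in the period decomposition it
replaces each power by one of summable norm. Negative `t` is included because time reversal applies
the bound at `-t`. -/
theorem exists_stable_reachable_bound (h : IsAdmissible A B U T) :
    ∃ C, ∀ t, |t| ≤ T → ∀ x ∈ reachableSet A B U t, x ∈ stableSpace A T t → ‖x‖ ≤ C := by
  obtain ⟨C₁, hC₁0, hC₁⟩ := h.exists_phi_bound T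
  obtain ⟨C₂, hC₂0, hC₂⟩ := h.exists_fundamental_bound T
  obtain ⟨c, hc0, hcs, hc⟩ := h.exists_summable_stable_bound 0
  have hC₁' : ∀ t s, |t - s| ≤ T → ∀ u ∈ controls U, ‖phi A B t s 0 u‖ ≤ C₁ :=
    fun t s hts u hu => by simpa using hC₁ t s hts u hu 0
  have hbd : ∀ x, ‖(stableProj A T 0).mulVec x‖ ≤ c 0 * ‖x‖ := fun x => by simpa using hc 0 x
  refine ⟨C₂ * ((∑' k, c k) * C₁ + c 0 * (C₂ * C₁)), fun t ht x hx hxs => ?_⟩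
  obtain ⟨s, hs, hx⟩ := hx
  -- The start `-k T` lies before both `s` and `t`. The trajectory is compared with its value at 0
  -- and then followed, forward or backward, to `t`.
  obtain ⟨k, hk⟩ := exists_nat_mul_ge h.pos (max (-s) (-t))
  have hk1 := (le_max_left _ _).trans hk
  have hk2 := (le_max_right _ _).trans hk
  obtain ⟨u, hu, rfl⟩ := h.mem_reach_of_le (s := 0 - k * T) (by linarith) hs hx
  set z := phi A B 0 (0 - k * T) 0 u with hz
  obtain ⟨p, hp, hzp⟩ := h.exists_sum_of_mem_reach hC₁' k z ⟨u, hu, rfl⟩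
  set w := phi A B t 0 0 u with hw
  have hxz : phi A B t (0 - k * T) 0 u = (fundamental A t 0).mulVec z + w := by
    rw [← phi_trans h.memLp_A h.memLp_B hu.1 t 0, phi_eq h.memLp_A h.memLp_B hu.1]
  set x := phi A B t (0 - k * T) 0 u
  have h1 : (stableProj A T t).mulVec x = x := by
    simpa using h.stableProj_eq hxs (Submodule.zero_mem (centerUnstableSpace A T t))
  have h2 : x = (fundamental A t 0).mulVec ((stableProj A T 0).mulVec z +
      (stableProj A T 0).mulVec ((fundamental A 0 t).mulVec w)) := by
    rw [Matrix.mulVec_add, ← h.stableProj_fundamental, ← h.stableProj_fundamental,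
      Matrix.mulVec_mulVec (M := fundamental A t 0), fundamental_mul h.memLp_A,
      fundamental_self h.memLp_A, Matrix.one_mulVec, ← Matrix.mulVec_add, ← hxz, h1]
  have h3 : ‖(stableProj A T 0).mulVec z‖ ≤ (∑' k, c k) * C₁ := by
    have h4 : (stableProj A T 0).mulVec z = ∑ j ∈ Finset.range k,
        (fundamental A (T + 0) 0 ^ j).mulVec ((stableProj A T 0).mulVec (p j)) := by
      rw [hzp, Matrix.mulVec_sum]
      refine Finset.sum_congr rfl fun j _ => ?_
      have h5 := h.stableProj_fundamental (0 + j * T) 0 (p j)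
      have h6 := h.stableProj_add_int j 0
      push_cast at h6
      rwa [h6, h.fundamental_add_nat_mul] at h5
    rw [h4]
    calc _ ≤ ∑ j ∈ Finset.range k, c j * C₁ :=
          (norm_sum_le _ _).trans (Finset.sum_le_sum fun j _ =>
            (hc j _).trans (mul_le_mul_of_nonneg_left (hp j) (hc0 j)))
      _ = (∑ j ∈ Finset.range k, c j) * C₁ := by rw [Finset.sum_mul]
      _ ≤ _ := by gcongr; exact hcs.sum_le_tsum _ fun j _ => hc0 j
  have h4 : ‖(stableProj A T 0).mulVec ((fundamental A 0 t).mulVec w)‖ ≤ c 0 * (C₂ * C₁) := by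
    have h5 := hc0 0
    refine (hbd _).trans ?_
    gcongr
    refine (hC₂ _ _ (by rwa [zero_sub, abs_neg]) _).trans ?_
    gcongr
    exact hC₁' _ _ (by rwa [sub_zero]) u hu
  rw [h2]
  refine (hC₂ _ _ (by rwa [sub_zero]) _).trans ?_
  gcongr
  exact (norm_add_le _ _).trans (add_le_add h3 h4)

/-! #### Time-reversed versions -/

theorem convex_nullSet (h : IsAdmissible A B U T) (t : ℝ) : Convex ℝ (nullSet A B U t) := by
  rw [← h.reachableSet_reverse]; exact h.reverse.convex_reachableSet _

theorem isOpen_nullSet (h : IsAdmissible A B U T) :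
    IsOpen {p : ℝ × (Fin d → ℝ) | p.2 ∈ nullSet A B U p.1} := by
  simp_rw [← h.reachableSet_reverse]
  exact h.reverse.isOpen_reachableSet.preimage
    (f := fun p : ℝ × (Fin d → ℝ) => (-p.1, p.2)) (by fun_prop)

theorem isOpen_nullSet_fiber (h : IsAdmissible A B U T) (t : ℝ) : IsOpen (nullSet A B U t) :=
  h.isOpen_nullSet.preimage (Continuous.prodMk_right t)

theorem zero_mem_nullSet (h : IsAdmissible A B U T) (t : ℝ) : 0 ∈ nullSet A B U t := by
  rw [← h.reachableSet_reverse]; exact h.reverse.zero_mem_reachableSet _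

theorem add_mem_nullSet (h : IsAdmissible A B U T) (hx : x ∈ nullSet A B U t)
    {w : Fin d → ℝ} (hw : w ∈ centerStableSpace A T t) : x + w ∈ nullSet A B U t := by
  rw [← h.reachableSet_reverse] at hx ⊢
  rw [← h.centerUnstableSpace_reverse] at hw
  exact h.reverse.add_mem_reachableSet hx hw

theorem fundamental_mulVec_mem_nullSet (h : IsAdmissible A B U T)
    (hx : x ∈ nullSet A B U s) (hst : t ≤ s) :
    (fundamental A t s).mulVec x ∈ nullSet A B U t := by
  rw [← h.reachableSet_reverse] at hx ⊢
  have := h.reverse.fundamental_mulVec_mem_reachableSet hx (neg_le_neg hst)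
  rwa [fundamental_reverse h.memLp_A, neg_neg, neg_neg] at this

theorem exists_unstable_null_bound (h : IsAdmissible A B U T) :
    ∃ C, ∀ t, |t| ≤ T → ∀ x ∈ nullSet A B U t, x ∈ unstableSpace A T t → ‖x‖ ≤ C := by
  obtain ⟨C, hC⟩ := h.reverse.exists_stable_reachable_bound
  refine ⟨C, fun t ht x hx hxu => hC (-t) (by rwa [abs_neg]) x ?_ ?_⟩
  · rwa [h.reachableSet_reverse]
  · rwa [h.stableSpace_reverse]

open Filter Topology in
/-- Backward solutions are asymptotically in the center-stable subspace, uniformly on bounded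
sets. -/
theorem exists_tendsto_unstable_bound (h : IsAdmissible A B U T) (t : ℝ) :
    ∃ g : ℝ → ℝ, Tendsto g atTop (𝓝 0) ∧ ∀ s ≥ 0, ∀ x, ∃ w,
      (fundamental A t (t + s)).mulVec x - w ∈ centerStableSpace A T t ∧ ‖w‖ ≤ g s * ‖x‖ := by
  obtain ⟨g, hg, hg'⟩ := h.reverse.exists_tendsto_stable_bound (-t)
  refine ⟨g, hg, fun s hs x => ⟨_, ?_, hg' s hs x⟩⟩
  have := (h.reverse.stableProj_mem_and (-t) ((fundamental A t (t + s)).mulVec x)).2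
  rw [h.centerUnstableSpace_reverse] at this
  rwa [fundamental_reverse h.memLp_A, show -(-t - s) = t + s by ring, neg_neg]

/-! ### Comparison with the unions over whole periods, and invariance properties. -/

theorem reachN_eq (h : IsAdmissible A B U T) {τ : ℝ} (hτ : τ ∈ Ico 0 T) :
    reachN A B U T τ = reachableSet A B U τ := by
  ext x
  simp only [reachN, mem_iUnion]
  have key : ∀ k : ℕ, reach A B U (k * T + τ) 0 0 = reach A B U τ (0 - k * T) 0 := fun k => by
    rw [← h.reach_add_int k τ, Int.cast_natCast, sub_add_cancel, add_comm]
  constructor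
  · rintro ⟨k, hx⟩
    rw [key] at hx
    have : 0 ≤ k * T := mul_nonneg k.cast_nonneg h.pos.le
    exact ⟨_, by linarith [hτ.1], hx⟩
  · rintro ⟨s, hs, hx⟩
    obtain ⟨k, hk⟩ := exists_nat_mul_ge h.pos (-s)
    exact ⟨k, by rw [key]; exact h.mem_reach_of_le (by linarith) hs hx⟩

/-- Shifting by `k` periods turns steering from `-kT + τ` to the origin at time 0 into steering from
`τ` to the origin at time `kT`. -/
theorem ctrlN_eq (h : IsAdmissible A B U T) {τ : ℝ} :
    ctrlN A B U T τ = nullSet A B U τ := by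
  ext x
  simp only [ctrlN, mem_iUnion]
  have key : ∀ k : ℕ, x ∈ ctrl A B U (-(k * T) + τ) 0 0 ↔ x ∈ reach A B U τ (k * T) 0 :=
    fun k => by
      rw [← h.reach_add_int (-k) τ, mem_reach_zero_iff h.memLp_A h.memLp_B]
      push_cast
      rw [show (k * T + -k * T : ℝ) = 0 by ring, show (τ + -k * T : ℝ) = -(k * T) + τ by ring]
      rfl
  constructor
  · rintro ⟨k, hk, hx⟩
    exact ⟨k * T, by linarith, (key k).1 hx⟩
  · rintro ⟨s, hs, hx⟩
    obtain ⟨k, hk⟩ := exists_nat_mul_ge h.pos s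
    exact ⟨k, by linarith, (key k).2 (reach_zero_mono h.memLp_A h.memLp_B h.zero_mem
      (mem_uIcc.2 (Or.inr ⟨hs, hk⟩)) hx)⟩

/-- The control that reaches the origin is continued by 0: before arrival its remainder still steers
to 0, and afterwards the state stays at 0. -/
theorem exists_control_nullSet (h : IsAdmissible A B U T) (hx : x ∈ nullSet A B U t) :
    ∃ w ∈ controls U, ∀ r ≥ t, phi A B r t x w ∈ nullSet A B U r := by
  classical
  obtain ⟨s, hs, hx⟩ := hx
  obtain ⟨u, hu, hu0⟩ := (mem_reach_zero_iff h.memLp_A h.memLp_B).1 hx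
  have h0 := zero_mem_controls h.zero_mem
  have hw : (Iic s).piecewise u (fun _ => 0) ∈ controls U := by
    refine ⟨MemLp.piecewise measurableSet_Iic (hu.1.restrict _) (h0.1.restrict _), ?_⟩
    filter_upwards [hu.2, h0.2] with q h1 h2
    by_cases hq : q ∈ Iic s
    · rwa [piecewise_eq_of_mem _ _ _ hq]
    · rwa [piecewise_eq_of_notMem _ _ _ hq]
  have h1 : phi A B s t x ((Iic s).piecewise u fun _ => 0) = 0 := by
    rw [← hu0]
    refine phi_congr h.memLp_A h.memLp_B hw.1 hu.1 (.of_forall fun q hq => ?_) x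
    rw [uIoc_of_le hs] at hq
    exact piecewise_eq_of_mem _ _ _ hq.2
  refine ⟨_, hw, fun r hr => ?_⟩
  rcases le_total r s with hrs | hrs
  · refine ⟨s, hrs, (mem_reach_zero_iff h.memLp_A h.memLp_B).2 ⟨_, hw, ?_⟩⟩
    rw [phi_trans h.memLp_A h.memLp_B hw.1, h1]
  · rw [← phi_trans h.memLp_A h.memLp_B hw.1 r s, h1,
      phi_congr h.memLp_A h.memLp_B hw.1 h0.1 (.of_forall fun q hq => ?_),
      phi_zero_zero h.memLp_A h.memLp_B]
    · exact h.zero_mem_nullSet r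
    · rw [uIoc_of_le hrs] at hq
      exact piecewise_eq_of_notMem _ _ _ (not_le.2 hq.1)

/-- With `k = d` this says that Y(τ) maps K⁻ into itself, which is why the factors in the spectral
bounds only weaken them. -/
theorem fundamental_mulVec_mem_reachable_stable (h : IsAdmissible A B U T) (k : ℕ)
    (hx : x ∈ reachableSet A B U t ∧ x ∈ stableSpace A T t) :
    (fundamental A (t + k * T) t).mulVec x ∈ reachableSet A B U t ∧
      (fundamental A (t + k * T) t).mulVec x ∈ stableSpace A T t := by
  have hk : 0 ≤ k * T := mul_nonneg k.cast_nonneg h.pos.le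
  have h1 := h.reachableSet_add_int k t
  have h2 := h.stableSpace_add_int k t
  rw [Int.cast_natCast] at h1 h2
  rw [← h1, ← h2]
  exact ⟨h.fundamental_mulVec_mem_reachableSet hx.1 (by linarith),
    h.fundamental_mulVec_mem_stableSpace hx.2 _⟩

theorem fundamental_mulVec_mem_null_unstable (h : IsAdmissible A B U T) (k : ℕ)
    (hx : x ∈ nullSet A B U t ∧ x ∈ unstableSpace A T t) :
    (fundamental A t (t + k * T)).mulVec x ∈ nullSet A B U t ∧
      (fundamental A t (t + k * T)).mulVec x ∈ unstableSpace A T t := by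
  have hk : 0 ≤ k * T := mul_nonneg k.cast_nonneg h.pos.le
  have h1 := h.nullSet_add_int k t
  have h2 := h.unstableSpace_add_int k t
  rw [Int.cast_natCast] at h1 h2
  rw [← h1, ← h2] at hx
  exact ⟨h.fundamental_mulVec_mem_nullSet hx.1 (by linarith),
    h.fundamental_mulVec_mem_unstableSpace hx.2 _⟩

end IsAdmissible

/-! ### The covering `ℝ × ℝᵈ → 𝕊¹ × ℝᵈ` -/

section Cover

variable {d : ℕ} {T : ℝ}

/-- The covering map `ℝ × ℝᵈ → 𝕊¹ × ℝᵈ`. -/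
def cover (d : ℕ) (T : ℝ) (p : ℝ × (Fin d → ℝ)) : AddCircle T × (Fin d → ℝ) :=
  ((p.1 : AddCircle T), p.2)

theorem continuous_cover : Continuous (cover d T) :=
  ((AddCircle.continuous_mk' T).comp continuous_fst).prodMk continuous_snd

theorem isOpenMap_cover : IsOpenMap (cover d T) :=
  (QuotientAddGroup.isOpenMap_coe (N := AddSubgroup.zmultiples T)).prodMap IsOpenMap.id

theorem surjective_cover : Function.Surjective (cover d T) := by
  rintro ⟨a, x⟩
  obtain ⟨t, rfl⟩ := QuotientAddGroup.mk_surjective a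
  exact ⟨(t, x), rfl⟩

theorem preimage_closure_cover (S : Set (AddCircle T × (Fin d → ℝ))) :
    cover d T ⁻¹' closure S = closure (cover d T ⁻¹' S) :=
  isOpenMap_cover.preimage_closure_eq_closure_preimage continuous_cover S

theorem cover_add_int (n : ℤ) (t : ℝ) (x : Fin d → ℝ) :
    cover d T (t + n * T, x) = cover d T (t, x) := by
  refine Prod.ext ?_ rfl
  change ((t + n * T : ℝ) : AddCircle T) = t
  rw [← zsmul_eq_mul, AddCircle.coe_add, AddCircle.coe_zsmul, AddCircle.coe_period, smul_zero,
    add_zero]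

theorem exists_int_of_coe_eq {a b : ℝ} (h : (a : AddCircle T) = b) : ∃ n : ℤ, a = b + n * T := by
  obtain ⟨n, hn⟩ := AddSubgroup.mem_zmultiples_iff.1 (QuotientAddGroup.eq.1 h.symm)
  exact ⟨n, by rw [← zsmul_eq_mul, hn]; ring⟩

theorem cover_mem_bundleSum {t : ℝ} {x : Fin d → ℝ}
    {S S' : Set (AddCircle T × (Fin d → ℝ))} :
    cover d T (t, x) ∈ bundleSum S S' ↔
      ∃ a b, cover d T (t, a) ∈ S ∧ cover d T (t, b) ∈ S' ∧ x = a + b := Iff.rfl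

variable [hT : Fact (0 < T)]

theorem rep_mem (a : AddCircle T) : rep a ∈ Ico 0 T := by
  have h := (AddCircle.equivIco T 0 a).2
  exact ⟨h.1, h.2.trans_eq (zero_add T)⟩

theorem coe_rep (a : AddCircle T) : ((rep a : ℝ) : AddCircle T) = a :=
  AddCircle.coe_equivIco

theorem exists_rep_eq (T : ℝ) [Fact (0 < T)] (t : ℝ) : ∃ n : ℤ, rep (t : AddCircle T) = t + n * T :=
  exists_int_of_coe_eq (coe_rep _)

theorem mem_bundle_cover {K L : ℝ → Set (Fin d → ℝ)} (hL : ∀ (n : ℤ) t, L (t + n * T) = L t)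
    (hKL : ∀ τ ∈ Ico 0 T, K τ = L τ) {t : ℝ} {x : Fin d → ℝ} :
    cover d T (t, x) ∈ bundle T K ↔ x ∈ L t := by
  obtain ⟨n, hn⟩ := exists_rep_eq T t
  change x ∈ K (rep (t : AddCircle T)) ↔ _
  rw [hKL _ (rep_mem _), hn, hL]

end Cover

namespace IsAdmissible

variable {d m : ℕ} {A : ℝ → Matrix (Fin d) (Fin d) ℝ} {B : ℝ → Matrix (Fin d) (Fin m) ℝ}
  {U : Set (Fin m → ℝ)} {T : ℝ} [hT : Fact (0 < T)] {u : ℝ → Fin m → ℝ} {t s : ℝ}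
  {x y : Fin d → ℝ}

/-! #### The autonomized system in the covering space -/

/-- The representative in `[0, T)` differs from `t` by whole periods, so the two descriptions agree
up to a shift of the control, and the admissible controls are shift-invariant. -/
theorem exists_phiA_cover (h : IsAdmissible A B U T) (t : ℝ) :
    ∃ c : ℝ, ∀ u, MemLp u ⊤ volume → ∀ s x,
      phiA A B s (cover d T (t, x)) (fun r => u (r + c)) = cover d T (t + s, phi A B (t + s) t x u) ∧
      phiA A B s (cover d T (t, x)) u =
        cover d T (t + s, phi A B (t + s) t x fun r => u (r - c)) := by
  obtain ⟨n, hn⟩ := exists_rep_eq T t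
  have key : ∀ u, MemLp u ⊤ volume → ∀ s x,
      phiA A B s (cover d T (t, x)) u =
        cover d T (t + s, phi A B (t + s) t x fun r => u (r - (-n : ℤ) * T)) := by
    intro u hu s x
    have h1 := h.phi_add_int n hu (t + s) t x
    refine Prod.ext ?_ ?_
    · change (t : AddCircle T) + s = _
      rw [← AddCircle.coe_add]; rfl
    · change phi A B (rep (t : AddCircle T) + s) (rep (t : AddCircle T)) x u =
        phi A B (t + s) t x fun r => u (r - (-n : ℤ) * T)
      rw [hn, add_right_comm, h1]
      congr 1; ext1 r; congr 1; push_cast; ring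
  refine ⟨(-n : ℤ) * T, fun u hu s x => ⟨?_, key u hu s x⟩⟩
  rw [key _ (memLp_comp_add_right hu _)]
  simp only [sub_add_cancel]

theorem mem_reachA_cover (h : IsAdmissible A B U T) {q : AddCircle T × (Fin d → ℝ)} :
    q ∈ reachA A B U (cover d T (t, x)) ↔
      ∃ s ≥ 0, ∃ u ∈ controls U, cover d T (t + s, phi A B (t + s) t x u) = q := by
  obtain ⟨c, hc⟩ := h.exists_phiA_cover t
  constructor
  · rintro ⟨s, hs, u, hu, rfl⟩
    exact ⟨s, hs, _, comp_add_right_mem_controls hu (-c), ((hc u hu.1 s x).2).symm⟩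
  · rintro ⟨s, hs, u, hu, rfl⟩
    exact ⟨s, hs, _, comp_add_right_mem_controls hu c, (hc u hu.1 s x).1⟩

theorem phiA_mem_reachA (h : IsAdmissible A B U T) {p q : AddCircle T × (Fin d → ℝ)}
    (hq : q ∈ reachA A B U p) (hs : 0 ≤ s) (hu : u ∈ controls U) :
    phiA A B s q u ∈ reachA A B U p := by
  obtain ⟨⟨t, x⟩, rfl⟩ := surjective_cover p
  obtain ⟨r, hr, v, hv, rfl⟩ := h.mem_reachA_cover.1 hq
  obtain ⟨c, hc⟩ := h.exists_phiA_cover (t + r)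
  rw [(hc u hu.1 s _).2]
  have hv' : phi A B (t + r) t x v ∈ reach A B U (t + r) t x := ⟨v, hv, rfl⟩
  obtain ⟨w, hw, hw'⟩ := mem_reach_phi h.memLp_A h.memLp_B (t := t + r + s)
    (mem_uIcc.2 (Or.inl ⟨by linarith, by linarith⟩)) (comp_add_right_mem_controls hu (-c)) hv'
  refine h.mem_reachA_cover.2 ⟨r + s, by linarith, w, hw, ?_⟩
  rw [← add_assoc, hw']
  rfl

theorem reachA_subset (h : IsAdmissible A B U T) {p q : AddCircle T × (Fin d → ℝ)}
    (hq : q ∈ reachA A B U p) : reachA A B U q ⊆ reachA A B U p := by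
  rintro _ ⟨s, hs, u, hu, rfl⟩
  exact h.phiA_mem_reachA hq hs hu

/-- The closure of a positively invariant set is positively invariant. -/
theorem phiA_mem_closure (h : IsAdmissible A B U T) {S : Set (AddCircle T × (Fin d → ℝ))}
    (hS : ∀ q ∈ S, ∀ s, 0 ≤ s → ∀ u ∈ controls U, phiA A B s q u ∈ S)
    {p : AddCircle T × (Fin d → ℝ)} (hp : p ∈ closure S) (hs : 0 ≤ s) (hu : u ∈ controls U) :
    phiA A B s p u ∈ closure S := by
  obtain ⟨⟨t, x⟩, rfl⟩ := surjective_cover p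
  obtain ⟨c, hc⟩ := h.exists_phiA_cover t
  rw [(hc u hu.1 s x).2]
  set v := fun r => u (r - c) with hv
  have hv' : v ∈ controls U := comp_add_right_mem_controls hu (-c)
  have hF : Continuous fun p : ℝ × (Fin d → ℝ) => (p.1 + s, phi A B (p.1 + s) p.1 p.2 v) :=
    (continuous_fst.add continuous_const).prodMk
      ((continuous_phi_joint h.memLp_A h.memLp_B hv'.1).comp
        ((continuous_fst.add continuous_const).prodMk (continuous_fst.prodMk continuous_snd)))
  have hp' : (t, x) ∈ closure (cover d T ⁻¹' S) := by rwa [← preimage_closure_cover]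
  have := map_mem_closure hF hp' (t := cover d T ⁻¹' S) fun q hq => by
    obtain ⟨c', hc'⟩ := h.exists_phiA_cover q.1
    rw [mem_preimage, ← (hc' v hv'.1 s q.2).1]
    exact hS _ hq s hs _ (comp_add_right_mem_controls hv' c')
  rwa [← preimage_closure_cover] at this

theorem reachA_subset_closure (h : IsAdmissible A B U T) {p q : AddCircle T × (Fin d → ℝ)}
    (hq : q ∈ closure (reachA A B U p)) : reachA A B U q ⊆ closure (reachA A B U p) := by
  rintro _ ⟨s, hs, u, hu, rfl⟩
  exact h.phiA_mem_closure (fun q hq s hs u hu => h.phiA_mem_reachA hq hs hu) hq hs hu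

theorem cover_mem_reachA_zero (h : IsAdmissible A B U T) :
    cover d T (t, x) ∈ reachA A B U (0, 0) ↔ x ∈ reachableSet A B U t := by
  rw [show ((0, 0) : AddCircle T × (Fin d → ℝ)) = cover d T (0, 0) from rfl, h.mem_reachA_cover]
  constructor
  · rintro ⟨s, hs, u, hu, he⟩
    obtain ⟨n, hn⟩ := exists_int_of_coe_eq (congrArg Prod.fst he)
    have hx : phi A B (0 + s) 0 0 u = x := congrArg Prod.snd he
    have : x ∈ reachableSet A B U (0 + s) := ⟨0, by linarith, u, hu, hx⟩
    rwa [show 0 + s = t + n * T from hn, h.reachableSet_add_int] at this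
  · rintro ⟨s, hs, hx⟩
    obtain ⟨n, hn⟩ := exists_nat_mul_ge h.pos (-s)
    have hx := h.mem_reach_of_le (s := 0 - n * T) (by linarith) hs hx
    rw [← h.reach_add_int n, Int.cast_natCast, sub_add_cancel] at hx
    obtain ⟨u, hu, rfl⟩ := hx
    refine ⟨t + n * T, by linarith, u, hu, ?_⟩
    rw [zero_add]
    exact cover_add_int n t _

theorem cover_mem_ctrlA_zero (h : IsAdmissible A B U T) :
    cover d T (t, x) ∈ ctrlA A B U (0, 0) ↔ x ∈ nullSet A B U t := by
  have h0 : cover d T (t, x) ∈ ctrlA A B U (0, 0) ↔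
      (0, 0) ∈ reachA A B U (cover d T (t, x)) := Iff.rfl
  rw [h0, h.mem_reachA_cover]
  constructor
  · rintro ⟨s, hs, u, hu, he⟩
    exact ⟨t + s, by linarith, (mem_reach_zero_iff h.memLp_A h.memLp_B).2
      ⟨u, hu, congrArg Prod.snd he⟩⟩
  · rintro ⟨s, hs, hx⟩
    obtain ⟨n, hn⟩ := exists_nat_mul_ge h.pos s
    have hx := reach_zero_mono h.memLp_A h.memLp_B h.zero_mem (t := t) (s := n * T)
      (mem_uIcc.2 (Or.inr ⟨hs, hn⟩)) hx
    obtain ⟨u, hu, hu'⟩ := (mem_reach_zero_iff h.memLp_A h.memLp_B).1 hx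
    refine ⟨n * T - t, by linarith, u, hu, ?_⟩
    rw [add_sub_cancel, hu']
    have := cover_add_int (d := d) (T := T) n 0 0
    rw [zero_add] at this
    exact this

theorem mem_ctrlA_iff {p q : AddCircle T × (Fin d → ℝ)} :
    p ∈ ctrlA A B U q ↔ q ∈ reachA A B U p := Iff.rfl

theorem preimage_reachA_zero (h : IsAdmissible A B U T) :
    cover d T ⁻¹' reachA A B U (0, 0) = {p | p.2 ∈ reachableSet A B U p.1} :=
  Set.ext fun _ => h.cover_mem_reachA_zero

theorem preimage_ctrlA_zero (h : IsAdmissible A B U T) :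
    cover d T ⁻¹' ctrlA A B U (0, 0) = {p | p.2 ∈ nullSet A B U p.1} :=
  Set.ext fun _ => h.cover_mem_ctrlA_zero

theorem isOpen_reachA_zero (h : IsAdmissible A B U T) :
    IsOpen (reachA A B U ((0, 0) : AddCircle T × (Fin d → ℝ))) := by
  rw [← image_preimage_eq (reachA A B U (0, 0)) (surjective_cover (d := d) (T := T)),
    h.preimage_reachA_zero]
  exact isOpenMap_cover _ h.isOpen_reachableSet

theorem isOpen_ctrlA_zero (h : IsAdmissible A B U T) :
    IsOpen (ctrlA A B U ((0, 0) : AddCircle T × (Fin d → ℝ))) := by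
  rw [← image_preimage_eq (ctrlA A B U (0, 0)) (surjective_cover (d := d) (T := T)),
    h.preimage_ctrlA_zero]
  exact isOpenMap_cover _ h.isOpen_nullSet

/-! ### The fibrewise sets of the statement, lifted to the covering space. -/

theorem cover_mem_KMinus (h : IsAdmissible A B U T) :
    cover d T (t, x) ∈ KMinus A B U T ↔ x ∈ reachableSet A B U t ∧ x ∈ stableSpace A T t := by
  refine mem_bundle_cover (L := fun t => reachableSet A B U t ∩ stableSpace A T t)
    (fun n t => ?_) fun τ hτ => ?_
  · rw [h.reachableSet_add_int, h.stableSpace_add_int]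
  · rw [h.reachN_eq hτ, (h.isOpen_reachableSet_fiber τ).interior_eq]

theorem cover_mem_KPlus (h : IsAdmissible A B U T) :
    cover d T (t, x) ∈ KPlus A B U T ↔ x ∈ nullSet A B U t ∧ x ∈ unstableSpace A T t := by
  refine mem_bundle_cover (L := fun t => nullSet A B U t ∩ unstableSpace A T t)
    (fun n t => ?_) fun τ hτ => ?_
  · rw [h.nullSet_add_int, h.unstableSpace_add_int]
  · rw [h.ctrlN_eq, (h.isOpen_nullSet_fiber τ).interior_eq]

theorem cover_mem_centerBundle (h : IsAdmissible A B U T) :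
    cover d T (t, x) ∈ centerBundle A T ↔ x ∈ centerSpace A T t :=
  mem_bundle_cover (L := fun t => (centerSpace A T t : Set (Fin d → ℝ)))
    (fun n t => by rw [h.centerSpace_add_int]) (fun τ _ => rfl)

/-- A fibre bound over one period suffices: `S` then lies in the continuous image of a compact set.
-/
theorem isBounded_of_cover_bound {S : Set (AddCircle T × (Fin d → ℝ))} {C : ℝ}
    (hS : ∀ t ∈ Icc 0 T, ∀ x, cover d T (t, x) ∈ S → ‖x‖ ≤ C) : Bornology.IsBounded S := by
  have hT0 := hT.out
  refine (((isCompact_Icc (a := (0 : ℝ)) (b := T)).prod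
    (ProperSpace.isCompact_closedBall (0 : Fin d → ℝ) C)).image
    (continuous_cover (d := d) (T := T))).isBounded.subset fun p hp => ?_
  have hr := rep_mem p.1
  have hp' : cover d T (rep p.1, p.2) = p := Prod.ext (coe_rep p.1) rfl
  refine ⟨(rep p.1, p.2), ⟨⟨hr.1, hr.2.le⟩, ?_⟩, hp'⟩
  rw [mem_closedBall_zero_iff]
  exact hS _ ⟨hr.1, hr.2.le⟩ _ (hp'.symm ▸ hp)

theorem isBounded_KMinus (h : IsAdmissible A B U T) : Bornology.IsBounded (KMinus A B U T) := by
  obtain ⟨C, hC⟩ := h.exists_stable_reachable_bound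
  refine isBounded_of_cover_bound (C := C) fun t ht x hx => ?_
  rw [h.cover_mem_KMinus] at hx
  exact hC t (by rw [abs_of_nonneg ht.1]; exact ht.2) x hx.1 hx.2

theorem isBounded_KPlus (h : IsAdmissible A B U T) : Bornology.IsBounded (KPlus A B U T) := by
  obtain ⟨C, hC⟩ := h.exists_unstable_null_bound
  refine isBounded_of_cover_bound (C := C) fun t ht x hx => ?_
  rw [h.cover_mem_KPlus] at hx
  exact hC t (by rw [abs_of_nonneg ht.1]; exact ht.2) x hx.1 hx.2

end IsAdmissible

/-- The control set around the zero section. -/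
def centralControlSet {d m : ℕ} (A : ℝ → Matrix (Fin d) (Fin d) ℝ)
    (B : ℝ → Matrix (Fin d) (Fin m) ℝ) (U : Set (Fin m → ℝ)) (T : ℝ) [Fact (0 < T)] :
    Set (AddCircle T × (Fin d → ℝ)) :=
  closure (reachA A B U (0, 0)) ∩ ctrlA A B U (0, 0)

namespace IsAdmissible

variable {d m : ℕ} {A : ℝ → Matrix (Fin d) (Fin d) ℝ} {B : ℝ → Matrix (Fin d) (Fin m) ℝ}
  {U : Set (Fin m → ℝ)} {T : ℝ} [hT : Fact (0 < T)] {u : ℝ → Fin m → ℝ} {t s : ℝ}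
  {x y : Fin d → ℝ}

/-! #### The control set around the zero section -/

theorem reachA_inter_ctrlA_subset_interior (h : IsAdmissible A B U T) :
    reachA A B U (0, 0) ∩ ctrlA A B U (0, 0) ⊆ interior (centralControlSet A B U T) :=
  interior_maximal (inter_subset_inter_left _ subset_closure)
    (h.isOpen_reachA_zero.inter h.isOpen_ctrlA_zero)

theorem cover_mem_interior (h : IsAdmissible A B U T) (hx : x ∈ reachableSet A B U t)
    (hx' : x ∈ nullSet A B U t) : cover d T (t, x) ∈ interior (centralControlSet A B U T) :=
  h.reachA_inter_ctrlA_subset_interior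
    ⟨h.cover_mem_reachA_zero.2 hx, h.cover_mem_ctrlA_zero.2 hx'⟩

theorem zero_section_subset_interior (h : IsAdmissible A B U T) :
    {p : AddCircle T × (Fin d → ℝ) | p.2 = 0} ⊆ interior (centralControlSet A B U T) := by
  rintro p hp
  obtain ⟨⟨t, x⟩, rfl⟩ := surjective_cover p
  obtain rfl : x = 0 := hp
  exact h.cover_mem_interior (h.zero_mem_reachableSet t) (h.zero_mem_nullSet t)

/-- The closure of the reachable set is positively invariant, and some control keeps the state in
the null set. Since the origin is reachable from each point `p` of the set, Rᵃ(0,0) is contained in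
Rᵃ(p). -/
theorem isPreControlSet_central (h : IsAdmissible A B U T) :
    IsPreControlSet A B U (centralControlSet A B U T) := by
  refine ⟨fun p hp => ?_, fun p hp => ?_⟩
  · obtain ⟨⟨t, x⟩, rfl⟩ := surjective_cover p
    obtain ⟨w, hw, hw'⟩ := h.exists_control_nullSet (h.cover_mem_ctrlA_zero.1 hp.2)
    obtain ⟨c, hc⟩ := h.exists_phiA_cover t
    have hwc := comp_add_right_mem_controls hw c
    refine ⟨_, hwc, fun s hs => ⟨h.phiA_mem_closure
      (fun q hq s hs u hu => h.phiA_mem_reachA hq hs hu) hp.1 hs hwc, ?_⟩⟩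
    rw [(hc w hw.1 s x).1]
    exact h.cover_mem_ctrlA_zero.2 (hw' _ (by linarith))
  · exact inter_subset_left.trans (closure_mono (h.reachA_subset (mem_ctrlA_iff.1 hp.2)))

theorem zero_mem_central (h : IsAdmissible A B U T) : (0, 0) ∈ centralControlSet A B U T :=
  interior_subset (h.zero_section_subset_interior rfl)

/-- Maximality: a larger set lies in the closure of Rᵃ(0,0) because it contains the origin. From
each of its points the origin is approximately reachable, so the open set Cᵃ(0,0) is hit and the
origin is then reached exactly. -/
theorem isControlSet_central (h : IsAdmissible A B U T) :
    IsControlSet A B U (centralControlSet A B U T) := by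
  refine ⟨⟨_, h.zero_mem_central⟩, h.isPreControlSet_central, fun D' hD hD' => ?_⟩
  refine Subset.antisymm (fun p hp => ⟨hD'.2 _ (hD h.zero_mem_central) hp, ?_⟩) hD
  obtain ⟨q, hq, hq'⟩ := mem_closure_iff.1 (hD'.2 p hp (hD h.zero_mem_central)) _
    h.isOpen_ctrlA_zero h.zero_mem_central.2
  exact h.reachA_subset hq' hq

/-! #### Uniqueness -/

/-- Stay in `D` up to time `s` and apply approximate controllability from the point reached there:
the starting point is approximated by its own trajectories at arbitrarily late times. -/
theorem mem_closure_tail (h : IsAdmissible A B U T)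
    {D : Set (AddCircle T × (Fin d → ℝ))} (hD : IsPreControlSet A B U D)
    (hp : cover d T (t, x) ∈ D) (hs : 0 ≤ s) :
    cover d T (t, x) ∈ closure {q | ∃ r ≥ s, ∃ u ∈ controls U,
      cover d T (t + r, phi A B (t + r) t x u) = q} := by
  obtain ⟨u, hu, hu'⟩ := hD.1 _ hp
  refine closure_mono ?_ (hD.2 _ (hu' s hs) hp)
  obtain ⟨c, hc⟩ := h.exists_phiA_cover t
  rw [(hc u hu.1 s x).2]
  intro q hq
  obtain ⟨r, hr, v, hv, rfl⟩ := h.mem_reachA_cover.1 hq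
  have h1 : phi A B (t + s) t x (fun r => u (r - c)) ∈ reach A B U (t + s) t x :=
    ⟨_, comp_add_right_mem_controls hu (-c), rfl⟩
  obtain ⟨w, hw, hw'⟩ := mem_reach_phi h.memLp_A h.memLp_B (t := t + s + r)
    (mem_uIcc.2 (Or.inl ⟨by linarith, by linarith⟩)) hv h1
  refine ⟨s + r, by linarith, w, hw, ?_⟩
  rw [← add_assoc, hw']

/-- At a late return, the state is a state reached from 0, plus a center-unstable vector, plus the
image of the stable part of `x`. The first two together are reachable and the last has become small.
-/
theorem subset_closure_reachA (h : IsAdmissible A B U T)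
    {D : Set (AddCircle T × (Fin d → ℝ))} (hD : IsPreControlSet A B U D) :
    D ⊆ closure (reachA A B U (0, 0)) := by
  intro p hp
  obtain ⟨⟨t, x⟩, rfl⟩ := surjective_cover p
  rw [Metric.mem_closure_iff]
  intro ε hε
  obtain ⟨h1, h2⟩ := h.stableProj_mem_and t x
  set z := (stableProj A T t).mulVec x
  obtain ⟨N, hN⟩ := Filter.eventually_atTop.1
    ((h.tendsto_fundamental_stable h1).eventually (Metric.ball_mem_nhds 0 (half_pos hε)))
  obtain ⟨_, ⟨r, hr, u, hu, rfl⟩, hd⟩ := Metric.mem_closure_iff.1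
    (h.mem_closure_tail hD hp (le_max_right (N - t) 0)) _ (half_pos hε)
  have hr1 : N ≤ t + r := by linarith [(le_max_left _ _).trans hr]
  have hr0 : 0 ≤ r := (le_max_right _ _).trans hr
  have h3 : phi A B (t + r) t 0 u ∈ reachableSet A B U (t + r) := ⟨t, by linarith, u, hu, rfl⟩
  have h4 := h.add_mem_reachableSet h3 (h.fundamental_mulVec_mem_centerUnstableSpace h2 (t + r))
  refine ⟨_, h.cover_mem_reachA_zero.2 h4, 
    (dist_triangle _ (cover d T (t + r, phi A B (t + r) t x u)) _).trans_lt ?_⟩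
  have h5 : phi A B (t + r) t x u - (phi A B (t + r) t 0 u +
      (fundamental A (t + r) t).mulVec (x - z)) = (fundamental A (t + r) t).mulVec z := by
    rw [phi_eq h.memLp_A h.memLp_B hu.1, Matrix.mulVec_sub]; abel
  have h6 : dist (cover d T (t + r, phi A B (t + r) t x u)) (cover d T (t + r,
      phi A B (t + r) t 0 u + (fundamental A (t + r) t).mulVec (x - z))) < ε / 2 := by
    rw [Prod.dist_eq]
    simp only [cover, dist_self, dist_eq_norm (phi A B (t + r) t x u), h5]
    rw [max_eq_right (norm_nonneg _), ← mem_ball_zero_iff]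
    exact hN _ hr1
  linarith

/-- The backward counterpart: `x` is the sum of a state `c` that the return control steers to 0 and
of the return point `y` carried back to time `t`. The latter is center-stable up to an error `w`
that tends to 0 uniformly over bounded return points. -/
theorem mem_closure_nullSet (h : IsAdmissible A B U T)
    {D : Set (AddCircle T × (Fin d → ℝ))} (hD : IsPreControlSet A B U D)
    (hp : cover d T (t, x) ∈ D) : x ∈ closure (nullSet A B U t) := by
  rw [Metric.mem_closure_iff]
  intro ε hε
  obtain ⟨g, hg, hg'⟩ := h.exists_tendsto_unstable_bound t
  have hx1 : 0 < ‖x‖ + 1 := by positivity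
  obtain ⟨N, hN⟩ := Filter.eventually_atTop.1
    (hg.eventually (Metric.ball_mem_nhds 0 (div_pos hε hx1)))
  -- Distance 1 is enough: the return only has to keep `‖y‖` bounded, while the accuracy comes from
  -- the late time.
  obtain ⟨_, ⟨r, hr, u, hu, rfl⟩, hd⟩ := Metric.mem_closure_iff.1
    (h.mem_closure_tail hD hp (le_max_right N 0)) _ one_pos
  have hr1 : N ≤ r := (le_max_left _ _).trans hr
  have hr0 : 0 ≤ r := (le_max_right _ _).trans hr
  set y := phi A B (t + r) t x u with hy
  have hyx : ‖y‖ ≤ ‖x‖ + 1 := by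
    have h1 : dist x y ≤ dist (cover d T (t, x)) (cover d T (t + r, y)) := le_max_right _ _
    have h2 := norm_le_norm_add_norm_sub' y x
    rw [← dist_eq_norm, dist_comm] at h2
    linarith
  obtain ⟨w, hw, hwn⟩ := hg' r hr0 y
  set c := -(fundamental A t (t + r)).mulVec (phi A B (t + r) t 0 u) with hc
  have h1 : c ∈ nullSet A B U t := by
    refine ⟨t + r, by linarith, (mem_reach_zero_iff h.memLp_A h.memLp_B).2 ⟨u, hu, ?_⟩⟩
    rw [phi_eq h.memLp_A h.memLp_B hu.1, hc, Matrix.mulVec_neg, Matrix.mulVec_mulVec,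
      fundamental_mul h.memLp_A, fundamental_self h.memLp_A, Matrix.one_mulVec, neg_add_cancel]
  have h2 : c + ((fundamental A t (t + r)).mulVec y - w) = x - w := by
    rw [hy, phi_eq h.memLp_A h.memLp_B hu.1, Matrix.mulVec_add, Matrix.mulVec_mulVec,
      fundamental_mul h.memLp_A, fundamental_self h.memLp_A, Matrix.one_mulVec, hc]
    abel
  have h3 := h.add_mem_nullSet h1 hw
  rw [h2] at h3
  refine ⟨_, h3, ?_⟩
  rw [dist_eq_norm, sub_sub_cancel]
  have h4 : |g r| < ε / (‖x‖ + 1) := by simpa using hN r hr1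
  have h5 : 0 ≤ ‖y‖ := norm_nonneg y
  calc ‖w‖ ≤ g r * ‖y‖ := hwn
    _ ≤ |g r| * (‖x‖ + 1) := by gcongr; exact le_abs_self _
    _ < ε / (‖x‖ + 1) * (‖x‖ + 1) := by
        gcongr
    _ = ε := div_mul_cancel₀ _ hx1.ne'

/-- A common point links the two sets: it is approximately reachable from either one, and closures
of reachable sets absorb further reachability. -/
theorem isPreControlSet_union (h : IsAdmissible A B U T)
    {D D' : Set (AddCircle T × (Fin d → ℝ))} (hD : IsPreControlSet A B U D)
    (hD' : IsPreControlSet A B U D') (hne : (D ∩ D').Nonempty) :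
    IsPreControlSet A B U (D ∪ D') := by
  obtain ⟨p, hp, hp'⟩ := hne
  refine ⟨fun q hq => ?_, fun q hq => union_subset ?_ ?_⟩
  · rcases hq with hq | hq
    · obtain ⟨u, hu, h'⟩ := hD.1 q hq
      exact ⟨u, hu, fun t ht => Or.inl (h' t ht)⟩
    · obtain ⟨u, hu, h'⟩ := hD'.1 q hq
      exact ⟨u, hu, fun t ht => Or.inr (h' t ht)⟩
  · rcases hq with hq | hq
    · exact hD.2 q hq
    · exact (hD.2 p hp).trans
        (closure_minimal (h.reachA_subset_closure (hD'.2 q hq hp')) isClosed_closure)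
  · rcases hq with hq | hq
    · exact (hD'.2 p hp').trans
        (closure_minimal (h.reachA_subset_closure (hD.2 q hq hp)) isClosed_closure)
    · exact hD'.2 q hq

theorem eq_central_of_isControlSet (h : IsAdmissible A B U T)
    {D : Set (AddCircle T × (Fin d → ℝ))} (hD : IsControlSet A B U D)
    (hint : (interior D).Nonempty) : D = centralControlSet A B U T := by
  obtain ⟨p, hp⟩ := hint
  obtain ⟨⟨t, x⟩, rfl⟩ := surjective_cover p
  have hx : x ∈ nullSet A B U t := by
    have h1 : x ∈ interior (closure (nullSet A B U t)) := by
      refine mem_interior.2 ⟨(fun y => cover d T (t, y)) ⁻¹' interior D, fun y hy =>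
        h.mem_closure_nullSet hD.2.1 (interior_subset hy),
        isOpen_interior.preimage (continuous_cover.comp (Continuous.prodMk_right t)), hp⟩
    -- An open convex set is the interior of its closure, so approximate null controllability on an
    -- open set becomes exact.
    rwa [(h.convex_nullSet t).interior_closure_eq_interior_of_nonempty_interior
      (by rw [(h.isOpen_nullSet_fiber t).interior_eq]; exact ⟨0, h.zero_mem_nullSet t⟩),
      (h.isOpen_nullSet_fiber t).interior_eq] at h1
  have hpD := interior_subset hp
  have hne : (D ∩ centralControlSet A B U T).Nonempty :=
    ⟨_, hpD, h.subset_closure_reachA hD.2.1 hpD, h.cover_mem_ctrlA_zero.2 hx⟩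
  have hU := h.isPreControlSet_union hD.2.1 h.isPreControlSet_central hne
  rw [← hD.2.2 _ subset_union_left hU]
  exact h.isControlSet_central.2.2 _ subset_union_right hU

/-! #### Spectral bounds -/

theorem Ymat_rep (h : IsAdmissible A B U T) (t : ℝ) :
    Ymat A T (rep (t : AddCircle T)) = fundamental A (t + d * T) t := by
  obtain ⟨n, hn⟩ := exists_rep_eq T t
  unfold Ymat
  rw [hn, ← add_assoc, h.fundamental_add_int, add_comm]

theorem mem_bundleMul_Ymat (h : IsAdmissible A B U T) {S : Set (AddCircle T × (Fin d → ℝ))} :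
    cover d T (t, x) ∈ bundleMul (Ymat A T) S ↔
      ∃ a, cover d T (t, a) ∈ S ∧ x = (fundamental A (t + d * T) t).mulVec a := by
  rw [← h.Ymat_rep]; rfl

theorem mem_bundleMul_Ymat_inv (h : IsAdmissible A B U T)
    {S : Set (AddCircle T × (Fin d → ℝ))} :
    cover d T (t, x) ∈ bundleMul (fun τ => (Ymat A T τ)⁻¹) S ↔
      ∃ a, cover d T (t, a) ∈ S ∧ x = (fundamental A t (t + d * T)).mulVec a := by
  rw [← fundamental_inv h.memLp_A, ← h.Ymat_rep]; rfl

/-- The stable summand is reachable and tolerates center and unstable translations; the unstable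
summand is null controllable and tolerates center and stable ones. The sum therefore lies in both
open sets. -/
theorem bundleSum_subset_interior (h : IsAdmissible A B U T) :
    bundleSum (bundleSum (bundleMul (Ymat A T) (KMinus A B U T)) (centerBundle A T))
      (bundleMul (fun τ => (Ymat A T τ)⁻¹) (KPlus A B U T)) ⊆
      interior (centralControlSet A B U T) := by
  intro p hp
  obtain ⟨⟨t, x⟩, rfl⟩ := surjective_cover p
  obtain ⟨ab, c', hab, hc', hx⟩ := cover_mem_bundleSum.1 hp
  obtain ⟨a', b, ha', hb, hab⟩ := cover_mem_bundleSum.1 hab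
  obtain ⟨a, ha, rfl⟩ := h.mem_bundleMul_Ymat.1 ha'
  obtain ⟨c, hc, rfl⟩ := h.mem_bundleMul_Ymat_inv.1 hc'
  have ha := h.fundamental_mulVec_mem_reachable_stable d (h.cover_mem_KMinus.1 ha)
  have hc := h.fundamental_mulVec_mem_null_unstable d (h.cover_mem_KPlus.1 hc)
  have hb := h.cover_mem_centerBundle.1 hb
  set a' := (fundamental A (t + d * T) t).mulVec a
  set c' := (fundamental A t (t + d * T)).mulVec c
  obtain rfl : x = a' + b + c' := by rw [hx, hab]
  refine h.cover_mem_interior ?_ ?_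
  · exact h.add_mem_reachableSet
      (h.add_mem_reachableSet ha.1 (h.centerSpace_le_centerUnstableSpace t hb))
      (h.unstableSpace_le_centerUnstableSpace t hc.2)
  · rw [add_comm]
    exact h.add_mem_nullSet hc.1 (add_mem (h.stableSpace_le_centerStableSpace t ha.2)
      (h.centerSpace_le_centerStableSpace t hb))

/-- Translation invariance allows removing the center-unstable part from reachable points and the
center-stable part from null controllable ones. The closure falls on K⁻ alone because only the
reachable set is closed up in the control set. -/
theorem central_subset_bundleSum (h : IsAdmissible A B U T) :
    centralControlSet A B U T ⊆ bundleSum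
      (bundleSum (bundleMul (fun τ => (Ymat A T τ)⁻¹) (closure (KMinus A B U T)))
        (centerBundle A T))
      (bundleMul (Ymat A T) (KPlus A B U T)) := by
  intro p hp
  obtain ⟨⟨t, x⟩, rfl⟩ := surjective_cover p
  obtain ⟨h1, h2⟩ := h.stableProj_mem_and t x
  obtain ⟨b, hb, c, hc, hbc⟩ := Submodule.mem_sup.1 (h.centerUnstableSpace_le_sup t h2)
  set z := (stableProj A T t).mulVec x with hz
  refine cover_mem_bundleSum.2 ⟨z + b, c, cover_mem_bundleSum.2 ⟨z, b, h.mem_bundleMul_Ymat_inv.2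
    ⟨(fundamental A (t + d * T) t).mulVec z, ?_, ?_⟩, h.cover_mem_centerBundle.2 hb, rfl⟩,
    h.mem_bundleMul_Ymat.2 ⟨(fundamental A t (t + d * T)).mulVec c, h.cover_mem_KPlus.2
      (h.fundamental_mulVec_mem_null_unstable d ⟨?_, hc⟩), ?_⟩, ?_⟩
  · have hF : Continuous fun p : ℝ × (Fin d → ℝ) => (p.1,
        (fundamental A (p.1 + d * T) p.1).mulVec ((stableProj A T p.1).mulVec p.2)) :=
      continuous_fst.prodMk
        (((continuous_fundamental h.memLp_A).comp
          ((continuous_fst.add continuous_const).prodMk continuous_fst)).matrix_mulVec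
          ((h.continuous_stableProj.comp continuous_fst).matrix_mulVec continuous_snd))
    have hp' : (t, x) ∈ closure (cover d T ⁻¹' reachA A B U (0, 0)) := by
      rw [← preimage_closure_cover]; exact hp.1
    have := map_mem_closure hF hp' (t := cover d T ⁻¹' KMinus A B U T) fun q hq => by
      obtain ⟨h3, h4⟩ := h.stableProj_mem_and q.1 q.2
      refine h.cover_mem_KMinus.2 (h.fundamental_mulVec_mem_reachable_stable d ⟨?_, h3⟩)
      have h5 := h.add_mem_reachableSet (h.cover_mem_reachA_zero.1 hq) (neg_mem h4)
      rwa [neg_sub, add_sub_cancel] at h5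
    rwa [← preimage_closure_cover] at this
  · rw [Matrix.mulVec_mulVec, fundamental_mul h.memLp_A, fundamental_self h.memLp_A,
      Matrix.one_mulVec]
  · have h3 := h.add_mem_nullSet (h.cover_mem_ctrlA_zero.1 hp.2)
      (neg_mem (add_mem (h.stableSpace_le_centerStableSpace t h1)
        (h.centerSpace_le_centerStableSpace t hb)))
    convert h3 using 1
    rw [← sub_eq_add_neg, ← sub_sub, ← hbc, add_sub_cancel_left]
  · rw [Matrix.mulVec_mulVec, fundamental_mul h.memLp_A, fundamental_self h.memLp_A,
      Matrix.one_mulVec]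
  · rw [add_assoc, hbc, add_sub_cancel]

theorem isBounded_central (h : IsAdmissible A B U T)
    (hc : ∀ p ∈ centerBundle A T, p.2 = 0) :
    Bornology.IsBounded (centralControlSet A B U T) := by
  obtain ⟨C₁, hC₁⟩ := h.isBounded_KMinus.closure.exists_norm_le
  obtain ⟨C₂, hC₂⟩ := h.isBounded_KPlus.exists_norm_le
  obtain ⟨L, hL0, hL⟩ := h.exists_fundamental_bound (d * T)
  have hdT : 0 ≤ d * T := mul_nonneg d.cast_nonneg h.pos.le
  refine isBounded_of_cover_bound (C := L * C₁ + L * C₂) fun t _ x hx => ?_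
  obtain ⟨ab, c', hab, hc', hx⟩ := cover_mem_bundleSum.1 (h.central_subset_bundleSum hx)
  obtain ⟨a', b, ha', hb, hab⟩ := cover_mem_bundleSum.1 hab
  obtain ⟨a, ha, rfl⟩ := h.mem_bundleMul_Ymat_inv.1 ha'
  obtain ⟨c, hc, rfl⟩ := h.mem_bundleMul_Ymat.1 hc'
  obtain rfl : b = 0 := ‹∀ p ∈ centerBundle A T, p.2 = 0› _ hb
  obtain rfl : x = (fundamental A t (t + d * T)).mulVec a +
      (fundamental A (t + d * T) t).mulVec c := by
    rw [hx, hab, add_zero]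
  have ha1 : ‖a‖ ≤ C₁ := (norm_snd_le _).trans (hC₁ _ ha)
  have hc1 : ‖c‖ ≤ C₂ := (norm_snd_le _).trans (hC₂ _ hc)
  refine (norm_add_le _ _).trans (add_le_add ((hL _ _ ?_ _).trans ?_) ((hL _ _ ?_ _).trans ?_))
  · rw [sub_add_cancel_left, abs_neg, abs_of_nonneg hdT]
  · gcongr
  · rw [add_sub_cancel_left, abs_of_nonneg hdT]
  · gcongr

/-- A nonzero center vector can be added to 0 with any real factor without leaving either the
reachable or the null set. -/
theorem not_isBounded_interior_iff (h : IsAdmissible A B U T) :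
    ¬ Bornology.IsBounded (interior (centralControlSet A B U T)) ↔
      ∃ p ∈ centerBundle A T, p.2 ≠ 0 := by
  constructor
  · intro hb
    by_contra! hc
    exact hb ((h.isBounded_central hc).subset interior_subset)
  · rintro ⟨p, hp, hp0⟩ hb
    obtain ⟨⟨t, x⟩, rfl⟩ := surjective_cover p
    have hx := h.cover_mem_centerBundle.1 hp
    have hx0 : 0 < ‖x‖ := norm_pos_iff.2 hp0
    obtain ⟨R, hR0, hR⟩ := hb.exists_pos_norm_le
    have hcx := Submodule.smul_mem _ ((R + 1) / ‖x‖) hx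
    have h1 := h.add_mem_reachableSet (h.zero_mem_reachableSet t)
      (h.centerSpace_le_centerUnstableSpace t hcx)
    have h2 := h.add_mem_nullSet (h.zero_mem_nullSet t)
      (h.centerSpace_le_centerStableSpace t hcx)
    have h3 := (norm_snd_le _).trans (hR _ (h.cover_mem_interior h1 h2))
    simp only [cover, zero_add, norm_smul, norm_div, norm_norm] at h3
    rw [Real.norm_of_nonneg (by positivity), div_mul_cancel₀ _ hx0.ne'] at h3
    linarith

end IsAdmissible

end PeriodicControl

/-! ### The theorem. -/

open PeriodicControl in
theorem mainTheorem1 (d m : ℕ) (T : ℝ) [Fact (0 < T)]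
    (A : ℝ → Matrix (Fin d) (Fin d) ℝ) (B : ℝ → Matrix (Fin d) (Fin m) ℝ)
    (hA : ∀ i j, MemLp (fun t => A t i j) ⊤ volume)
    (hB : ∀ i j, MemLp (fun t => B t i j) ⊤ volume)
    (hAT : ∀ᵐ t, A (t + T) = A t) (hBT : ∀ᵐ t, B (t + T) = B t)
    (U : Set (Fin m → ℝ)) (hUb : Bornology.IsBounded U) (hUc : Convex ℝ U)
    (hU0 : U ∈ nhds (0 : Fin m → ℝ))
    (hctrl : IsControllable A B) :
    ∃ D : Set (AddCircle T × (Fin d → ℝ)),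
      (IsControlSet A B U D ∧ (interior D).Nonempty) ∧
      (∀ D' : Set (AddCircle T × (Fin d → ℝ)),
        IsControlSet A B U D' → (interior D').Nonempty → D' = D) ∧
      D = closure (reachA A B U (0, 0)) ∩ ctrlA A B U (0, 0) ∧
      {p : AddCircle T × (Fin d → ℝ) | p.2 = 0} ⊆ interior D ∧
      Bornology.IsBounded (KMinus A B U T) ∧
      Bornology.IsBounded (KPlus A B U T) ∧
      bundleSum (bundleSum (bundleMul (Ymat A T) (KMinus A B U T)) (centerBundle A T))
        (bundleMul (fun τ => (Ymat A T τ)⁻¹) (KPlus A B U T)) ⊆ interior D ∧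
      D ⊆ bundleSum
        (bundleSum (bundleMul (fun τ => (Ymat A T τ)⁻¹) (closure (KMinus A B U T)))
          (centerBundle A T))
        (bundleMul (Ymat A T) (KPlus A B U T)) ∧
      (¬ Bornology.IsBounded (interior D) ↔ ∃ p ∈ centerBundle A T, p.2 ≠ 0) := by
  have hT : 0 < T := Fact.out
  have h : IsAdmissible A B U T :=
    hctrl.isAdmissible hT hA hB hAT hBT hUb hUc hU0
  exact ⟨centralControlSet A B U T,
    ⟨h.isControlSet_central, ⟨_, h.zero_section_subset_interior (a := (0, 0)) rfl⟩⟩,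
    fun D' hD' hint => h.eq_central_of_isControlSet hD' hint, rfl,
    h.zero_section_subset_interior, h.isBounded_KMinus, h.isBounded_KPlus,
    h.bundleSum_subset_interior, h.central_subset_bundleSum, h.not_isBounded_interior_iff⟩
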